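/- For complex numbers $x,q$ put $(x;q)_n=\prod_{k=0}^{n-1}(1-xq^k)$ and, if $|q|<1$, $(x;q)_\infty=\prod_{k\ge 0}(1-xq^k)$. For $|q|<1$ define the eighth order mock theta functions $$S_0(q)=\sum_{n\ge0}\frac{q^{n^2}(-q;q^2)_n}{(-q^2;q^2)_n},\qquad S_1(q)=\sum_{n\ge0}\frac{q^{n(n+2)}(-q;q^2)_n}{(-q^2;q^2)_n},$$ $$T_0(q)=\sum_{n\ge0}\frac{q^{(n+1)(n+2)}(-q^2;q^2)_n}{(-q;q^2)_{n+1}},\qquad T_1(q)=\sum_{n\ge0}\frac{q^{n(n+1)}(-q^2;q^2)_n}{(-q;q^2)_{n+1}},$$ $$V_0(q)=-1+2\sum_{n\ge0}\frac{q^{n^2}(-q;q^2)_n}{(q;q^2)_n},\qquad V_1(q)=\sum_{n\ge0}\frac{q^{(n+1)^2}(-q;q^2)_n}{(q;q^2)_{n+1}}.$$ **Theorem.** Let $q\in\mathbb C$ with $|q|<1$. Then all the series above and below converge absolutely, and $$S_0(q)=\frac{(-q;q^2)_\infty}{(q^2;q^2)_\infty}\sum_{n=0}^\infty q^{4n^2+n}(1-q^{6n+3})\sum_{j=-n}^n(-1)^jq^{-2j^2},$$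 $$S_1(q)=\frac{(-q;q^2)_\infty}{(q^2;q^2)_\infty}\sum_{n=0}^\infty q^{4n^2+3n}(1-q^{2n+1})\sum_{j=-n}^n(-1)^jq^{-2j^2},$$ $$T_0(q)=q^2\frac{(-q^2;q^2)_\infty}{(q^2;q^2)_\infty}\sum_{n=0}^\infty q^{4n^2+7n}(1-q^{2n+2})\sum_{j=-n-1}^n(-1)^jq^{-2j^2-3j},$$ $$T_1(q)=\frac{(-q^2;q^2)_\infty}{(q^2;q^2)_\infty}\sum_{n=0}^\infty q^{4n^2+3n}(1-q^{2n+1})\sum_{j=-n}^n(-1)^jq^{-2j^2-j},$$ $$V_0(q)=-1+2\frac{(-q;q^2)_\infty}{(q^2;q^2)_\infty}\sum_{n=0}^\infty(-1)^nq^{4n^2+2n}\sum_{j=0}^{2n}q^{-\binom{j+1}2}(1+q^{4n+2}),$$ $$V_1(q)=q\frac{(-q;q^2)_\infty}{(q^2;q^2)_\infty}\sum_{n=0}^\infty(-1)^nq^{4n^2+4n}\sum_{j=-n}^nq^{-2j^2-j},$$ $$V_1(q)=q\frac{(-q;q)_\infty}{(q;q)_\infty}\sum_{n=0}^\infty(-1)^n\frac{1-q^{2n+1}}{1+q^{4n+2}}\,q^{n^2+2n}.$$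 Furthermore, the last representation is equivalent to the Gordon–McIntosh representation of $V_1$, that is, their right-hand sides agree: $$q\frac{(-q;q)_\infty}{(q;q)_\infty}\sum_{n=0}^\infty(-1)^n\frac{1-q^{2n+1}}{1+q^{4n+2}}\,q^{n^2+2n}=\frac{(-q^4;q^4)_\infty}{(q^4;q^4)_\infty}\sum_{n=-\infty}^\infty\frac{(-1)^nq^{(2n+1)^2}}{1-q^{4n+1}}.$$ (At $q=0$ each summand containing negative powers of $q$ is understood through its limit as $q\to0$.) -/

import Mathlib

noncomputable section

namespace MockTheta8

/-- The finite `q`-shifted factorial `(x; q)_n = ∏_{k=0}^{n-1} (1 - x q^k)`. -/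
def qPoch (x q : ℂ) (n : ℕ) : ℂ := ∏ k ∈ Finset.range n, (1 - x * q ^ k)

/-- The infinite `q`-shifted factorial `(x; q)_∞ = ∏_{k=0}^∞ (1 - x q^k)`, for `|q| < 1`. -/
def qPochInf (x q : ℂ) : ℂ := ∏' k : ℕ, (1 - x * q ^ k)

/-- For `|q| < 1` the product defining `(x; q)_∞` converges unconditionally. -/
theorem multipliable_qPochInf (x q : ℂ) (hq : ‖q‖ < 1) :
    Multipliable fun k : ℕ => 1 - x * q ^ k := by
  have h : Summable fun k : ℕ => ‖-(x * q ^ k)‖ := by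
    simpa [norm_mul, norm_pow] using
      (summable_geometric_of_lt_one (norm_nonneg q) hq).mul_left ‖x‖
  simpa [sub_eq_add_neg] using multipliable_one_add_of_summable h

/-! Summands of the Eulerian series defining the eighth order mock theta functions,
and the functions themselves. -/

def S0Term (q : ℂ) (n : ℕ) : ℂ :=
  q ^ (n ^ 2) * qPoch (-q) (q ^ 2) n / qPoch (-q ^ 2) (q ^ 2) n

def S1Term (q : ℂ) (n : ℕ) : ℂ :=
  q ^ (n * (n + 2)) * qPoch (-q) (q ^ 2) n / qPoch (-q ^ 2) (q ^ 2) n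

def T0Term (q : ℂ) (n : ℕ) : ℂ :=
  q ^ ((n + 1) * (n + 2)) * qPoch (-q ^ 2) (q ^ 2) n / qPoch (-q) (q ^ 2) (n + 1)

def T1Term (q : ℂ) (n : ℕ) : ℂ :=
  q ^ (n * (n + 1)) * qPoch (-q ^ 2) (q ^ 2) n / qPoch (-q) (q ^ 2) (n + 1)

def V0Term (q : ℂ) (n : ℕ) : ℂ :=
  q ^ (n ^ 2) * qPoch (-q) (q ^ 2) n / qPoch q (q ^ 2) n

def V1Term (q : ℂ) (n : ℕ) : ℂ :=
  q ^ ((n + 1) ^ 2) * qPoch (-q) (q ^ 2) n / qPoch q (q ^ 2) (n + 1)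

def S0 (q : ℂ) : ℂ := ∑' n : ℕ, S0Term q n

def S1 (q : ℂ) : ℂ := ∑' n : ℕ, S1Term q n

def T0 (q : ℂ) : ℂ := ∑' n : ℕ, T0Term q n

def T1 (q : ℂ) : ℂ := ∑' n : ℕ, T1Term q n

def V0 (q : ℂ) : ℂ := -1 + 2 * ∑' n : ℕ, V0Term q n

def V1 (q : ℂ) : ℂ := ∑' n : ℕ, V1Term q n

/-! Summands (in the outer variable `n`) of the Hecke-type series. -/

def S0Hecke (q : ℂ) (n : ℕ) : ℂ :=
  q ^ (4 * n ^ 2 + n) * (1 - q ^ (6 * n + 3)) *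
    ∑ j ∈ Finset.Icc (-(n : ℤ)) (n : ℤ), (-1 : ℂ) ^ j * q ^ (-2 * j ^ 2)

def S1Hecke (q : ℂ) (n : ℕ) : ℂ :=
  q ^ (4 * n ^ 2 + 3 * n) * (1 - q ^ (2 * n + 1)) *
    ∑ j ∈ Finset.Icc (-(n : ℤ)) (n : ℤ), (-1 : ℂ) ^ j * q ^ (-2 * j ^ 2)

def T0Hecke (q : ℂ) (n : ℕ) : ℂ :=
  q ^ (4 * n ^ 2 + 7 * n) * (1 - q ^ (2 * n + 2)) *
    ∑ j ∈ Finset.Icc (-(n : ℤ) - 1) (n : ℤ), (-1 : ℂ) ^ j * q ^ (-2 * j ^ 2 - 3 * j)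

def T1Hecke (q : ℂ) (n : ℕ) : ℂ :=
  q ^ (4 * n ^ 2 + 3 * n) * (1 - q ^ (2 * n + 1)) *
    ∑ j ∈ Finset.Icc (-(n : ℤ)) (n : ℤ), (-1 : ℂ) ^ j * q ^ (-2 * j ^ 2 - j)

def V0Hecke (q : ℂ) (n : ℕ) : ℂ :=
  (-1) ^ n * q ^ (4 * n ^ 2 + 2 * n) *
    ∑ j ∈ Finset.range (2 * n + 1),
      q ^ (-((j + 1).choose 2 : ℤ)) * (1 + q ^ (4 * n + 2))

def V1Hecke (q : ℂ) (n : ℕ) : ℂ :=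
  (-1) ^ n * q ^ (4 * n ^ 2 + 4 * n) *
    ∑ j ∈ Finset.Icc (-(n : ℤ)) (n : ℤ), q ^ (-2 * j ^ 2 - j)

/-! Summands of the two Appell-Lerch series for `V1`: the one-sided one, and the
bilateral one of Gordon and McIntosh. -/

def V1Appell (q : ℂ) (n : ℕ) : ℂ :=
  (-1) ^ n * ((1 - q ^ (2 * n + 1)) / (1 + q ^ (4 * n + 2))) * q ^ (n ^ 2 + 2 * n)

def V1GordonMcIntosh (q : ℂ) (n : ℤ) : ℂ :=
  (-1 : ℂ) ^ n * q ^ ((2 * n + 1) ^ 2) / (1 - q ^ (4 * n + 1))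

end MockTheta8

end

/-!
All the representations come from Bailey's lemma applied to explicit Bailey pairs, with base `q²`
or `q⁴`.

*Bailey's lemma.* A pair `(α, β)` with `β n = ∑_{r ≤ n} α r / ((q; q)_{n-r} (aq; q)_{n+r})`
satisfies a transformation from a sum over `β` to a sum over `α` (`bailey_lemma`). Interchanging
the two summations reduces it to the `q`-Gauss sum (`gauss_sum`), which follows from a telescoping
contiguous relation `c ↦ cq` iterated to the limit `c q^N → 0`. The parameters `ρ₁, ρ₂` enter
through their reciprocals `d, e`, so that `ρ₁ → ∞` is the substitution `d = 0`
(`bailey_lemma_limit`).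

*Hecke-type series.* The Eulerian series with denominators `(bq; q)_n` are `β` sides for the pairs
of `isBaileyPair_of_recurrence`. There `β n = 1 / (bq; q)_n` is determined by
`(1 - b q^n) β n = β (n - 1)`, and the sums defined by `α` obey the same recurrence because their
partial sums have a closed form. Here `α` is a hypergeometric factor times the partial sums of a
theta-like series, and the latter become the inner sums over `j` (`isBaileyPair_thetaS`,
`isBaileyPair_thetaT`, `isBaileyPair_thetaT'`, `isBaileyPair_thetaV`). For `S₁`, `T₀`, `T₁` and
`V₁` these pairs are inserted directly. For `S₀` and `V₀` a pair relative to `a = q²` is first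
lowered to `a = 1` (`IsBaileyPair.lower`); a shift of the summation index then merges the two parts
of the lowered `α`.

*Appell–Lerch series.* The series `∑ q^{n(n+1)/2} xⁿ (-x; q)_n / (x; q)_{n+1}` has two other
Eulerian forms. The three series satisfy the same inhomogeneous second order `q`-difference
equation in `x`, whose bounded solution along `x, xq, xq², …` is unique (`tsum_eq_of_qDiffEq`).
In base `q²` and at `x = q` the first form is `V₁ / q`. Bailey's lemma with the pair
`β n = 1 / ((y; q)_{n+1} (w; q)_{n+1})`, `yw = q` (`isBaileyPair_appell`), turns the second form
into the one-sided Appell–Lerch series (`V1_eq_appell`) and the third one into the Gordon–McIntosh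
series (`V1_eq_gordonMcIntosh`). So both right-hand sides equal `V₁`.

Bailey's lemma uses `q ≠ 0`; at `q = 0` every one-sided series reduces to its first term, and every
term of the Gordon–McIntosh series vanishes.
-/

noncomputable section

namespace MockTheta8

open Filter Topology

/-! ### The `q`-shifted factorials -/

@[simp] lemma qPoch_zero (x q : ℂ) : qPoch x q 0 = 1 := by simp [qPoch]

lemma qPoch_succ (x q : ℂ) (n : ℕ) :
    qPoch x q (n + 1) = qPoch x q n * (1 - x * q ^ n) := by
  simp [qPoch, Finset.prod_range_succ]

lemma qPoch_add (x q : ℂ) (m n : ℕ) :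
    qPoch x q (m + n) = qPoch x q m * qPoch (x * q ^ m) q n := by
  simp only [qPoch, Finset.prod_range_add]
  congr 1
  refine Finset.prod_congr rfl fun k _ => ?_
  rw [pow_add]; ring

lemma qPoch_succ' (x q : ℂ) (n : ℕ) :
    qPoch x q (n + 1) = (1 - x) * qPoch (x * q) q n := by
  rw [add_comm, qPoch_add]; simp [qPoch]

lemma qPoch_ne_zero {x q : ℂ} (h : ∀ k : ℕ, x * q ^ k ≠ 1) (n : ℕ) : qPoch x q n ≠ 0 :=
  Finset.prod_ne_zero_iff.2 fun k _ => sub_ne_zero.2 (h k).symm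

/-- Pairing the factors of `(x; q)_{2n}` by the parity of their index. -/
lemma qPoch_two_mul (x q : ℂ) (n : ℕ) :
    qPoch x q (2 * n) = qPoch x (q ^ 2) n * qPoch (x * q) (q ^ 2) n := by
  induction n with
  | zero => simp
  | succ n ih =>
    rw [show 2 * (n + 1) = 2 * n + 1 + 1 by ring, qPoch_succ, qPoch_succ, ih, qPoch_succ,
      qPoch_succ]
    ring

lemma qPoch_mul_qPoch_neg (x q : ℂ) (n : ℕ) :
    qPoch x q n * qPoch (-x) q n = qPoch (x ^ 2) (q ^ 2) n := by
  simp only [qPoch, ← Finset.prod_mul_distrib]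
  refine Finset.prod_congr rfl fun k _ => ?_
  ring

lemma tendsto_qPoch (x : ℂ) {q : ℂ} (hq : ‖q‖ < 1) :
    Tendsto (qPoch x q) atTop (𝓝 (qPochInf x q)) :=
  (multipliable_qPochInf x q hq).hasProd.tendsto_prod_nat

lemma qPochInf_ne_zero {x q : ℂ} (hq : ‖q‖ < 1) (h : ∀ k : ℕ, x * q ^ k ≠ 1) :
    qPochInf x q ≠ 0 := by
  have hs : Summable fun k : ℕ => ‖-(x * q ^ k)‖ := by
    simpa [norm_mul, norm_pow] using
      (summable_geometric_of_lt_one (norm_nonneg q) hq).mul_left ‖x‖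
  have := tprod_one_add_ne_zero_of_summable (f := fun k : ℕ => -(x * q ^ k))
    (fun k => by simpa [← sub_eq_add_neg, sub_eq_zero] using (h k).symm) hs
  simpa [qPochInf, sub_eq_add_neg] using this

lemma qPochInf_eq_mul (x : ℂ) {q : ℂ} (hq : ‖q‖ < 1) (n : ℕ) :
    qPochInf x q = qPoch x q n * qPochInf (x * q ^ n) q := by
  have h1 : Tendsto (fun m => qPoch x q (n + m)) atTop (𝓝 (qPochInf x q)) := by
    simpa [add_comm] using (tendsto_add_atTop_iff_nat n).2 (tendsto_qPoch x hq)
  have h2 := (tendsto_qPoch (x * q ^ n) hq).const_mul (qPoch x q n)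
  simp only [qPoch_add] at h1
  exact tendsto_nhds_unique h1 h2

lemma qPochInf_eq_one_sub_mul (x : ℂ) {q : ℂ} (hq : ‖q‖ < 1) :
    qPochInf x q = (1 - x) * qPochInf (x * q) q := by
  have := qPochInf_eq_mul x hq 1
  simpa [qPoch] using this

lemma norm_sq_lt_one {q : ℂ} (hq : ‖q‖ < 1) : ‖q ^ 2‖ < 1 := by
  rw [norm_pow]; exact pow_lt_one₀ (norm_nonneg q) hq two_ne_zero

lemma qPochInf_eq_even_mul_odd (x : ℂ) {q : ℂ} (hq : ‖q‖ < 1) :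
    qPochInf x q = qPochInf x (q ^ 2) * qPochInf (x * q) (q ^ 2) := by
  have h1 : Tendsto (fun n => qPoch x q (2 * n)) atTop (𝓝 (qPochInf x q)) :=
    (tendsto_qPoch x hq).comp (tendsto_id.const_mul_atTop' two_pos)
  simp only [qPoch_two_mul] at h1
  exact tendsto_nhds_unique h1
    ((tendsto_qPoch x (norm_sq_lt_one hq)).mul (tendsto_qPoch (x * q) (norm_sq_lt_one hq)))

lemma exists_norm_qPoch_le (x : ℂ) {q : ℂ} (hq : ‖q‖ < 1) :
    ∃ C : ℝ, 0 ≤ C ∧ ∀ n, ‖qPoch x q n‖ ≤ C := by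
  obtain ⟨C, hC⟩ := (tendsto_qPoch x hq).norm.bddAbove_range
  exact ⟨C, (norm_nonneg _).trans (hC ⟨0, rfl⟩), fun n => hC ⟨n, rfl⟩⟩

lemma exists_norm_inv_qPoch_le {x q : ℂ} (hq : ‖q‖ < 1) (h : ∀ k : ℕ, x * q ^ k ≠ 1) :
    ∃ C : ℝ, 0 ≤ C ∧ ∀ n, ‖(qPoch x q n)⁻¹‖ ≤ C := by
  obtain ⟨C, hC⟩ := ((tendsto_qPoch x hq).inv₀ (qPochInf_ne_zero hq h)).norm.bddAbove_range
  exact ⟨C, (norm_nonneg _).trans (hC ⟨0, rfl⟩), fun n => hC ⟨n, rfl⟩⟩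

lemma mul_pow_ne_one {x q : ℂ} (hx : ‖x‖ < 1) (hq : ‖q‖ < 1) (k : ℕ) : x * q ^ k ≠ 1 := by
  intro h
  have h1 : ‖x * q ^ k‖ < 1 := by
    rw [norm_mul, norm_pow]
    exact (mul_le_of_le_one_right (norm_nonneg x)
      (pow_le_one₀ (norm_nonneg q) hq.le)).trans_lt hx
  rw [h] at h1
  simp at h1

/-- A series whose consecutive terms satisfy `f (n + 1) = ρ n * f n` with `ρ n → l`, `‖l‖ < 1`,
converges; unlike in the usual ratio test, terms may vanish. -/
lemma summable_of_ratio_tendsto {f ρ : ℕ → ℂ} {l : ℂ} (hl : ‖l‖ < 1)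
    (hρ : Tendsto ρ atTop (𝓝 l)) (h : ∀ n, f (n + 1) = ρ n * f n) : Summable f := by
  obtain ⟨r, hr1, hr2⟩ := exists_between hl
  refine summable_of_ratio_norm_eventually_le hr2 ?_
  filter_upwards [hρ.norm.eventually (gt_mem_nhds hr1)] with n hn
  rw [h, norm_mul]
  exact mul_le_mul_of_nonneg_right hn.le (norm_nonneg _)

lemma tendsto_pow_zero {q : ℂ} (hq : ‖q‖ < 1) : Tendsto (fun n : ℕ => q ^ n) atTop (𝓝 0) :=
  tendsto_pow_atTop_nhds_zero_of_norm_lt_one hq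

/-- `revPoch d q n = ∏_{k<n} (d - q^k)`, which is `dⁿ (1/d; q)_n` for `d ≠ 0`. The parameter
`d = 1/ρ` makes the limit `ρ → ∞` in summation formulas the substitution `d = 0`. -/
def revPoch (d q : ℂ) (n : ℕ) : ℂ := ∏ k ∈ Finset.range n, (d - q ^ k)

@[simp] lemma revPoch_zero (d q : ℂ) : revPoch d q 0 = 1 := by simp [revPoch]

lemma revPoch_succ (d q : ℂ) (n : ℕ) :
    revPoch d q (n + 1) = revPoch d q n * (d - q ^ n) := by
  simp [revPoch, Finset.prod_range_succ]

lemma revPoch_add (d : ℂ) {q : ℂ} (hq : q ≠ 0) (r m : ℕ) :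
    revPoch d q (r + m) = revPoch d q r * (q ^ (r * m) * revPoch (d / q ^ r) q m) := by
  induction m with
  | zero => simp
  | succ m ih =>
    rw [← add_assoc, revPoch_succ, ih, revPoch_succ]
    have : q ^ r ≠ 0 := pow_ne_zero _ hq
    field_simp
    ring

lemma summable_revPoch (d e c : ℂ) {q : ℂ} (hq : ‖q‖ < 1) (h : ‖c * d * e‖ < 1) :
    Summable fun n => revPoch d q n * revPoch e q n * c ^ n := by
  refine summable_of_ratio_tendsto (ρ := fun n => (d - q ^ n) * (e - q ^ n) * c)
    (l := (d - 0) * (e - 0) * c) ?_ ?_ ?_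
  · convert h using 2; ring
  · have := tendsto_pow_zero hq
    exact ((this.const_sub d).mul (this.const_sub e)).mul_const c
  · intro n; rw [revPoch_succ, revPoch_succ]; ring

lemma tsum_eq_of_telescope {u G : ℕ → ℂ} (hu : Summable u) (h : ∀ n, u n = G (n + 1) - G n)
    (hG : Tendsto G atTop (𝓝 0)) : ∑' n, u n = - G 0 := by
  have h1 := hu.hasSum.tendsto_sum_nat
  simp only [h, Finset.sum_range_sub] at h1
  simp only [h]
  have h2 := hG.sub_const (G 0)
  rw [zero_sub] at h2
  exact tendsto_nhds_unique h1 h2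

/-! ### The `q`-Gauss sum -/

/-- Summand of the `q`-Gauss series `₂φ₁(1/d, 1/e; c; q, cde)`. -/
def gaussTerm (d e c q : ℂ) (n : ℕ) : ℂ :=
  revPoch d q n * revPoch e q n * c ^ n / (qPoch q q n * qPoch c q n)

lemma qPoch_self_ne_zero {q : ℂ} (hq : ‖q‖ < 1) (n : ℕ) : qPoch q q n ≠ 0 :=
  qPoch_ne_zero (mul_pow_ne_one hq hq) n

lemma summable_gaussTerm (d e : ℂ) {c q : ℂ} (hq : ‖q‖ < 1) (h : ‖c * d * e‖ < 1)
    (hc : ∀ k : ℕ, c * q ^ k ≠ 1) : Summable (gaussTerm d e c q) := by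
  obtain ⟨A, hA0, hA⟩ := exists_norm_inv_qPoch_le hq (mul_pow_ne_one hq hq)
  obtain ⟨B, hB0, hB⟩ := exists_norm_inv_qPoch_le hq hc
  refine Summable.of_norm_bounded ((summable_revPoch d e c hq h).norm.mul_right (A * B)) fun n => ?_
  rw [gaussTerm, div_eq_mul_inv, norm_mul, mul_inv, norm_mul _⁻¹]
  gcongr
  · exact hA n
  · exact hB n

/-- The contiguous relation between the `q`-Gauss series at `c` and at `cq`. -/
lemma gauss_contiguous (d e : ℂ) {c q : ℂ} (hq : ‖q‖ < 1) (h : ‖c * d * e‖ < 1)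
    (hc : ∀ k : ℕ, c * q ^ k ≠ 1) :
    (1 - c * d * e) * ∑' n, gaussTerm d e c q n * (1 - c)  =
      (1 - c * d) * (1 - c * e) * ∑' n, gaussTerm d e (c * q) q n := by
  have hc' : ∀ k : ℕ, c * q * q ^ k ≠ 1 := fun k => by
    have := hc (k + 1); rwa [pow_succ', ← mul_assoc] at this
  have h' : ‖c * q * d * e‖ < 1 := by
    rw [show c * q * d * e = (c * d * e) * q by ring, norm_mul]
    exact mul_lt_one_of_nonneg_of_lt_one_left (norm_nonneg _) h hq.le
  have s1 := summable_gaussTerm d e hq h hc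
  have s2 := summable_gaussTerm d e hq h' hc'
  have hc0 : 1 - c ≠ 0 := by have := hc 0; rw [pow_zero, mul_one] at this; exact sub_ne_zero.2 this.symm
  have key := tsum_eq_of_telescope
    (u := fun n => (1 - c * d * e) * (gaussTerm d e c q n * (1 - c)) -
      (1 - c * d) * (1 - c * e) * gaussTerm d e (c * q) q n)
    -- the difference of the two summands is `G (n + 1) - G n` for this multiple `G` of `gaussTerm`
    (G := fun n => -(1 - c) * (1 - q ^ n) * gaussTerm d e c q n)
    (((s1.mul_right _).mul_left _).sub (s2.mul_left _)) ?_ ?_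
  · rw [((s1.mul_right _).mul_left _).tsum_sub (s2.mul_left _), tsum_mul_left, tsum_mul_left] at key
    simp at key
    exact sub_eq_zero.1 key
  · intro n
    have e1 : qPoch c q n * (1 - c * q ^ n) = (1 - c) * qPoch (c * q) q n := by
      rw [← qPoch_succ, qPoch_succ']
    have hn : 1 - c * q ^ n ≠ 0 := sub_ne_zero.2 (hc n).symm
    have hn' : 1 - q * q ^ n ≠ 0 := sub_ne_zero.2 (mul_pow_ne_one hq hq n).symm
    have hp := qPoch_ne_zero hc n
    have hq' := qPoch_self_ne_zero hq n
    have e2 : qPoch (c * q) q n = qPoch c q n * (1 - c * q ^ n) / (1 - c) := by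
      rw [e1]; field_simp
    simp only [gaussTerm, qPoch_succ, revPoch_succ, e2, mul_pow, pow_succ]
    rw [mul_comm q (q ^ n)] at hn'
    field_simp
    ring
  · have := (((tendsto_pow_zero hq).const_sub 1).const_mul (-(1 - c))).mul s1.tendsto_atTop_zero
    simpa using this

/-- As `c → 0` along `c q^N` the `q`-Gauss series tends to its first term, by dominated
convergence. -/
lemma tendsto_gauss (d e : ℂ) {c q : ℂ} (hq : ‖q‖ < 1) (h : ‖c * d * e‖ < 1)
    (hc : ∀ k : ℕ, c * q ^ k ≠ 1) :
    Tendsto (fun N : ℕ => ∑' n, gaussTerm d e (c * q ^ N) q n) atTop (𝓝 1) := by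
  obtain ⟨A, hA0, hA⟩ := exists_norm_inv_qPoch_le hq (mul_pow_ne_one hq hq)
  obtain ⟨B, hB0, hB⟩ := exists_norm_inv_qPoch_le hq hc
  obtain ⟨D, hD0, hD⟩ := exists_norm_qPoch_le c hq
  have hbd : ∀ N n, ‖gaussTerm d e (c * q ^ N) q n‖ ≤
      ‖revPoch d q n * revPoch e q n * c ^ n‖ * (A * (D * B)) * ‖(q ^ N) ^ n‖ := by
    intro N n
    have e1 : (qPoch (c * q ^ N) q n)⁻¹ = qPoch c q N * (qPoch c q (N + n))⁻¹ := by
      rw [qPoch_add, mul_inv, mul_inv_cancel_left₀ (qPoch_ne_zero hc N)]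
    rw [gaussTerm, div_eq_mul_inv, mul_inv, e1, mul_pow,
      show revPoch d q n * revPoch e q n * (c ^ n * (q ^ N) ^ n) *
        ((qPoch q q n)⁻¹ * (qPoch c q N * (qPoch c q (N + n))⁻¹)) =
        revPoch d q n * revPoch e q n * c ^ n *
        ((qPoch q q n)⁻¹ * (qPoch c q N * (qPoch c q (N + n))⁻¹)) * (q ^ N) ^ n by ring,
      norm_mul, norm_mul (revPoch d q n * revPoch e q n * c ^ n), norm_mul (qPoch q q n)⁻¹,
      norm_mul (qPoch c q N)]
    gcongr
    · exact hA n
    · exact hD N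
    · exact hB _
  have h1 : ∑' n : ℕ, (if n = 0 then (1 : ℂ) else 0) = 1 := by simp
  rw [← h1]
  refine tendsto_tsum_of_dominated_convergence
    ((summable_revPoch d e c hq h).norm.mul_right (A * (D * B))) (fun n => ?_)
    (Eventually.of_forall fun N n => ?_)
  · rcases Nat.eq_zero_or_pos n with rfl | hn
    · simp [gaussTerm]
    · rw [if_neg hn.ne']
      refine squeeze_zero_norm (fun N => hbd N n) ?_
      have : Tendsto (fun N : ℕ => (q ^ N) ^ n) atTop (𝓝 0) := by
        simpa [hn.ne'] using (tendsto_pow_zero hq).pow n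
      simpa using this.norm.const_mul (‖revPoch d q n * revPoch e q n * c ^ n‖ * (A * (D * B)))
  · refine (hbd N n).trans (mul_le_of_le_one_right (by positivity) ?_)
    rw [norm_pow, norm_pow]
    exact pow_le_one₀ (by positivity) (pow_le_one₀ (norm_nonneg _) hq.le)

/-- The `q`-Gauss sum
`₂φ₁(1/d, 1/e; c; q, cde) = (cd; q)_∞ (ce; q)_∞ / ((c; q)_∞ (cde; q)_∞)`. -/
theorem gauss_sum (d e : ℂ) {c q : ℂ} (hq : ‖q‖ < 1) (h : ‖c * d * e‖ < 1)
    (hc : ∀ k : ℕ, c * q ^ k ≠ 1) :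
    ∑' n, gaussTerm d e c q n = qPochInf (c * d) q * qPochInf (c * e) q /
      (qPochInf c q * qPochInf (c * d * e) q) := by
  have hcde : ∀ k : ℕ, c * d * e * q ^ k ≠ 1 := mul_pow_ne_one h hq
  -- the contiguous relation, iterated `N` times
  have step : ∀ N : ℕ, qPoch c q N * qPoch (c * d * e) q N * ∑' n, gaussTerm d e c q n =
      qPoch (c * d) q N * qPoch (c * e) q N * ∑' n, gaussTerm d e (c * q ^ N) q n := by
    intro N
    induction N with
    | zero => simp
    | succ N ih =>
      have hN : ∀ k : ℕ, c * q ^ N * q ^ k ≠ 1 := fun k => by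
        rw [mul_assoc, ← pow_add]; exact hc _
      have hN' : ‖c * q ^ N * d * e‖ < 1 := by
        rw [show c * q ^ N * d * e = (c * d * e) * q ^ N by ring, norm_mul, norm_pow]
        exact (mul_le_of_le_one_right (norm_nonneg _)
          (pow_le_one₀ (norm_nonneg q) hq.le)).trans_lt h
      have := gauss_contiguous d e hq hN' hN
      rw [tsum_mul_right, show c * q ^ N * q = c * q ^ (N + 1) by ring] at this
      simp only [qPoch_succ]
      linear_combination (1 - c * q ^ N) * (1 - c * d * e * q ^ N) * ih +
        qPoch (c * d) q N * qPoch (c * e) q N * this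
  have l1 := ((tendsto_qPoch c hq).mul (tendsto_qPoch (c * d * e) hq)).mul_const
    (∑' n, gaussTerm d e c q n)
  have l2 := ((tendsto_qPoch (c * d) hq).mul (tendsto_qPoch (c * e) hq)).mul
    (tendsto_gauss d e hq h hc)
  simp only [step] at l1
  have := tendsto_nhds_unique l1 l2
  rw [eq_div_iff (mul_ne_zero (qPochInf_ne_zero hq hc) (qPochInf_ne_zero hq hcde))]
  rw [mul_one] at this
  rw [← this]; ring

/-! ### Bailey pairs and Bailey's lemma -/

/-- `(α, β)` is a Bailey pair relative to `a`, in base `q`. -/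
def IsBaileyPair (a q : ℂ) (α β : ℕ → ℂ) : Prop :=
  ∀ n, β n = ∑ r ∈ Finset.range (n + 1), α r / (qPoch q q (n - r) * qPoch (a * q) q (n + r))

/-- The weight `(1/d; q)_n (1/e; q)_n (aqde)^n` of Bailey's lemma, written so that it also makes
sense for `d = 0` or `e = 0`. -/
def baileyWeight (a q d e : ℂ) (n : ℕ) : ℂ := revPoch d q n * revPoch e q n * (a * q) ^ n

/-- Bailey's lemma, `β` side, for one fixed `α r`: this is the `q`-Gauss sum with
`c = a q^{2r+1}`. -/
lemma tsum_baileyWeight {a q d e : ℂ} (hq : ‖q‖ < 1) (hq0 : q ≠ 0)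
    (ha : ∀ k : ℕ, a * q * q ^ k ≠ 1) (hde : ‖a * q * d * e‖ < 1)
    (hd : ∀ k : ℕ, a * q * d * q ^ k ≠ 1) (he : ∀ k : ℕ, a * q * e * q ^ k ≠ 1) (r : ℕ) :
    ∑' m, baileyWeight a q d e (r + m) / (qPoch q q m * qPoch (a * q) q (r + m + r)) =
      qPochInf (a * q * d) q * qPochInf (a * q * e) q /
        (qPochInf (a * q) q * qPochInf (a * q * d * e) q) *
      (baileyWeight a q d e r / (qPoch (a * q * d) q r * qPoch (a * q * e) q r)) := by
  have hr : q ^ r ≠ 0 := pow_ne_zero _ hq0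
  have hc : ∀ k : ℕ, a * q * q ^ (r + r) * q ^ k ≠ 1 := fun k => by
    rw [mul_assoc, ← pow_add]; exact ha _
  have e1 : a * q * q ^ (r + r) * (d / q ^ r) = a * q * d * q ^ r := by
    rw [pow_add]; field_simp
  have e2 : a * q * q ^ (r + r) * (e / q ^ r) = a * q * e * q ^ r := by
    rw [pow_add]; field_simp
  have e3 : a * q * q ^ (r + r) * (d / q ^ r) * (e / q ^ r) = a * q * d * e := by
    rw [e1]; field_simp
  have hterm : ∀ m, baileyWeight a q d e (r + m) / (qPoch q q m * qPoch (a * q) q (r + m + r)) =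
      baileyWeight a q d e r / qPoch (a * q) q (r + r) *
        gaussTerm (d / q ^ r) (e / q ^ r) (a * q * q ^ (r + r)) q m := by
    intro m
    rw [show r + m + r = (r + r) + m by ring, qPoch_add (a * q)]
    simp only [baileyWeight, gaussTerm, revPoch_add _ hq0]
    have h1 := qPoch_ne_zero ha (r + r)
    have h2 := qPoch_ne_zero hc m
    have h3 := qPoch_self_ne_zero hq m
    have h4 : (a * q * q ^ (r + r)) ^ m = (a * q) ^ m * (q ^ (r * m) * q ^ (r * m)) := by
      rw [mul_pow, ← pow_mul, ← pow_add]; congr 2; ring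
    rw [h4]
    field_simp
    ring
  simp only [hterm]
  rw [tsum_mul_left, gauss_sum _ _ hq (by rw [e3]; exact hde) hc, e3, e1, e2,
    qPochInf_eq_mul (a * q * d) hq r, qPochInf_eq_mul (a * q * e) hq r,
    qPochInf_eq_mul (a * q) hq (r + r)]
  have h1 := qPoch_ne_zero ha (r + r)
  have h2 := qPoch_ne_zero hd r
  have h3 := qPoch_ne_zero he r
  field_simp

/-- Summation of a double series along its antidiagonals. -/
lemma tsum_prod_eq_tsum_range {F : ℕ × ℕ → ℂ} (hF : Summable F) :
    ∑' p, F p = ∑' n, ∑ r ∈ Finset.range (n + 1), F (r, n - r) := by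
  have hF' : Summable fun c : Σ n : ℕ, Finset.HasAntidiagonal.antidiagonal n =>
      F (Finset.HasAntidiagonal.sigmaAntidiagonalEquivProd c) := (Equiv.summable_iff _).2 hF
  rw [← Equiv.tsum_eq (Finset.HasAntidiagonal.sigmaAntidiagonalEquivProd (A := ℕ)) F,
    hF'.tsum_sigma]
  refine tsum_congr fun n => ?_
  rw [tsum_fintype]
  simp only [Finset.HasAntidiagonal.sigmaAntidiagonalEquivProd_apply]
  rw [Finset.sum_coe_sort (Finset.HasAntidiagonal.antidiagonal n) F]
  exact Finset.Nat.sum_antidiagonal_eq_sum_range_succ_mk F n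

/-- Bailey's lemma with parameters `ρ₁ = 1/d`, `ρ₂ = 1/e`: expand `β`, interchange the two sums,
and evaluate the inner one by `tsum_baileyWeight`. -/
theorem bailey_lemma {a q d e : ℂ} {α β : ℕ → ℂ} (hq : ‖q‖ < 1) (hq0 : q ≠ 0)
    (ha : ∀ k : ℕ, a * q * q ^ k ≠ 1) (hde : ‖a * q * d * e‖ < 1)
    (hd : ∀ k : ℕ, a * q * d * q ^ k ≠ 1) (he : ∀ k : ℕ, a * q * e * q ^ k ≠ 1)
    (hα : Summable fun r => ‖α r‖) (h : IsBaileyPair a q α β) :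
    ∑' n, baileyWeight a q d e n * β n =
      qPochInf (a * q * d) q * qPochInf (a * q * e) q /
        (qPochInf (a * q) q * qPochInf (a * q * d * e) q) *
      ∑' r, baileyWeight a q d e r / (qPoch (a * q * d) q r * qPoch (a * q * e) q r) * α r := by
  obtain ⟨A, hA0, hA⟩ := exists_norm_inv_qPoch_le hq (mul_pow_ne_one hq hq)
  obtain ⟨B, hB0, hB⟩ := exists_norm_inv_qPoch_le hq ha
  -- the double series over `(r, m)`, where `n = r + m`
  set F : ℕ × ℕ → ℂ := fun p =>
    baileyWeight a q d e (p.1 + p.2) / (qPoch q q p.2 * qPoch (a * q) q (p.1 + p.2 + p.1)) * α p.1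
    with hF
  have hw : Summable fun n => ‖baileyWeight a q d e n‖ := (summable_revPoch d e (a * q) hq hde).norm
  have hFs : Summable F := by
    have h1 : Summable fun p : ℕ × ℕ => ‖α p.1‖ * ‖baileyWeight a q d e p.2‖ :=
      hα.mul_of_nonneg hw (fun _ => norm_nonneg _) (fun _ => norm_nonneg _)
    have hinj : Function.Injective fun p : ℕ × ℕ => (p.1, p.1 + p.2) := by
      rintro ⟨x, y⟩ ⟨x', y'⟩ hxy
      simp only [Prod.mk.injEq] at hxy ⊢
      omega
    refine Summable.of_norm_bounded ((h1.comp_injective hinj).mul_left (A * B)) fun p => ?_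
    simp only [hF, Function.comp, div_eq_mul_inv, mul_inv, norm_mul]
    have := hA p.2
    have := hB (p.1 + p.2 + p.1)
    calc _ ≤ ‖baileyWeight a q d e (p.1 + p.2)‖ * (A * B) * ‖α p.1‖ := by gcongr
      _ = _ := by ring
  have hL : ∑' n, baileyWeight a q d e n * β n = ∑' p, F p := by
    rw [tsum_prod_eq_tsum_range hFs]
    refine tsum_congr fun n => ?_
    rw [h n, Finset.mul_sum]
    refine Finset.sum_congr rfl fun r hr => ?_
    have hr : r ≤ n := Nat.lt_succ_iff.1 (Finset.mem_range.1 hr)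
    simp only [hF]
    rw [Nat.add_sub_cancel' hr]
    ring
  rw [hL, hFs.tsum_prod, ← tsum_mul_left]
  refine tsum_congr fun r => ?_
  simp only [hF]
  rw [tsum_mul_right, tsum_baileyWeight hq hq0 ha hde hd he r, mul_assoc]

/-! ### Bailey pairs with `β n = 1 / (bq; q)_n` -/

/-- The rational function identity behind the induction step of `partial_sum_of_recurrence`. -/
lemma partial_sum_algebra {a b q x M E α P Q A s u v : ℂ} (ha1 : 1 - a ≠ 0)
    (d1 : 1 - a * q * (q * x ^ 2 * M) ≠ 0) (d2 : 1 - a * q * (q ^ 2 * x ^ 2 * M) ≠ 0)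
    (d3 : 1 - b * (x * q) ≠ 0) (d4 : 1 - b * (x * q * q) ≠ 0) (d5 : 1 - q * x ≠ 0)
    (d6 : 1 - q * M ≠ 0) (d7 : 1 - q ^ 2 * x * M ≠ 0) (d8 : 1 - a * (x * q) ^ 2 ≠ 0)
    (d9 : 1 - a * (q ^ 4 * x ^ 2) ≠ 0) (hA : A ≠ 0) (hP : P ≠ 0) (hQ : Q ≠ 0) :
    -((u * v - s * (E * (x * q)) * (1 - b) * (1 - a * (x * q) ^ 2) * (1 - a * (x * (x * q))) * α /
        ((1 - a) * (1 - b * (x * q)) * (P * (1 - x * q)))) * (M * q) * (1 - b * (x * q)) /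
        ((1 - a * (x * q) ^ 2) * (Q * (1 - q * M) * (A * (1 - a * q * (q * x ^ 2 * M)))))) -
      (1 - b) * (q ^ 2 * x * M) / ((1 - a) * (1 - q ^ 2 * x * M)) *
        (s * E * α / (P * (Q * (1 - q * M)) * A)) +
      u * v * ((1 - b * (q ^ 2 * x * M)) / (Q * (1 - q * M) *
        (A * (1 - a * q * (q * x ^ 2 * M)) * (1 - a * q * (q ^ 2 * x ^ 2 * M)))) -
        1 / (Q * (A * (1 - a * q * (q * x ^ 2 * M))))) =
    -(-(a * (x * q) ^ 3 * q * (b - a * (x * q)) * (1 - a * (x * q) ^ 2 * q ^ 2)) * u /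
        ((1 - a * (x * q) ^ 2) * (1 - b * (x * q * q))) * (M * v * (1 - b * (x * q * q))) /
        ((1 - a * (q ^ 4 * x ^ 2)) * (Q * (A * (1 - a * q * (q * x ^ 2 * M)) *
          (1 - a * q * (q ^ 2 * x ^ 2 * M)))))) -
      (1 - b) * (q ^ 2 * x * M) / ((1 - a) * (1 - q ^ 2 * x * M)) *
        (s * -1 * (E * q * x) * (α * (1 - a * x)) /
          (P * (1 - q * x) * Q * (A * (1 - a * q * (q * x ^ 2 * M))))) := by
  -- keeping the denominators atomic lets `field_simp` clear them without factoring them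
  rw [mul_comm q x] at d5
  rw [mul_comm q x]
  generalize hD1 : 1 - a * q * (q * x ^ 2 * M) = D1 at *
  generalize hD2 : 1 - a * q * (q ^ 2 * x ^ 2 * M) = D2 at *
  generalize hD3 : 1 - b * (x * q) = D3 at *
  generalize hD4 : 1 - b * (x * q * q) = D4 at *
  generalize hD5 : 1 - x * q = D5 at *
  generalize hD6 : 1 - q * M = D6 at *
  generalize hD7 : 1 - q ^ 2 * x * M = D7 at *
  generalize hD8 : 1 - a * (x * q) ^ 2 = D8 at *
  generalize hD9 : 1 - a * (q ^ 4 * x ^ 2) = D9 at *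
  field_simp
  subst hD1 hD2 hD3 hD4 hD5 hD6 hD7 hD8 hD9
  ring

/-- Closed form of the partial sums, over `r ≤ N`, of the series expressing
`(1 - b q^n) β n - β (n - 1)` through `α = p t`, where `n = N + 1 + m`. The hypothesis `hp` makes
`p` hypergeometric, and `ht` prescribes the increments of `t`. At `m = 0` it gives the recurrence
of `β` in `isBaileyPair_of_recurrence`. -/
lemma partial_sum_of_recurrence {a b q : ℂ} {p t : ℕ → ℂ} (hq : ‖q‖ < 1)
    (ha : ∀ k : ℕ, a * q ^ k ≠ 1) (hb : ∀ k : ℕ, b * q * q ^ k ≠ 1) (hp0 : p 0 = 1) (ht0 : t 0 = 1)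
    (hp : ∀ r, p (r + 1) * ((1 - a * q ^ (2 * r)) * (1 - b * q ^ (r + 1))) =
      -(a * q ^ (3 * r + 1) * (b - a * q ^ r) * (1 - a * q ^ (2 * r + 2))) * p r)
    (ht : ∀ r, p (r + 1) * (t (r + 1) - t r) *
        ((1 - a) * (1 - b * q ^ (r + 1)) * qPoch q q (r + 1)) =
      (-1) ^ (r + 1) * q ^ ((r + 2).choose 2) * (1 - b) * (1 - a * q ^ (2 * r + 2)) *
        (1 - a * q ^ (2 * r + 1)) * qPoch a q r) (N : ℕ) :
    ∀ m : ℕ, ∑ r ∈ Finset.range (N + 1), p r * t r *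
      ((1 - b * q ^ (N + 1 + m)) / (qPoch q q (N + 1 + m - r) * qPoch (a * q) q (N + 1 + m + r))
        - 1 / (qPoch q q (N + m - r) * qPoch (a * q) q (N + m + r))) =
      -(q ^ m * p (N + 1) * t N * (1 - b * q ^ (N + 1)) / ((1 - a * q ^ (2 * N + 2)) *
        (qPoch q q m * qPoch (a * q) q (2 * N + 1 + m)))) -
      (1 - b) * q ^ (N + 1 + m) / ((1 - a) * (1 - q ^ (N + 1 + m))) *
        ((-1) ^ (N + 1) * q ^ ((N + 1).choose 2) * qPoch a q N /
          (qPoch q q N * qPoch q q m * qPoch (a * q) q (2 * N + m))) := by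
  have ha' : ∀ k : ℕ, a * q * q ^ k ≠ 1 := fun k => by
    have := ha (k + 1); rwa [pow_succ', ← mul_assoc] at this
  have hane : ∀ k : ℕ, 1 - a * q ^ k ≠ 0 := fun k => sub_ne_zero.2 (ha k).symm
  have ha1 : 1 - a ≠ 0 := by simpa using hane 0
  have hqne : ∀ k : ℕ, 1 - q ^ (k + 1) ≠ 0 := fun k => by
    have := mul_pow_ne_one hq hq k; rw [← pow_succ'] at this; exact sub_ne_zero.2 this.symm
  have hbne : ∀ k : ℕ, 1 - b * q ^ (k + 1) ≠ 0 := fun k => by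
    have := hb k; rw [mul_assoc, ← pow_succ'] at this; exact sub_ne_zero.2 this.symm
  have hpq := qPoch_self_ne_zero hq
  have hpa := qPoch_ne_zero ha'
  induction N with
  | zero =>
    intro m
    have h0 := hp 0
    have hpv : p 1 = -(a * q * (b - a) * (1 - a * q ^ 2)) / ((1 - a) * (1 - b * q)) := by
      have h1 : (1 - a) * (1 - b * q) ≠ 0 := mul_ne_zero ha1 (by simpa using hbne 0)
      rw [eq_div_iff h1]; simpa [hp0] using h0
    have hb1 : 1 - b * q ≠ 0 := by simpa using hbne 0
    have ha2 := hane 2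
    have hqm := hqne m
    have e1 : 1 + m = m + 1 := add_comm _ _
    have ham := hane (m + 1)
    simp only [zero_add, Finset.sum_range_one, hp0, ht0, hpv, e1, Nat.sub_zero, add_zero, mul_zero,
      qPoch_succ, qPoch_zero, mul_one, one_mul, pow_one, show Nat.choose 1 2 = 0 from rfl, pow_zero]
    have := hpq m
    have := hpa m
    have i1 : 1 - q * q ^ m ≠ 0 := by simpa [pow_succ'] using hqm
    have i2 : 1 - a * q * q ^ m ≠ 0 := by simpa [pow_succ', mul_assoc] using ham
    rw [pow_succ'] at hqm ⊢
    generalize q ^ m = M at *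
    generalize qPoch q q m = Q at *
    generalize qPoch (a * q) q m = A at *
    generalize hD1 : 1 - a * q * M = D1 at *
    generalize hD2 : 1 - a * q ^ 2 = D2 at *
    generalize hD3 : 1 - q * M = D3 at *
    generalize hD4 : 1 - b * q = D4 at *
    field_simp
    subst hD1 hD2 hD3 hD4
    ring
  | succ N ih =>
    intro m
    have h0 := hp (N + 1)
    have h1 := ht N
    have hpv : p (N + 1 + 1) = -(a * (q ^ (N + 1)) ^ 3 * q * (b - a * q ^ (N + 1)) *
        (1 - a * (q ^ (N + 1)) ^ 2 * q ^ 2)) * p (N + 1) /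
        ((1 - a * (q ^ (N + 1)) ^ 2) * (1 - b * (q ^ (N + 1) * q))) := by
      rw [eq_div_iff, ← pow_succ, ← pow_mul, ← pow_mul, mul_comm (N + 1) 2, h0]
      · ring
      · rw [← pow_succ, ← pow_mul]
        exact mul_ne_zero (hane _) (hbne _)
    have htv : p (N + 1) * t N = p (N + 1) * t (N + 1) -
        (-1) ^ (N + 1) * (q ^ ((N + 1).choose 2) * q ^ (N + 1)) * (1 - b) *
        (1 - a * (q ^ (N + 1)) ^ 2) * (1 - a * (q ^ N * q ^ (N + 1))) * qPoch a q N /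
        ((1 - a) * (1 - b * q ^ (N + 1)) * (qPoch q q N * (1 - q ^ (N + 1)))) := by
      have e : (q ^ ((N + 1).choose 2) * q ^ (N + 1)) = q ^ ((N + 2).choose 2) := by
        rw [← pow_add, Nat.choose_succ_succ (N + 1) 1, Nat.choose_one_right, add_comm]
      rw [e, ← pow_mul, ← pow_add, mul_comm (N + 1) 2, show N + (N + 1) = 2 * N + 1 by ring,
        show 2 * (N + 1) = 2 * N + 2 by ring, ← h1, qPoch_succ, ← pow_succ']
      have := hbne N
      have := hqne N
      have := hpq N
      field_simp
      ring
    rw [Finset.sum_range_succ]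
    have ihm := ih (m + 1)
    rw [show N + 1 + (m + 1) = N + 1 + 1 + m by ring, show N + (m + 1) = N + 1 + m by ring] at ihm
    rw [ihm]
    rw [show N + 1 + 1 + m - (N + 1) = m + 1 by omega, show N + 1 + m - (N + 1) = m by omega,
      show N + 1 + 1 + m + (N + 1) = 2 * N + (m + 1) + 1 + 1 by ring,
      show N + 1 + m + (N + 1) = 2 * N + (m + 1) + 1 by ring,
      show 2 * N + 1 + (m + 1) = 2 * N + (m + 1) + 1 by ring,
      show 2 * (N + 1) + 1 + m = 2 * N + (m + 1) + 1 + 1 by ring,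
      show 2 * (N + 1) + m = 2 * N + (m + 1) + 1 by ring]
    have c1 := hpa (2 * N + (m + 1))
    have c2 := hpq N
    have c3 := hpq m
    have d1 : 1 - a * q * q ^ (2 * N + (m + 1)) ≠ 0 := sub_ne_zero.2 (ha' _).symm
    have d2 : 1 - a * q * q ^ (2 * N + (m + 1) + 1) ≠ 0 := sub_ne_zero.2 (ha' _).symm
    have d3 := hbne N
    have d4 : 1 - b * (q ^ (N + 1) * q) ≠ 0 := hbne (N + 1)
    have d5 : 1 - q * q ^ N ≠ 0 := by rw [← pow_succ']; exact hqne N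
    have d6 : 1 - q * q ^ m ≠ 0 := by rw [← pow_succ']; exact hqne m
    have d7 := hqne (N + 1 + m)
    have d8 : 1 - a * (q ^ (N + 1)) ^ 2 ≠ 0 := by rw [← pow_mul]; exact hane _
    have d9 : 1 - a * q ^ (2 * (N + 1) + 2) ≠ 0 := hane _
    have x1 : q ^ (2 * N + (m + 1) + 1) = q ^ 2 * (q ^ N) ^ 2 * q ^ m := by ring
    have x2 : q ^ (2 * N + (m + 1)) = q * (q ^ N) ^ 2 * q ^ m := by ring
    have x3 : q ^ (2 * (N + 1) + 2) = q ^ 4 * (q ^ N) ^ 2 := by ring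
    have x4 : q ^ (N + 1 + m + 1) = q ^ 2 * q ^ N * q ^ m := by ring
    have x5 : q ^ (N + 1 + 1 + m) = q ^ 2 * q ^ N * q ^ m := by ring
    have x6 : q ^ ((N + 2).choose 2) = q ^ ((N + 1).choose 2) * q * q ^ N := by
      rw [Nat.choose_succ_succ (N + 1) 1, Nat.choose_one_right]; ring
    have x7 : q ^ (2 * N + 2) = (q ^ N * q) ^ 2 := by ring
    rw [show q ^ m * p (N + 1 + 1) * t (N + 1) * (1 - b * q ^ (N + 1 + 1)) =
      p (N + 1 + 1) * (q ^ m * t (N + 1) * (1 - b * q ^ (N + 1 + 1))) by ring,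
      show q ^ (m + 1) * p (N + 1) * t N = p (N + 1) * t N * q ^ (m + 1) by ring, htv, hpv,
      show N + 1 + 1 = N + 2 by ring]
    clear ihm htv hpv h1 h0 ih hp ht
    simp only [qPoch_succ]
    rw [x1] at d2 ⊢
    rw [x2] at d1 ⊢
    rw [x3] at d9 ⊢
    rw [x4] at d7
    rw [x5, x6, x7, pow_succ (-1 : ℂ) (N + 1), pow_succ q m, pow_succ q (N + 1)]
    rw [pow_succ q N] at d3 d4 d8 ⊢
    generalize hx : q ^ N = x at *
    generalize q ^ m = M at *
    generalize q ^ ((N + 1).choose 2) = E at *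
    generalize qPoch a q N = α at *
    generalize qPoch q q N = P at *
    generalize qPoch q q m = Q at *
    generalize qPoch (a * q) q (2 * N + (m + 1)) = A at *
    generalize (-1 : ℂ) ^ (N + 1) = s at *
    generalize p (N + 1) = u at *
    generalize t (N + 1) = v at *
    exact partial_sum_algebra ha1 d1 d2 d3 d4 d5 d6 d7 d8 d9 c1 c2 c3

/-- A family of Bailey pairs with `β n = 1 / (bq; q)_n` and `α = p t`, where `p` is hypergeometric
and `t` is the sequence of partial sums of a theta-like series. The proof is an induction on `n`
with the recurrence `(1 - b q^n) β n = β (n - 1)`. -/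
theorem isBaileyPair_of_recurrence {a b q : ℂ} {p t : ℕ → ℂ} (hq : ‖q‖ < 1)
    (ha : ∀ k : ℕ, a * q ^ k ≠ 1) (hb : ∀ k : ℕ, b * q * q ^ k ≠ 1) (hp0 : p 0 = 1) (ht0 : t 0 = 1)
    (hp : ∀ r, p (r + 1) * ((1 - a * q ^ (2 * r)) * (1 - b * q ^ (r + 1))) =
      -(a * q ^ (3 * r + 1) * (b - a * q ^ r) * (1 - a * q ^ (2 * r + 2))) * p r)
    (ht : ∀ r, p (r + 1) * (t (r + 1) - t r) *
        ((1 - a) * (1 - b * q ^ (r + 1)) * qPoch q q (r + 1)) =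
      (-1) ^ (r + 1) * q ^ ((r + 2).choose 2) * (1 - b) * (1 - a * q ^ (2 * r + 2)) *
        (1 - a * q ^ (2 * r + 1)) * qPoch a q r) :
    IsBaileyPair a q (fun r => p r * t r) (fun n => 1 / qPoch (b * q) q n) := by
  have ha' : ∀ k : ℕ, a * q * q ^ k ≠ 1 := fun k => by
    have := ha (k + 1); rwa [pow_succ', ← mul_assoc] at this
  have hane : ∀ k : ℕ, 1 - a * q ^ k ≠ 0 := fun k => sub_ne_zero.2 (ha k).symm
  have ha1 : 1 - a ≠ 0 := by simpa using hane 0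
  have hqne : ∀ k : ℕ, 1 - q * q ^ k ≠ 0 := fun k => sub_ne_zero.2 (mul_pow_ne_one hq hq k).symm
  have hbne : ∀ k : ℕ, 1 - b * q * q ^ k ≠ 0 := fun k => sub_ne_zero.2 (hb k).symm
  have hpq := qPoch_self_ne_zero hq
  have hpa := qPoch_ne_zero ha'
  intro n
  beta_reduce
  induction n with
  | zero => simp [hp0, ht0]
  | succ n ih =>
    have key := partial_sum_of_recurrence hq ha hb hp0 ht0 hp ht n 0
    simp only [add_zero, mul_sub (p _ * t _), Finset.sum_sub_distrib, pow_zero, one_mul, qPoch_zero] at key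
    have hS : ∑ r ∈ Finset.range (n + 1), p r * t r *
        (1 / (qPoch q q (n - r) * qPoch (a * q) q (n + r))) = 1 / qPoch (b * q) q n := by
      rw [ih]
      exact Finset.sum_congr rfl fun r _ => by ring
    rw [hS] at key
    have hT : ∑ r ∈ Finset.range (n + 1), p r * t r *
        ((1 - b * q ^ (n + 1)) / (qPoch q q (n + 1 - r) * qPoch (a * q) q (n + 1 + r))) =
        (1 - b * q ^ (n + 1)) * ∑ r ∈ Finset.range (n + 1),
          p r * t r / (qPoch q q (n + 1 - r) * qPoch (a * q) q (n + 1 + r)) := by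
      rw [Finset.mul_sum]
      exact Finset.sum_congr rfl fun r _ => by ring
    rw [hT] at key
    rw [Finset.sum_range_succ _ (n + 1), Nat.sub_self, qPoch_zero, one_mul, qPoch_succ]
    have htn := ht n
    have c1 := hbne n
    have c2 := qPoch_ne_zero hb n
    have c3 := hpa (2 * n)
    have c4 := hpa (2 * n + 1)
    have d1 : 1 - a * q ^ (2 * n + 1) ≠ 0 := hane _
    have d2 : 1 - a * q ^ (2 * n + 2) ≠ 0 := hane _
    have hval : p (n + 1) * t (n + 1) = p (n + 1) * t n + (-1) ^ (n + 1) *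
        q ^ ((n + 2).choose 2) * (1 - b) * (1 - a * q ^ (2 * n + 2)) *
        (1 - a * q ^ (2 * n + 1)) * qPoch a q n /
        ((1 - a) * (1 - b * q ^ (n + 1)) * qPoch q q (n + 1)) := by
      rw [← htn, mul_div_assoc, div_self]
      · ring
      · rw [pow_succ', ← mul_assoc]
        exact mul_ne_zero (mul_ne_zero ha1 c1) (hpq _)
    have e6 : q ^ ((n + 2).choose 2) = q ^ ((n + 1).choose 2) * q ^ (n + 1) := by
      rw [Nat.choose_succ_succ (n + 1) 1, Nat.choose_one_right]; ring
    rw [hval, e6]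
    rw [sub_eq_iff_eq_add] at key
    have c5 : 1 - b * q ^ (n + 1) ≠ 0 := by rw [pow_succ', ← mul_assoc]; exact c1
    refine mul_left_cancel₀ c5 ?_
    rw [mul_add, key, show n + 1 + (n + 1) = 2 * n + 1 + 1 by ring]
    simp only [qPoch_succ]
    have d1' : 1 - a * q * q ^ (2 * n) ≠ 0 := by rw [mul_assoc, ← pow_succ']; exact d1
    have d2' : 1 - a * q * q ^ (2 * n + 1) ≠ 0 := by rw [mul_assoc, ← pow_succ']; exact d2
    have hq1 := hpq n
    have hq2 := hqne n
    clear key hval ht hp hT hS htn ih e6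
    have e1 : q ^ (2 * n) = (q ^ n) ^ 2 := by ring
    have e2 : q ^ (2 * n + 1) = q * (q ^ n) ^ 2 := by ring
    have e3 : q ^ (2 * n + 2) = q ^ 2 * (q ^ n) ^ 2 := by ring
    rw [e1] at d1'
    rw [e2] at d1 d2'
    rw [e3] at d2
    rw [e1, e2, e3]
    simp only [pow_succ' q n, qPoch_succ] at *
    have r1 : 1 - a * q * (q * (q ^ n) ^ 2) = 1 - a * (q ^ 2 * (q ^ n) ^ 2) := by ring
    have r2 : 1 - a * q * (q ^ n) ^ 2 = 1 - a * (q * (q ^ n) ^ 2) := by ring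
    rw [r1, r2, mul_assoc b]
    generalize q ^ n = x at *
    generalize q ^ (Nat.choose _ _) = E at *
    generalize qPoch q q n = M at *
    generalize qPoch (b * q) q n = M' at *
    generalize qPoch (a * q) q (2 * n) = M'' at *
    generalize hD1 : 1 - a * (q ^ 2 * x ^ 2) = D1 at *
    generalize hD2 : 1 - a * (q * x ^ 2) = D2 at *
    generalize hD3 : 1 - q * x = D3 at *
    generalize hD4 : 1 - b * (q * x) = D4 at *
    field_simp
    subst hD1 hD2 hD3 hD4
    ring

/-! ### Lowering the parameter of a Bailey pair -/

/-- Lowering `a = q` to `a = 1` in a Bailey pair, with `β n` multiplied by `1 - x q^n`. Each term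
of the kernel relative to `q` splits into two adjacent terms of the kernel relative to `1`. -/
theorem IsBaileyPair.lower {q : ℂ} {A β : ℕ → ℂ} (x : ℂ) (hq : ‖q‖ < 1)
    (h : IsBaileyPair q q (fun r => (1 - q ^ (2 * r + 1)) / (1 - q) * A r) β) :
    IsBaileyPair 1 q (fun r => A r * (1 - x * q ^ r) -
      if r = 0 then 0 else A (r - 1) * (q ^ (2 * r - 1) - x * q ^ (r - 1)))
      (fun n => (1 - x * q ^ n) * β n) := by
  have hqne : ∀ k : ℕ, 1 - q * q ^ k ≠ 0 := fun k => sub_ne_zero.2 (mul_pow_ne_one hq hq k).symm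
  have hpq := qPoch_self_ne_zero hq
  have hq1 : 1 - q ≠ 0 := by simpa using hqne 0
  have hsq : ∀ k, qPoch (q * q) q k = qPoch q q (k + 1) / (1 - q) := fun k => by
    rw [qPoch_succ']; field_simp
  intro n
  have hR : ∀ r, (A r * (1 - x * q ^ r) -
      if r = 0 then 0 else A (r - 1) * (q ^ (2 * r - 1) - x * q ^ (r - 1))) /
        (qPoch q q (n - r) * qPoch (1 * q) q (n + r)) =
      A r * (1 - x * q ^ r) / (qPoch q q (n - r) * qPoch q q (n + r)) -
      if r = 0 then 0 else A (r - 1) * (q ^ (2 * r - 1) - x * q ^ (r - 1)) /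
        (qPoch q q (n - r) * qPoch q q (n + r)) := by
    intro r
    rw [one_mul, sub_div]
    split_ifs <;> simp
  beta_reduce
  simp only [hR, Finset.sum_sub_distrib]
  rw [h n, Finset.sum_range_succ' (fun r => if r = 0 then (0 : ℂ) else _),
    Finset.sum_range_succ, Finset.sum_range_succ (fun r => A r * (1 - x * q ^ r) / _),
    if_pos rfl, add_zero, add_sub_right_comm, ← Finset.sum_sub_distrib, mul_add,
    Finset.mul_sum]
  beta_reduce
  congr 1
  · refine Finset.sum_congr rfl fun r hr => ?_
    obtain ⟨m, rfl⟩ := Nat.exists_eq_add_of_lt (Finset.mem_range.1 hr)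
    rw [if_neg r.succ_ne_zero, hsq, show r + m + 1 - r = m + 1 by omega,
      show r + m + 1 - (r + 1) = m by omega, show 2 * (r + 1) - 1 = 2 * r + 1 by omega,
      show r + m + 1 + (r + 1) = 2 * r + m + 1 + 1 by ring,
      show r + m + 1 + r + 1 = 2 * r + m + 1 + 1 by ring,
      show r + m + 1 + r = 2 * r + m + 1 by ring, Nat.add_sub_cancel]
    rw [qPoch_succ q q (2 * r + m + 1), qPoch_succ q q m]
    have h1 := hpq m
    have h2 := hpq (2 * r + m + 1)
    have h3 := hqne m
    have h4 := hqne (2 * r + m + 1)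
    generalize qPoch q q m = M at *
    generalize qPoch q q (2 * r + m + 1) = M' at *
    rw [show q ^ (2 * r + m + 1) = q * (q ^ r) ^ 2 * q ^ m by ring] at h4 ⊢
    rw [show q ^ (2 * r + 1) = q * (q ^ r) ^ 2 by ring,
      show q ^ (r + m + 1) = q * q ^ r * q ^ m by ring]
    generalize q ^ r = z at *
    generalize q ^ m = y at *
    generalize hD1 : 1 - q * y = D1 at *
    generalize hD2 : 1 - q * (q * z ^ 2 * y) = D2 at *
    field_simp
    subst hD1 hD2
    ring
  · rw [hsq, Nat.sub_self, qPoch_zero, show n + n = 2 * n by ring, qPoch_succ q q (2 * n)]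
    have h2 := hpq (2 * n)
    have h4 := hqne (2 * n)
    rw [show q ^ (2 * n + 1) = q * q ^ (2 * n) by ring]
    generalize q ^ (2 * n) = z at *
    field_simp

/-! ### Bailey pairs of Appell–Lerch type -/

/-- Partial sums, over `r ≤ N`, of the series of length `n = N + m` that expresses the vanishing of
`∑_r (-1)^r q^{r(r-1)/2} (1 - q^{2r+1}) / ((q; q)_{n-r} (q; q)_{n+r+1})`; the right-hand side is
zero at `m = 0`. -/
lemma partial_sum_theta {q : ℂ} (hq : ‖q‖ < 1) (N : ℕ) : ∀ m : ℕ, 1 ≤ N + m →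
    ∑ r ∈ Finset.range (N + 1), (-1) ^ r * q ^ (r.choose 2) * (1 - q ^ (2 * r + 1)) /
      (qPoch q q (N + m - r) * qPoch q q (N + m + r + 1)) =
    (-1) ^ N * q ^ ((N + 1).choose 2) * (1 - q ^ (N + 1)) * (1 - q ^ m) /
      ((1 - q ^ (N + m)) * (qPoch q q m * qPoch q q (2 * N + m + 1))) := by
  have hqne : ∀ k : ℕ, 1 - q * q ^ k ≠ 0 := fun k => sub_ne_zero.2 (mul_pow_ne_one hq hq k).symm
  have hpq := qPoch_self_ne_zero hq
  induction N with
  | zero =>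
    intro m hm
    obtain ⟨k, rfl⟩ : ∃ k, m = k + 1 := ⟨m - 1, by omega⟩
    have := hqne k
    rw [← pow_succ'] at this
    have h1 := hpq (k + 1)
    have h2 := hpq (k + 1 + 1)
    simp
    field_simp
  | succ N ih =>
    intro m hm
    rw [Finset.sum_range_succ]
    have ihm := ih (m + 1) (by omega)
    rw [show N + (m + 1) = N + 1 + m by ring] at ihm
    rw [ihm, show N + 1 + m - (N + 1) = m by omega,
      show N + 1 + m + (N + 1) + 1 = 2 * N + m + 2 + 1 by ring,
      show 2 * N + (m + 1) + 1 = 2 * N + m + 2 by ring,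
      show 2 * (N + 1) + m + 1 = 2 * N + m + 2 + 1 by ring, qPoch_succ q q m,
      qPoch_succ q q (2 * N + m + 2)]
    have h1 := hpq m
    have h2 := hpq (2 * N + m + 2)
    have h3 := hqne m
    have h4 := hqne (2 * N + m + 2)
    have h5 := hqne (N + m)
    rw [← pow_succ', show N + m + 1 = N + 1 + m by ring] at h5
    rw [show N + 1 + 1 = N + 2 by ring, Nat.choose_succ_succ (N + 1) 1, Nat.choose_one_right,
      pow_add q (N + 1) (Nat.choose _ _)]
    generalize q ^ (Nat.choose _ _) = E at *
    generalize qPoch q q m = M at *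
    generalize qPoch q q (2 * N + m + 2) = M' at *
    rw [show q ^ (2 * N + m + 2) = q ^ 2 * (q ^ N) ^ 2 * q ^ m by ring] at h4 ⊢
    rw [show q ^ (N + 1 + m) = q * q ^ N * q ^ m by ring] at h5 ⊢
    rw [show q ^ (2 * (N + 1) + 1) = q ^ 3 * (q ^ N) ^ 2 by ring,
      show q ^ (m + 1) = q * q ^ m by ring, show q ^ (N + 2) = q ^ 2 * q ^ N by ring,
      show q ^ (N + 1) = q * q ^ N by ring, pow_succ (-1 : ℂ)]
    generalize q ^ N = z at *
    generalize q ^ m = y at *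
    generalize (-1 : ℂ) ^ N = s at *
    generalize hD1 : 1 - q * y = D1 at *
    generalize hD2 : 1 - q * (q ^ 2 * z ^ 2 * y) = D2 at *
    generalize hD3 : 1 - q * z * y = D3 at *
    field_simp
    subst hD1 hD2 hD3
    ring

/-- The Bailey pair relative to `q` with `β n = 1 / ((y; q)_{n+1} (w; q)_{n+1})`, `yw = q`. Since
`yw = q`, the factor `(1 - y q^n) (1 - w q^n)` relating `β n` and `β (n - 1)` combines with the
kernel so as to cancel the denominators `(1 - y q^r) (1 - w q^r)` of `α r`; what is left is
`partial_sum_theta`. -/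
theorem isBaileyPair_appell {q y w : ℂ} (hq : ‖q‖ < 1) (hyw : y * w = q)
    (hy : ∀ k : ℕ, y * q ^ k ≠ 1) (hw : ∀ k : ℕ, w * q ^ k ≠ 1) :
    IsBaileyPair q q
      (fun r => (-1) ^ r * q ^ ((r + 1).choose 2) * (1 - q ^ (2 * r + 1)) /
        ((1 - q) * ((1 - y * q ^ r) * (1 - w * q ^ r))))
      (fun n => 1 / (qPoch y q (n + 1) * qPoch w q (n + 1))) := by
  have hqne : ∀ k : ℕ, 1 - q * q ^ k ≠ 0 := fun k => sub_ne_zero.2 (mul_pow_ne_one hq hq k).symm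
  have hpq := qPoch_self_ne_zero hq
  have hq1 : 1 - q ≠ 0 := by simpa using hqne 0
  have hyne : ∀ k : ℕ, 1 - y * q ^ k ≠ 0 := fun k => sub_ne_zero.2 (hy k).symm
  have hwne : ∀ k : ℕ, 1 - w * q ^ k ≠ 0 := fun k => sub_ne_zero.2 (hw k).symm
  have hsq : ∀ k, qPoch (q * q) q k = qPoch q q (k + 1) / (1 - q) := fun k => by
    rw [qPoch_succ']; field_simp
  intro n
  beta_reduce
  simp only [hsq]
  induction n with
  | zero =>
    have := hyne 0
    have := hwne 0
    simp [qPoch_succ]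
    field_simp
  | succ n ih =>
    have key := partial_sum_theta hq (n + 1) 0 (by omega)
    rw [pow_zero, sub_self, mul_zero, zero_div, Finset.sum_range_succ] at key
    have h1 := hyne (n + 1)
    have h2 := hwne (n + 1)
    -- the recurrence relating `β (n + 1)` and `β n`, for the sums over `α`
    have step : (1 - y * q ^ (n + 1)) * (1 - w * q ^ (n + 1)) * ∑ r ∈ Finset.range (n + 1 + 1),
        (-1) ^ r * q ^ ((r + 1).choose 2) * (1 - q ^ (2 * r + 1)) /
        ((1 - q) * ((1 - y * q ^ r) * (1 - w * q ^ r))) /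
        (qPoch q q (n + 1 - r) * (qPoch q q (n + 1 + r + 1) / (1 - q))) =
        1 / (qPoch y q (n + 1) * qPoch w q (n + 1)) := by
      rw [ih, ← sub_eq_zero, Finset.sum_range_succ,
        mul_add (_ * (1 - w * q ^ (n + 1))), add_sub_right_comm, Finset.mul_sum,
        ← Finset.sum_sub_distrib, ← mul_zero (q ^ (n + 1)), ← key,
        mul_add (q ^ (n + 1)), Finset.mul_sum]
      congr 1
      · refine Finset.sum_congr rfl fun r hr => ?_
        obtain ⟨m, rfl⟩ := Nat.exists_eq_add_of_le (Nat.lt_succ_iff.1 (Finset.mem_range.1 hr))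
        rw [add_zero, show r + m + 1 - r = m + 1 by omega, show r + m - r = m by omega,
          show r + m + 1 + r + 1 = 2 * r + m + 1 + 1 by ring,
          show r + m + r + 1 = 2 * r + m + 1 by ring, qPoch_succ q q m,
          qPoch_succ q q (2 * r + m + 1), Nat.choose_succ_succ r 1, Nat.choose_one_right,
          pow_add q r (Nat.choose _ _)]
        have h1 := hpq m
        have h2 := hpq (2 * r + m + 1)
        have h3 := hqne m
        have h4 := hqne (2 * r + m + 1)
        have h5 := hyne r
        have h6 := hwne r
        generalize q ^ (Nat.choose _ _) = E at *
        generalize qPoch q q m = M at *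
        generalize qPoch q q (2 * r + m + 1) = M' at *
        rw [show q ^ (2 * r + m + 1) = q * (q ^ r) ^ 2 * q ^ m by ring] at h4 ⊢
        rw [show q ^ (2 * r + 1) = q * (q ^ r) ^ 2 by ring,
          show q ^ (r + m + 1) = q * q ^ r * q ^ m by ring]
        generalize q ^ r = z at *
        generalize q ^ m = x at *
        generalize (-1 : ℂ) ^ r = s at *
        subst hyw
        generalize hD1 : 1 - y * w * x = D1 at *
        generalize hD2 : 1 - y * w * (y * w * z ^ 2 * x) = D2 at *
        generalize hD3 : 1 - y * z = D3 at *
        generalize hD4 : 1 - w * z = D4 at *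
        field_simp
        subst hD1 hD2 hD3 hD4
        ring
      · rw [add_zero, Nat.choose_succ_succ (n + 1) 1, Nat.choose_one_right,
          pow_add q (n + 1) (Nat.choose _ _)]
        have := hpq (n + 1 + (n + 1) + 1)
        rw [Nat.sub_self, qPoch_zero]
        generalize 1 - y * q ^ (n + 1) = D1 at *
        generalize 1 - w * q ^ (n + 1) = D2 at *
        field_simp
    rw [qPoch_succ y q (n + 1), qPoch_succ w q (n + 1)]
    have h3 := qPoch_ne_zero hy (n + 1)
    have h4 := qPoch_ne_zero hw (n + 1)
    refine mul_left_cancel₀ (mul_ne_zero h1 h2) ?_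
    rw [step]
    generalize 1 - y * q ^ (n + 1) = D1 at *
    generalize 1 - w * q ^ (n + 1) = D2 at *
    field_simp

/-! ### Three Eulerian series satisfying the same second order `q`-difference equation -/

/-- Summand of `∑ q^{n(n+1)/2} xⁿ (-x; q)_n / (x; q)_{n+1}`. -/
def eulerTerm (q x : ℂ) (n : ℕ) : ℂ :=
  q ^ ((n + 1).choose 2) * x ^ n * qPoch (-x) q n / qPoch x q (n + 1)

/-- Summand of `∑ xⁿ (-x; q)_n (-q; q)_n / (-x²; q²)_{n+1}`. -/
def eulerTermAppell (q x : ℂ) (n : ℕ) : ℂ :=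
  x ^ n * qPoch (-x) q n * qPoch (-q) q n / qPoch (-x ^ 2) (q ^ 2) (n + 1)

/-- Summand of `∑ q^{n²} x^{2n} (-q²; q²)_n / (x; q)_{2n+2}`. -/
def eulerTermBilateral (q x : ℂ) (n : ℕ) : ℂ :=
  q ^ (n ^ 2) * x ^ (2 * n) * qPoch (-q ^ 2) (q ^ 2) n / qPoch x q (2 * n + 2)

/-- `(xq^k; q)_n` is bounded, and bounded away from zero, uniformly in `k` and `n`. -/
lemma exists_norm_qPoch_mul_pow_le {x q : ℂ} (hq : ‖q‖ < 1) (hx : ‖x‖ < 1) :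
    ∃ C : ℝ, 0 ≤ C ∧ ∀ k n, ‖qPoch (x * q ^ k) q n‖ ≤ C ∧ ‖(qPoch (x * q ^ k) q n)⁻¹‖ ≤ C := by
  obtain ⟨A, hA0, hA⟩ := exists_norm_inv_qPoch_le hq (mul_pow_ne_one hx hq)
  obtain ⟨B, hB0, hB⟩ := exists_norm_qPoch_le x hq
  have h0 := qPoch_ne_zero (mul_pow_ne_one hx hq)
  refine ⟨A * B, by positivity, fun k n => ⟨?_, ?_⟩⟩
  · have : qPoch (x * q ^ k) q n = (qPoch x q k)⁻¹ * qPoch x q (k + n) := by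
      rw [qPoch_add, inv_mul_cancel_left₀ (h0 k)]
    rw [this, norm_mul]
    exact mul_le_mul (hA k) (hB _) (norm_nonneg _) hA0
  · have : (qPoch (x * q ^ k) q n)⁻¹ = (qPoch x q (k + n))⁻¹ * qPoch x q k := by
      rw [qPoch_add, mul_inv, mul_right_comm, inv_mul_cancel₀ (h0 k), one_mul]
    rw [this, norm_mul]
    exact mul_le_mul (hA _) (hB _) (norm_nonneg _) hA0

/-- Uniform bound for the summands `f (x q^k)`, which gives both convergence at `x` and
boundedness of the sums along `x q^k`. -/
def GeometricallyBounded (q : ℂ) (f : ℂ → ℕ → ℂ) : Prop :=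
  ∀ x : ℂ, ‖x‖ < 1 → ∃ C : ℝ, ∀ k n : ℕ, ‖f (x * q ^ k) n‖ ≤ C * ‖x‖ ^ n

lemma GeometricallyBounded.summable {q : ℂ} {f : ℂ → ℕ → ℂ} (h : GeometricallyBounded q f) {x : ℂ}
    (hx : ‖x‖ < 1) : Summable (f x) := by
  obtain ⟨C, hC⟩ := h x hx
  refine Summable.of_norm_bounded
    ((summable_geometric_of_lt_one (norm_nonneg x) hx).mul_left C) fun n => ?_
  simpa using hC 0 n

lemma GeometricallyBounded.norm_tsum_le {q : ℂ} {f : ℂ → ℕ → ℂ} (h : GeometricallyBounded q f)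
    {x : ℂ} (hx : ‖x‖ < 1) : ∃ C : ℝ, ∀ k : ℕ, ‖∑' n, f (x * q ^ k) n‖ ≤ C := by
  obtain ⟨C, hC⟩ := h x hx
  exact ⟨_, fun k => tsum_of_norm_bounded
    ((summable_geometric_of_lt_one (norm_nonneg x) hx).mul_left C).hasSum fun n => hC k n⟩

lemma norm_mul_pow_lt_one {x q : ℂ} (hq : ‖q‖ < 1) (hx : ‖x‖ < 1) (k : ℕ) : ‖x * q ^ k‖ < 1 := by
  rw [norm_mul, norm_pow]
  exact (mul_le_of_le_one_right (norm_nonneg x) (pow_le_one₀ (norm_nonneg q) hq.le)).trans_lt hx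

lemma norm_pow_mul_pow_le {x q : ℂ} (hq : ‖q‖ < 1) (k n : ℕ) :
    ‖(x * q ^ k) ^ n‖ ≤ ‖x‖ ^ n := by
  rw [norm_pow, norm_mul, norm_pow]
  exact pow_le_pow_left₀ (by positivity)
    (mul_le_of_le_one_right (norm_nonneg x) (pow_le_one₀ (norm_nonneg q) hq.le)) n

lemma geometricallyBounded_eulerTerm {q : ℂ} (hq : ‖q‖ < 1) :
    GeometricallyBounded q (eulerTerm q) := by
  intro x hx
  obtain ⟨A, hA0, hA⟩ := exists_norm_qPoch_mul_pow_le hq hx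
  obtain ⟨B, hB0, hB⟩ := exists_norm_qPoch_mul_pow_le (x := -x) hq (by simpa using hx)
  refine ⟨B * A, fun k n => ?_⟩
  rw [eulerTerm, div_eq_mul_inv, norm_mul, norm_mul, norm_mul, ← neg_mul]
  have h1 := (hA k (n + 1)).2
  have h2 := (hB k n).1
  have h3 : ‖q ^ ((n + 1).choose 2)‖ ≤ 1 := by
    rw [norm_pow]; exact pow_le_one₀ (norm_nonneg q) hq.le
  have h4 := norm_pow_mul_pow_le (x := x) hq k n
  calc _ ≤ 1 * ‖x‖ ^ n * B * A := by gcongr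
    _ = _ := by ring

lemma geometricallyBounded_eulerTermAppell {q : ℂ} (hq : ‖q‖ < 1) :
    GeometricallyBounded q (eulerTermAppell q) := by
  intro x hx
  have hx2 : ‖-x ^ 2‖ < 1 := by rw [norm_neg]; exact norm_sq_lt_one hx
  obtain ⟨A, hA0, hA⟩ := exists_norm_qPoch_mul_pow_le (norm_sq_lt_one hq) hx2
  obtain ⟨B, hB0, hB⟩ := exists_norm_qPoch_mul_pow_le (x := -x) hq (by simpa using hx)
  obtain ⟨D, hD0, hD⟩ := exists_norm_qPoch_le (-q) hq
  refine ⟨B * D * A, fun k n => ?_⟩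
  rw [eulerTermAppell, div_eq_mul_inv, norm_mul, norm_mul, norm_mul, ← neg_mul,
    show -(x * q ^ k) ^ 2 = -x ^ 2 * (q ^ 2) ^ k by ring]
  have h1 := (hA k (n + 1)).2
  have h2 := (hB k n).1
  have h3 := hD n
  have h4 := norm_pow_mul_pow_le (x := x) hq k n
  calc _ ≤ ‖x‖ ^ n * B * D * A := by gcongr
    _ = _ := by ring

lemma geometricallyBounded_eulerTermBilateral {q : ℂ} (hq : ‖q‖ < 1) :
    GeometricallyBounded q (eulerTermBilateral q) := by
  intro x hx
  obtain ⟨A, hA0, hA⟩ := exists_norm_qPoch_mul_pow_le hq hx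
  obtain ⟨D, hD0, hD⟩ := exists_norm_qPoch_le (-q ^ 2) (norm_sq_lt_one hq)
  refine ⟨D * A, fun k n => ?_⟩
  rw [eulerTermBilateral, div_eq_mul_inv, norm_mul, norm_mul, norm_mul]
  have h1 := (hA k (2 * n + 2)).2
  have h2 := hD n
  have h3 : ‖q ^ (n ^ 2)‖ ≤ 1 := by rw [norm_pow]; exact pow_le_one₀ (norm_nonneg q) hq.le
  have h4 : ‖(x * q ^ k) ^ (2 * n)‖ ≤ ‖x‖ ^ n :=
    (norm_pow_mul_pow_le (x := x) hq k (2 * n)).trans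
      (pow_le_pow_of_le_one (norm_nonneg x) hx.le (by omega))
  calc _ ≤ 1 * ‖x‖ ^ n * D * A := by gcongr
    _ = _ := by ring

/-- The second order `q`-difference equation
`(1-x)(1-xq) M(x) - x²q(1-xq) M(xq) - x²q³(1+xq) M(xq²) = 1`. -/
def QDiffEq (q : ℂ) (M : ℂ → ℂ) (x : ℂ) : Prop :=
  (1 - x) * (1 - x * q) * M x - x ^ 2 * q * (1 - x * q) * M (x * q) -
    q ^ 3 * x ^ 2 * (1 + x * q) * M (x * q ^ 2) = 1

/-- A bounded solution of the homogeneous equation along `x q^k` vanishes: far out the equation is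
a contraction, and from there it determines the solution backwards. -/
lemma eq_zero_of_qDiffEq {q x : ℂ} (hq : ‖q‖ < 1) (hx : ‖x‖ < 1) {D : ℕ → ℂ} {C : ℝ}
    (hC : ∀ k, ‖D k‖ ≤ C)
    (hD : ∀ k, (1 - x * q ^ k) * (1 - x * q ^ k * q) * D k =
      (x * q ^ k) ^ 2 * q * (1 - x * q ^ k * q) * D (k + 1) +
      q ^ 3 * (x * q ^ k) ^ 2 * (1 + x * q ^ k * q) * D (k + 2)) : D 0 = 0 := by
  have hne : ∀ k : ℕ, (1 - x * q ^ k) * (1 - x * q ^ k * q) ≠ 0 := fun k => by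
    refine mul_ne_zero (sub_ne_zero.2 (mul_pow_ne_one hx hq k).symm) (sub_ne_zero.2 ?_)
    have := mul_pow_ne_one hx hq (k + 1)
    rw [pow_succ, ← mul_assoc] at this
    exact this.symm
  set a : ℕ → ℂ := fun k => (x * q ^ k) ^ 2 * q * (1 - x * q ^ k * q) /
    ((1 - x * q ^ k) * (1 - x * q ^ k * q)) with ha
  set b : ℕ → ℂ := fun k => q ^ 3 * (x * q ^ k) ^ 2 * (1 + x * q ^ k * q) /
    ((1 - x * q ^ k) * (1 - x * q ^ k * q)) with hb
  have hD' : ∀ k, D k = a k * D (k + 1) + b k * D (k + 2) := fun k => by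
    have := hne k
    simp only [ha, hb]
    rw [div_mul_eq_mul_div, div_mul_eq_mul_div, ← add_div, ← hD, mul_div_cancel_left₀ _ this]
  have hX : Tendsto (fun k : ℕ => x * q ^ k) atTop (𝓝 0) := by
    simpa using (tendsto_pow_zero hq).const_mul x
  have hden : Tendsto (fun k : ℕ => (1 - x * q ^ k) * (1 - x * q ^ k * q)) atTop (𝓝 1) := by
    simpa using (hX.const_sub 1).mul ((hX.mul_const q).const_sub 1)
  have hat : Tendsto a atTop (𝓝 0) := by
    have := ((((hX.pow 2).mul_const q).mul ((hX.mul_const q).const_sub 1))).div hden one_ne_zero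
    simpa [ha, Pi.div_def] using this
  have hbt : Tendsto b atTop (𝓝 0) := by
    have := (((hX.pow 2).const_mul (q ^ 3)).mul ((hX.mul_const q).const_add 1)).div hden
      one_ne_zero
    simpa [hb, Pi.div_def] using this
  have hfar : ∀ᶠ k in atTop, ‖a k‖ ≤ 1 / 4 ∧ ‖b k‖ ≤ 1 / 4 := by
    have h1 := hat.norm.eventually (ge_mem_nhds (by simp : ‖(0 : ℂ)‖ < 1 / 4))
    have h2 := hbt.norm.eventually (ge_mem_nhds (by simp : ‖(0 : ℂ)‖ < 1 / 4))
    exact h1.and h2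
  obtain ⟨K, hK⟩ := eventually_atTop.1 hfar
  -- for `k ≥ K` each application of the equation halves the bound on `D`
  have hdecay : ∀ j : ℕ, ∀ k, K ≤ k → ‖D k‖ ≤ C * (1 / 2) ^ j := by
    intro j
    induction j with
    | zero => intro k _; simpa using hC k
    | succ j ih =>
      intro k hk
      have h1 := ih (k + 1) (by omega)
      have h2 := ih (k + 2) (by omega)
      obtain ⟨h3, h4⟩ := hK k hk
      rw [hD' k]
      calc _ ≤ ‖a k‖ * ‖D (k + 1)‖ + ‖b k‖ * ‖D (k + 2)‖ := by
            simpa [norm_mul] using norm_add_le (a k * D (k + 1)) (b k * D (k + 2))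
        _ ≤ 1 / 4 * (C * (1 / 2) ^ j) + 1 / 4 * (C * (1 / 2) ^ j) := by gcongr
        _ = _ := by ring
  have hzero : ∀ k, K ≤ k → D k = 0 := by
    intro k hk
    have hlim : Tendsto (fun j : ℕ => C * (1 / 2 : ℝ) ^ j) atTop (𝓝 0) := by
      simpa using (tendsto_pow_atTop_nhds_zero_of_lt_one (by norm_num : (0 : ℝ) ≤ 1 / 2)
        (by norm_num)).const_mul C
    exact norm_le_zero_iff.1 (ge_of_tendsto' hlim fun j => hdecay j k hk)
  have hback : ∀ i k, K ≤ k + i → D k = 0 := by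
    intro i
    induction i using Nat.strong_induction_on with
    | _ i ih =>
      intro k hk
      rcases Nat.lt_or_ge k K with h | h
      · rw [hD' k, ih (i - 1) (by omega) (k + 1) (by omega)]
        rcases Nat.lt_or_ge i 2 with h' | h'
        · rw [hzero (k + 2) (by omega)]; simp
        · rw [ih (i - 2) (by omega) (k + 2) (by omega)]; simp
      · exact hzero k h
  exact hback K 0 (by omega)

/-- Two series with the same `q`-difference equation have the same sum. -/
lemma tsum_eq_of_qDiffEq {q : ℂ} (hq : ‖q‖ < 1) {f g : ℂ → ℕ → ℂ}
    (hf : GeometricallyBounded q f) (hg : GeometricallyBounded q g)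
    (hf' : ∀ x, ‖x‖ < 1 → QDiffEq q (fun x => ∑' n, f x n) x)
    (hg' : ∀ x, ‖x‖ < 1 → QDiffEq q (fun x => ∑' n, g x n) x) {x : ℂ} (hx : ‖x‖ < 1) :
    ∑' n, f x n = ∑' n, g x n := by
  obtain ⟨A, hA⟩ := hf.norm_tsum_le hx
  obtain ⟨B, hB⟩ := hg.norm_tsum_le hx
  have := eq_zero_of_qDiffEq (D := fun k => ∑' n, f (x * q ^ k) n - ∑' n, g (x * q ^ k) n)
    (C := A + B) hq hx (fun k => (norm_sub_le _ _).trans (add_le_add (hA k) (hB k))) fun k => by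
      have h1 := hf' _ (norm_mul_pow_lt_one hq hx k)
      have h2 := hg' _ (norm_mul_pow_lt_one hq hx k)
      simp only [QDiffEq] at h1 h2
      rw [show x * q ^ (k + 1) = x * q ^ k * q by ring,
        show x * q ^ (k + 2) = x * q ^ k * q ^ 2 by ring]
      linear_combination h1 - h2
  simpa [sub_eq_zero] using this

lemma qPoch_mul_self_left (x q : ℂ) (n : ℕ) :
    (1 - x) * qPoch (x * q) q n = qPoch x q n * (1 - x * q ^ n) := by
  rw [← qPoch_succ', qPoch_succ]

lemma qPoch_neg_mul_self_left {x : ℂ} (q : ℂ) (n : ℕ) (hx : 1 + x ≠ 0) :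
    qPoch (-(x * q)) q n = qPoch (-x) q n * (1 + x * q ^ n) / (1 + x) := by
  have := qPoch_mul_self_left (-x) q n
  rw [neg_mul] at this
  rw [eq_div_iff hx]
  linear_combination this

lemma one_sub_ne_zero_of_norm_lt {z : ℂ} (hz : ‖z‖ < 1) : 1 - z ≠ 0 := by
  have := mul_pow_ne_one hz hz 0
  rw [pow_zero, mul_one] at this
  exact sub_ne_zero.2 this.symm

/-- The equation holds termwise after a shift: the summand of index `n + 1` at `x` is a combination
of the summands of index `n` at `xq` and at `xq²`, and the first term gives the constant `1`. -/
lemma qDiffEq_eulerTermBilateral {q x : ℂ} (hq : ‖q‖ < 1) (hx : ‖x‖ < 1) :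
    QDiffEq q (fun x => ∑' n, eulerTermBilateral q x n) x := by
  have hs := geometricallyBounded_eulerTermBilateral hq
  have h1 : ‖x * q‖ < 1 := by simpa using norm_mul_pow_lt_one hq hx 1
  have h2 : ‖x * q ^ 2‖ < 1 := norm_mul_pow_lt_one hq hx 2
  have x1 := one_sub_ne_zero_of_norm_lt hx
  have x2 := one_sub_ne_zero_of_norm_lt h1
  simp only [QDiffEq]
  rw [(hs.summable hx).tsum_eq_zero_add]
  have h0 : eulerTermBilateral q x 0 = 1 / ((1 - x) * (1 - x * q)) := by
    simp [eulerTermBilateral, qPoch_succ]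
  have hn : ∀ n, eulerTermBilateral q x (n + 1) =
      (x ^ 2 * q / (1 - x)) * eulerTermBilateral q (x * q) n +
      (q ^ 3 * x ^ 2 * (1 + x * q) / ((1 - x) * (1 - x * q))) *
        eulerTermBilateral q (x * q ^ 2) n := by
    intro n
    have e1 : qPoch (x * q) q (2 * n + 2) = qPoch x q (2 * n + 3) / (1 - x) := by
      rw [show 2 * n + 3 = 2 * n + 2 + 1 by ring, qPoch_succ' x, mul_div_cancel_left₀ _ x1]
    have e2 : qPoch (x * q ^ 2) q (2 * n + 2) =
        qPoch x q (2 * n + 3) * (1 - x * q ^ (2 * n + 3)) / ((1 - x) * (1 - x * q)) := by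
      rw [← qPoch_succ, show 2 * n + 3 + 1 = 2 * n + 2 + 1 + 1 by ring, qPoch_succ' x,
        qPoch_succ' (x * q), ← mul_assoc, mul_div_cancel_left₀ _ (mul_ne_zero x1 x2)]
      congr 1
      ring
    have p1 := qPoch_ne_zero (mul_pow_ne_one hx hq) (2 * n + 3)
    have p2 : 1 - x * q ^ (2 * n + 3) ≠ 0 := sub_ne_zero.2 (mul_pow_ne_one hx hq _).symm
    simp only [eulerTermBilateral, e1, e2]
    rw [show 2 * (n + 1) + 2 = 2 * n + 3 + 1 by ring, qPoch_succ x, qPoch_succ (-q ^ 2)]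
    rw [show q ^ (2 * n + 3) = q ^ 3 * (q ^ n) ^ 2 by ring] at p2 ⊢
    rw [show (q ^ 2) ^ n = (q ^ n) ^ 2 by ring,
      show q ^ ((n + 1) ^ 2) = q ^ (n ^ 2) * (q ^ n) ^ 2 * q by ring,
      show (x * q) ^ (2 * n) = x ^ (2 * n) * (q ^ n) ^ 2 by ring,
      show (x * q ^ 2) ^ (2 * n) = x ^ (2 * n) * (q ^ n) ^ 4 by ring,
      show x ^ (2 * (n + 1)) = x ^ (2 * n) * x ^ 2 by ring]
    generalize q ^ n = y at *
    generalize q ^ n ^ 2 = z at *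
    generalize x ^ (2 * n) = w at *
    generalize qPoch x q (2 * n + 3) = P at *
    generalize qPoch (-q ^ 2) (q ^ 2) n = P' at *
    generalize hD1 : 1 - x * (q ^ 3 * y ^ 2) = D1 at *
    generalize hD2 : 1 - x * q = D2 at *
    generalize hD3 : 1 - x = D3 at *
    field_simp
    subst hD1 hD2 hD3
    ring
  simp only [hn]
  rw [((hs.summable h1).mul_left _).tsum_add ((hs.summable h2).mul_left _), tsum_mul_left,
    tsum_mul_left, h0]
  field_simp
  ring

/-- The combination of summands telescopes, `G` being a rational multiple of `eulerTerm q x n`. -/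
lemma qDiffEq_eulerTerm {q x : ℂ} (hq : ‖q‖ < 1) (hx : ‖x‖ < 1) :
    QDiffEq q (fun x => ∑' n, eulerTerm q x n) x := by
  have hs := geometricallyBounded_eulerTerm hq
  have h1 : ‖x * q‖ < 1 := by simpa using norm_mul_pow_lt_one hq hx 1
  have h2 : ‖x * q ^ 2‖ < 1 := norm_mul_pow_lt_one hq hx 2
  have hnx : ‖-x‖ < 1 := by simpa using hx
  have x1 := one_sub_ne_zero_of_norm_lt hx
  have x2 := one_sub_ne_zero_of_norm_lt h1
  have x3 : 1 + x ≠ 0 := by simpa using one_sub_ne_zero_of_norm_lt hnx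
  have x4 : 1 + x * q ≠ 0 := by
    simpa using one_sub_ne_zero_of_norm_lt (z := -(x * q)) (by simpa using h1)
  simp only [QDiffEq]
  rw [← tsum_mul_left, ← tsum_mul_left, ← tsum_mul_left,
    ← ((hs.summable hx).mul_left _).tsum_sub ((hs.summable h1).mul_left _),
    ← (((hs.summable hx).mul_left _).sub ((hs.summable h1).mul_left _)).tsum_sub
      ((hs.summable h2).mul_left _)]
  rw [tsum_eq_of_telescope (G := fun n => eulerTerm q x n * ((1 - x) * (1 - x * q) *
    (-(1 + x) + q * x ^ 2 * q ^ n * (1 - q ^ n)) / ((1 - x * q * q ^ n) * (1 + x))))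
    ((((hs.summable hx).mul_left _).sub ((hs.summable h1).mul_left _)).sub
      ((hs.summable h2).mul_left _))]
  · simp [eulerTerm, qPoch_succ]
    field_simp
    ring
  · intro n
    have d1 : 1 - x * q * q ^ n ≠ 0 := one_sub_ne_zero_of_norm_lt (norm_mul_pow_lt_one hq h1 n)
    have d2 : 1 - x * q ^ 2 * q ^ n ≠ 0 := one_sub_ne_zero_of_norm_lt (norm_mul_pow_lt_one hq h2 n)
    have p1 := qPoch_ne_zero (mul_pow_ne_one hx hq) (n + 1)
    have e1 := qPoch_neg_mul_self_left q n x3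
    have e2 := qPoch_neg_mul_self_left q n x4
    rw [show x * q * q = x * q ^ 2 by ring] at e2
    have e3 : qPoch (x * q) q (n + 1) = qPoch x q (n + 1) * (1 - x * q * q ^ n) / (1 - x) := by
      rw [eq_div_iff x1, mul_comm, qPoch_mul_self_left]; ring
    have e4 : qPoch (x * q ^ 2) q (n + 1) =
        qPoch (x * q) q (n + 1) * (1 - x * q ^ 2 * q ^ n) / (1 - x * q) := by
      rw [eq_div_iff x2, mul_comm, show x * q ^ 2 = x * q * q by ring, qPoch_mul_self_left]; ring
    have r1 : eulerTerm q (x * q) n = eulerTerm q x n *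
        (q ^ n * (1 + x * q ^ n) * (1 - x) / ((1 + x) * (1 - x * q * q ^ n))) := by
      rw [eulerTerm, eulerTerm, e1, e3, mul_pow]
      field_simp
    have r2 : eulerTerm q (x * q ^ 2) n = eulerTerm q (x * q) n *
        (q ^ n * (1 + x * q * q ^ n) * (1 - x * q) /
          ((1 + x * q) * (1 - x * q ^ 2 * q ^ n))) := by
      have p2 : qPoch (x * q) q (n + 1) ≠ 0 := by
        rw [e3]; exact div_ne_zero (mul_ne_zero p1 d1) x1
      rw [eulerTerm, eulerTerm, e2, e4, mul_pow, mul_pow, ← pow_mul, mul_comm 2 n, pow_mul]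
      generalize qPoch (x * q) q (n + 1) = P at *
      generalize 1 - x * q ^ 2 * q ^ n = D1 at *
      generalize 1 - x * q = D2 at *
      generalize 1 + x * q = D3 at *
      field_simp
    have r3 : eulerTerm q x (n + 1) = eulerTerm q x n *
        (q * q ^ n * x * (1 + x * q ^ n) / (1 - x * q * q ^ n)) := by
      rw [eulerTerm, eulerTerm, qPoch_succ, qPoch_succ x q (n + 1),
        Nat.choose_succ_succ (n + 1) 1, Nat.choose_one_right, pow_add q (n + 1), pow_succ x,
        pow_succ' q n, ← mul_assoc x]
      generalize qPoch x q (n + 1) = P at *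
      generalize 1 - x * q * q ^ n = D1 at *
      field_simp
      ring
    rw [r3, r2, r1, pow_succ' q n, show x * q * (q * q ^ n) = x * q ^ 2 * q ^ n by ring]
    clear r1 r2 r3 e1 e2 e3 e4 p1
    generalize eulerTerm q x n = l at *
    generalize q ^ n = y at *
    generalize hD1 : 1 - x * q ^ 2 * y = D1 at *
    generalize hD2 : 1 - x * q * y = D2 at *
    generalize hD3 : 1 + x * q = D3 at *
    generalize hD4 : 1 - x * q = D4 at *
    generalize hD5 : 1 + x = D5 at *
    field_simp
    subst hD1 hD2 hD3 hD4 hD5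
    ring
  · have hy := tendsto_pow_zero hq
    have hR : Tendsto (fun n : ℕ => (1 - x) * (1 - x * q) *
        (-(1 + x) + q * x ^ 2 * q ^ n * (1 - q ^ n)) / ((1 - x * q * q ^ n) * (1 + x))) atTop
        (𝓝 ((1 - x) * (1 - x * q) *
        (-(1 + x) + q * x ^ 2 * 0 * (1 - 0)) / ((1 - x * q * 0) * (1 + x)))) := by
      refine Tendsto.div ?_ ?_ (by simpa using x3)
      · exact (((hy.const_mul _).mul (hy.const_sub 1)).const_add _).const_mul _
      · exact ((hy.const_mul _).const_sub 1).mul_const _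
    simpa using (hs.summable hx).tendsto_atTop_zero.mul hR

/-- The combination of summands telescopes, `G` being a rational multiple of
`eulerTermAppell q x n`. -/
lemma qDiffEq_eulerTermAppell {q x : ℂ} (hq : ‖q‖ < 1) (hx : ‖x‖ < 1) :
    QDiffEq q (fun x => ∑' n, eulerTermAppell q x n) x := by
  have hs := geometricallyBounded_eulerTermAppell hq
  have h1 : ‖x * q‖ < 1 := by simpa using norm_mul_pow_lt_one hq hx 1
  have h2 : ‖x * q ^ 2‖ < 1 := norm_mul_pow_lt_one hq hx 2
  have hq2 := norm_sq_lt_one hq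
  have hx2 : ‖-x ^ 2‖ < 1 := by rw [norm_neg]; exact norm_sq_lt_one hx
  have h12 : ‖-(x * q) ^ 2‖ < 1 := by rw [norm_neg]; exact norm_sq_lt_one h1
  have h22 : ‖-(x * q ^ 2) ^ 2‖ < 1 := by rw [norm_neg]; exact norm_sq_lt_one h2
  have x3 : 1 + x ≠ 0 := by simpa using one_sub_ne_zero_of_norm_lt (z := -x) (by simpa using hx)
  have x4 : 1 + x * q ≠ 0 := by
    simpa using one_sub_ne_zero_of_norm_lt (z := -(x * q)) (by simpa using h1)
  have x5 : 1 + x ^ 2 ≠ 0 := by simpa using one_sub_ne_zero_of_norm_lt hx2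
  have x6 : 1 + (x * q) ^ 2 ≠ 0 := by simpa using one_sub_ne_zero_of_norm_lt h12
  simp only [QDiffEq]
  rw [← tsum_mul_left, ← tsum_mul_left, ← tsum_mul_left,
    ← ((hs.summable hx).mul_left _).tsum_sub ((hs.summable h1).mul_left _),
    ← (((hs.summable hx).mul_left _).sub ((hs.summable h1).mul_left _)).tsum_sub
      ((hs.summable h2).mul_left _)]
  rw [tsum_eq_of_telescope (G := fun n => eulerTermAppell q x n *
    ((-((1 + x) * (1 - x * q)) - x * (q + x + x ^ 2 - q * x ^ 3) * q ^ n -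
      x ^ 2 * (q + q ^ 2 + x * q ^ 2 + x ^ 2 * q - x ^ 2 * q ^ 3 + x ^ 3 * q ^ 3) * (q ^ n) ^ 2 -
      x ^ 4 * q ^ 2 * (1 + q + x - x * q) * (q ^ n) ^ 3) /
        ((1 + x ^ 2 * q ^ 2 * (q ^ n) ^ 2) * (1 + x))))
    ((((hs.summable hx).mul_left _).sub ((hs.summable h1).mul_left _)).sub
      ((hs.summable h2).mul_left _))]
  · simp [eulerTermAppell, qPoch_succ]
    rw [mul_pow] at x6
    field_simp
    ring
  · intro n
    have d1 : 1 + x ^ 2 * q ^ 2 * (q ^ n) ^ 2 ≠ 0 := by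
      have := one_sub_ne_zero_of_norm_lt (norm_mul_pow_lt_one hq2 h12 n)
      convert this using 1; ring
    have d2 : 1 + x ^ 2 * q ^ 4 * (q ^ n) ^ 2 ≠ 0 := by
      have := one_sub_ne_zero_of_norm_lt (norm_mul_pow_lt_one hq2 h22 n)
      convert this using 1; ring
    have p1 := qPoch_ne_zero (mul_pow_ne_one hx2 hq2) (n + 1)
    have p2 := qPoch_ne_zero (mul_pow_ne_one h12 hq2) (n + 1)
    have e1 := qPoch_neg_mul_self_left q n x3
    have e2 := qPoch_neg_mul_self_left q n x4
    rw [show x * q * q = x * q ^ 2 by ring] at e2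
    have e3 := qPoch_neg_mul_self_left (q ^ 2) (n + 1) x5
    have e4 := qPoch_neg_mul_self_left (q ^ 2) (n + 1) x6
    rw [← mul_pow, show x ^ 2 * (q ^ 2) ^ (n + 1) = x ^ 2 * q ^ 2 * (q ^ n) ^ 2 by ring] at e3
    rw [← mul_pow, show (x * q) ^ 2 * (q ^ 2) ^ (n + 1) = x ^ 2 * q ^ 4 * (q ^ n) ^ 2 by ring,
      show x * q * q = x * q ^ 2 by ring] at e4
    have r1 : eulerTermAppell q (x * q) n = eulerTermAppell q x n *
        (q ^ n * (1 + x * q ^ n) * (1 + x ^ 2) /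
          ((1 + x) * (1 + x ^ 2 * q ^ 2 * (q ^ n) ^ 2))) := by
      rw [eulerTermAppell, eulerTermAppell, e1, e3, mul_pow x q n]
      generalize qPoch (-x ^ 2) (q ^ 2) (n + 1) = P at *
      generalize 1 + x ^ 2 * q ^ 2 * (q ^ n) ^ 2 = D1 at *
      field_simp
    have r2 : eulerTermAppell q (x * q ^ 2) n = eulerTermAppell q (x * q) n *
        (q ^ n * (1 + x * q * q ^ n) * (1 + (x * q) ^ 2) /
          ((1 + x * q) * (1 + x ^ 2 * q ^ 4 * (q ^ n) ^ 2))) := by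
      rw [eulerTermAppell, eulerTermAppell, e2, e4, mul_pow x (q ^ 2) n, mul_pow x q n, ← pow_mul,
        mul_comm 2 n, pow_mul]
      generalize qPoch (-(x * q) ^ 2) (q ^ 2) (n + 1) = P at *
      generalize 1 + x ^ 2 * q ^ 4 * (q ^ n) ^ 2 = D1 at *
      generalize 1 + (x * q) ^ 2 = D2 at *
      generalize 1 + x * q = D3 at *
      field_simp
    have r3 : eulerTermAppell q x (n + 1) = eulerTermAppell q x n *
        (x * (1 + x * q ^ n) * (1 + q * q ^ n) / (1 + x ^ 2 * q ^ 2 * (q ^ n) ^ 2)) := by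
      rw [eulerTermAppell, eulerTermAppell, qPoch_succ, qPoch_succ (-q),
        qPoch_succ (-x ^ 2) _ (n + 1), pow_succ x,
        show 1 - -x ^ 2 * (q ^ 2) ^ (n + 1) = 1 + x ^ 2 * q ^ 2 * (q ^ n) ^ 2 by ring]
      generalize qPoch (-x ^ 2) (q ^ 2) (n + 1) = P at *
      generalize 1 + x ^ 2 * q ^ 2 * (q ^ n) ^ 2 = D1 at *
      field_simp
      ring
    rw [r3, r2, r1, pow_succ' q n,
      show x ^ 2 * q ^ 2 * (q * q ^ n) ^ 2 = x ^ 2 * q ^ 4 * (q ^ n) ^ 2 by ring]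
    clear r1 r2 r3 e1 e2 e3 e4 p1 p2
    generalize eulerTermAppell q x n = l at *
    generalize q ^ n = y at *
    generalize hD1 : 1 + x ^ 2 * q ^ 4 * y ^ 2 = D1 at *
    generalize hD2 : 1 + x ^ 2 * q ^ 2 * y ^ 2 = D2 at *
    generalize hD3 : 1 + x * q = D3 at *
    generalize hD5 : 1 + x = D5 at *
    field_simp
    subst hD1 hD2 hD3 hD5
    ring
  · have hy := tendsto_pow_zero hq
    have hR : Tendsto (fun n : ℕ =>
        ((-((1 + x) * (1 - x * q)) - x * (q + x + x ^ 2 - q * x ^ 3) * q ^ n -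
        x ^ 2 * (q + q ^ 2 + x * q ^ 2 + x ^ 2 * q - x ^ 2 * q ^ 3 + x ^ 3 * q ^ 3) * (q ^ n) ^ 2 -
        x ^ 4 * q ^ 2 * (1 + q + x - x * q) * (q ^ n) ^ 3) /
        ((1 + x ^ 2 * q ^ 2 * (q ^ n) ^ 2) * (1 + x)))) atTop
        (𝓝 ((-((1 + x) * (1 - x * q)) - x * (q + x + x ^ 2 - q * x ^ 3) * 0 -
        x ^ 2 * (q + q ^ 2 + x * q ^ 2 + x ^ 2 * q - x ^ 2 * q ^ 3 + x ^ 3 * q ^ 3) * 0 ^ 2 -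
        x ^ 4 * q ^ 2 * (1 + q + x - x * q) * 0 ^ 3) /
        ((1 + x ^ 2 * q ^ 2 * 0 ^ 2) * (1 + x)))) := by
      refine Tendsto.div ?_ ?_ (by simpa using x3)
      · exact (((hy.const_mul _).const_sub _).sub ((hy.pow 2).const_mul _)).sub
          ((hy.pow 3).const_mul _)
      · exact (((hy.pow 2).const_mul _).const_add 1).mul_const _
    simpa using (hs.summable hx).tendsto_atTop_zero.mul hR

theorem tsum_eulerTerm_eq_appell {q x : ℂ} (hq : ‖q‖ < 1) (hx : ‖x‖ < 1) :
    ∑' n, eulerTerm q x n = ∑' n, eulerTermAppell q x n :=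
  tsum_eq_of_qDiffEq hq (geometricallyBounded_eulerTerm hq) (geometricallyBounded_eulerTermAppell hq)
    (fun _ => qDiffEq_eulerTerm hq) (fun _ => qDiffEq_eulerTermAppell hq) hx

theorem tsum_eulerTerm_eq_bilateral {q x : ℂ} (hq : ‖q‖ < 1) (hx : ‖x‖ < 1) :
    ∑' n, eulerTerm q x n = ∑' n, eulerTermBilateral q x n :=
  tsum_eq_of_qDiffEq hq (geometricallyBounded_eulerTerm hq)
    (geometricallyBounded_eulerTermBilateral hq)
    (fun _ => qDiffEq_eulerTerm hq) (fun _ => qDiffEq_eulerTermBilateral hq) hx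

/-! ### Convergence of Eulerian and Hecke-type series -/

lemma summable_norm_pow {q : ℂ} (hq : ‖q‖ < 1) {N : ℕ → ℕ} (hN : ∀ n, n ≤ N n) :
    Summable fun n => ‖q ^ N n‖ := by
  refine Summable.of_nonneg_of_le (fun _ => norm_nonneg _) (fun n => ?_)
    (summable_geometric_of_lt_one (norm_nonneg q) hq)
  rw [norm_pow]
  exact pow_le_pow_of_le_one (norm_nonneg q) hq.le (hN n)

lemma summable_norm_mul_of_tendsto {f g : ℕ → ℂ} {l : ℂ} (hg : Tendsto g atTop (𝓝 l))
    (hf : Summable fun n => ‖f n‖) : Summable fun n => ‖g n * f n‖ := by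
  obtain ⟨C, hC⟩ := hg.norm.bddAbove_range
  refine Summable.of_nonneg_of_le (fun _ => norm_nonneg _) (fun n => ?_) (hf.mul_left C)
  rw [norm_mul]
  exact mul_le_mul_of_nonneg_right (hC ⟨n, rfl⟩) (norm_nonneg _)

lemma summable_eulerian {q p x y : ℂ} (hq : ‖q‖ < 1) (hp : ‖p‖ < 1) (hy : ∀ k : ℕ, y * p ^ k ≠ 1)
    {N m : ℕ → ℕ} (hN : ∀ n, n ≤ N n) :
    Summable fun n => q ^ N n * qPoch x p n / qPoch y p (m n) := by
  obtain ⟨A, hA0, hA⟩ := exists_norm_qPoch_le x hp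
  obtain ⟨B, hB0, hB⟩ := exists_norm_inv_qPoch_le hp hy
  refine Summable.of_norm_bounded ((summable_norm_pow hq hN).mul_right (A * B)) fun n => ?_
  rw [div_eq_mul_inv, norm_mul, norm_mul, mul_assoc]
  have := hA n
  have := hB (m n)
  gcongr

/-- Hecke-type series converge: the powers of `q` in front outweigh the negative powers of `q`
in the inner sums by at least `q^n`. -/
lemma summable_norm_hecke {q l : ℂ} (hq : ‖q‖ < 1) (hq0 : q ≠ 0) {g : ℕ → ℂ} {N : ℕ → ℕ}
    {S : ℕ → Finset ℤ} {c : ℤ → ℂ} {e : ℤ → ℤ} (hg : Tendsto g atTop (𝓝 l))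
    (hc : ∀ j, ‖c j‖ ≤ 1) (hS : ∀ n, (S n).card ≤ 2 * n + 2)
    (he : ∀ n : ℕ, ∀ j ∈ S n, (n : ℤ) ≤ N n + e j) :
    Summable fun n => ‖g n * (q ^ N n * ∑ j ∈ S n, c j * q ^ e j)‖ := by
  refine summable_norm_mul_of_tendsto hg ?_
  have hsum : Summable fun n : ℕ => (2 * (n : ℝ) + 2) * ‖q‖ ^ n := by
    have h1 := summable_pow_mul_geometric_of_norm_lt_one 1 (r := ‖q‖) (by simpa using hq)
    have h0 := summable_geometric_of_lt_one (norm_nonneg q) hq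
    refine ((h1.mul_left 2).add (h0.mul_left 2)).congr fun n => ?_
    ring
  refine Summable.of_nonneg_of_le (fun _ => norm_nonneg _) (fun n => ?_) hsum
  rw [Finset.mul_sum]
  have hterm : ∀ j ∈ S n, ‖q ^ N n * (c j * q ^ e j)‖ ≤ ‖q‖ ^ n := by
    intro j hj
    have : q ^ N n * (c j * q ^ e j) = c j * q ^ ((N n : ℤ) + e j) := by
      rw [zpow_add₀ hq0, zpow_natCast]; ring
    rw [this, norm_mul, norm_zpow]
    obtain ⟨k, hk⟩ := Int.eq_ofNat_of_zero_le (sub_nonneg.2 (he n j hj))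
    have hk' : (N n : ℤ) + e j = ((n + k : ℕ) : ℤ) := by push_cast; omega
    rw [hk', zpow_natCast]
    calc _ ≤ 1 * ‖q‖ ^ n := mul_le_mul (hc j)
          (pow_le_pow_of_le_one (norm_nonneg q) hq.le (by omega)) (by positivity) zero_le_one
      _ = _ := one_mul _
  refine (norm_sum_le _ _).trans ((Finset.sum_le_sum hterm).trans ?_)
  rw [Finset.sum_const, nsmul_eq_mul]
  have : ((S n).card : ℝ) ≤ 2 * n + 2 := by exact_mod_cast hS n
  gcongr

/-! ### Bailey's lemma with one parameter sent to infinity -/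

lemma revPoch_zero_left (q : ℂ) (n : ℕ) : revPoch 0 q n = (-1) ^ n * q ^ (n.choose 2) := by
  induction n with
  | zero => simp
  | succ n ih =>
    rw [revPoch_succ, ih, Nat.choose_succ_succ n 1, Nat.choose_one_right]; ring

lemma revPoch_inv {z : ℂ} (hz : z ≠ 0) (q : ℂ) (n : ℕ) :
    revPoch z⁻¹ q n = z⁻¹ ^ n * qPoch z q n := by
  induction n with
  | zero => simp
  | succ n ih =>
    have : z⁻¹ - q ^ n = z⁻¹ * (1 - z * q ^ n) := by field_simp
    rw [revPoch_succ, ih, qPoch_succ, this]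
    ring

@[simp] lemma qPoch_zero_left (q : ℂ) (n : ℕ) : qPoch 0 q n = 1 := by simp [qPoch]

@[simp] lemma qPochInf_zero_left (q : ℂ) : qPochInf 0 q = 1 := by simp [qPochInf]

/-- Bailey's lemma with `ρ₁ → ∞` and `ρ₂ = z`, where `w = aq/z`. -/
theorem bailey_lemma_limit {a q z w : ℂ} {α β : ℕ → ℂ} (hq : ‖q‖ < 1) (hq0 : q ≠ 0) (hz : z ≠ 0)
    (ha : ∀ k : ℕ, a * q * q ^ k ≠ 1) (hzw : z * w = a * q) (hw : ∀ k : ℕ, w * q ^ k ≠ 1)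
    (hα : Summable fun r => ‖α r‖) (h : IsBaileyPair a q α β) :
    ∑' n, q ^ (n.choose 2) * (-w) ^ n * qPoch z q n * β n =
      qPochInf w q / qPochInf (a * q) q *
      ∑' r, q ^ (r.choose 2) * (-w) ^ r * (qPoch z q r / qPoch w q r) * α r := by
  have hw' : a * q * z⁻¹ = w := by rw [← hzw]; field_simp
  have hwt : ∀ n, baileyWeight a q 0 z⁻¹ n = q ^ (n.choose 2) * (-w) ^ n * qPoch z q n := by
    intro n
    rw [baileyWeight, revPoch_zero_left, revPoch_inv hz, neg_pow w, ← hw', mul_pow _ z⁻¹]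
    ring
  have := bailey_lemma (d := 0) (e := z⁻¹) hq hq0 ha (by simp) (by simp) (by rw [hw']; exact hw)
    hα h
  simp only [hwt, hw', mul_zero, zero_mul, qPochInf_zero_left, qPoch_zero_left, one_mul,
    mul_one] at this
  rw [this]
  congr 1
  exact tsum_congr fun r => by ring

lemma sq_pow_choose_two (q : ℂ) (n : ℕ) : (q ^ 2) ^ (n.choose 2) * q ^ n = q ^ (n ^ 2) := by
  induction n with
  | zero => simp
  | succ n ih =>
    rw [Nat.choose_succ_succ n 1, Nat.choose_one_right, pow_add, ← pow_mul q 2 n,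
      show (n + 1) ^ 2 = n ^ 2 + (2 * n + 1) by ring, pow_add q (n ^ 2), ← ih]
    simp only [Nat.succ_eq_add_one, Nat.reduceAdd]
    ring

lemma sq_pow_choose_two_succ (q : ℂ) (n : ℕ) :
    (q ^ 2) ^ ((n + 2).choose 2) = q ^ ((n + 1) ^ 2 + (n + 1)) := by
  rw [pow_add q, ← sq_pow_choose_two, Nat.choose_succ_succ (n + 1) 1, Nat.choose_one_right]
  simp only [Nat.succ_eq_add_one, Nat.reduceAdd]
  ring

/-! ### The inner theta sums and their Bailey pairs -/

/-- `∑_{|j| ≤ n} (-1)^j q^{-2j²}`. -/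
def thetaS (q : ℂ) (n : ℕ) : ℂ :=
  ∑ j ∈ Finset.Icc (-(n : ℤ)) (n : ℤ), (-1 : ℂ) ^ j * q ^ (-2 * j ^ 2)

/-- `∑_{|j| ≤ n} (-1)^j q^{-2j²-j}`. -/
def thetaT (q : ℂ) (n : ℕ) : ℂ :=
  ∑ j ∈ Finset.Icc (-(n : ℤ)) (n : ℤ), (-1 : ℂ) ^ j * q ^ (-2 * j ^ 2 - j)

/-- `∑_{-n-1 ≤ j ≤ n} (-1)^j q^{-2j²-3j}`. -/
def thetaT' (q : ℂ) (n : ℕ) : ℂ :=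
  ∑ j ∈ Finset.Icc (-(n : ℤ) - 1) (n : ℤ), (-1 : ℂ) ^ j * q ^ (-2 * j ^ 2 - 3 * j)

/-- `∑_{|j| ≤ n} q^{-2j²-j}`. -/
def thetaV (q : ℂ) (n : ℕ) : ℂ :=
  ∑ j ∈ Finset.Icc (-(n : ℤ)) (n : ℤ), q ^ (-2 * j ^ 2 - j)

lemma sum_Icc_add_endpoints (f : ℤ → ℂ) {a b : ℤ} (h : a - 1 ≤ b) :
    ∑ j ∈ Finset.Icc (a - 1) (b + 1), f j = ∑ j ∈ Finset.Icc a b, f j + (f (b + 1) + f (a - 1)) := by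
  have h1 : Finset.Icc (a - 1) (b + 1) = insert (a - 1) (insert (b + 1) (Finset.Icc a b)) := by
    ext j; simp only [Finset.mem_insert, Finset.mem_Icc]; omega
  rw [h1, Finset.sum_insert, Finset.sum_insert]
  · ring
  · simp only [Finset.mem_Icc]; omega
  · simp only [Finset.mem_insert, Finset.mem_Icc]; omega

lemma sum_Icc_neg_succ (f : ℤ → ℂ) (n : ℕ) :
    ∑ j ∈ Finset.Icc (-((n + 1 : ℕ) : ℤ)) ((n + 1 : ℕ) : ℤ), f j =
      ∑ j ∈ Finset.Icc (-(n : ℤ)) (n : ℤ), f j + (f ((n : ℤ) + 1) + f (-(n : ℤ) - 1)) := by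
  rw [← sum_Icc_add_endpoints f (by omega)]
  congr 2
  push_cast; ring

lemma neg_one_zpow_natCast_succ (n : ℕ) : (-1 : ℂ) ^ ((n : ℤ) + 1) = (-1) ^ (n + 1) := by
  rw [← zpow_natCast]; push_cast; rfl

lemma neg_one_zpow_neg (j : ℤ) : (-1 : ℂ) ^ (-j) = (-1) ^ j := by
  rw [zpow_neg, ← inv_zpow]; norm_num

lemma neg_one_zpow_neg_succ (n : ℕ) : (-1 : ℂ) ^ (-(n : ℤ) - 1) = (-1) ^ (n + 1) := by
  rw [show -(n : ℤ) - 1 = -((n : ℤ) + 1) by ring, neg_one_zpow_neg, neg_one_zpow_natCast_succ]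

lemma pow_mul_zpow {q : ℂ} (hq0 : q ≠ 0) {a c : ℕ} {b : ℤ} (h : (a : ℤ) + b = c) :
    q ^ a * q ^ b = q ^ c := by
  rw [← zpow_natCast, ← zpow_natCast, ← zpow_add₀ hq0, h]

section

variable {q : ℂ}

lemma one_sub_pow_ne_zero (hq : ‖q‖ < 1) (k : ℕ) : 1 - q ^ (k + 1) ≠ 0 := by
  rw [pow_succ']; exact sub_ne_zero.2 (mul_pow_ne_one hq hq k).symm

lemma one_add_pow_ne_zero (hq : ‖q‖ < 1) (k : ℕ) : 1 + q ^ (k + 1) ≠ 0 := by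
  have h : ‖q ^ (k + 1)‖ < 1 := by
    rw [norm_pow]; exact pow_lt_one₀ (norm_nonneg q) hq k.succ_ne_zero
  have := one_sub_ne_zero_of_norm_lt (z := -q ^ (k + 1)) (by simpa using h)
  simpa using this

lemma norm_neg_pow_succ_lt_one (hq : ‖q‖ < 1) (k : ℕ) : ‖-q ^ (k + 1)‖ < 1 := by
  rw [norm_neg, norm_pow]; exact pow_lt_one₀ (norm_nonneg q) hq k.succ_ne_zero

lemma norm_pow_succ_lt_one (hq : ‖q‖ < 1) (k : ℕ) : ‖q ^ (k + 1)‖ < 1 := by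
  rw [norm_pow]; exact pow_lt_one₀ (norm_nonneg q) hq k.succ_ne_zero

/-- The pair behind `S₀` and `S₁`: the case `a = q²`, `b = -1`, in base `q²`, of
`isBaileyPair_of_recurrence`. -/
theorem isBaileyPair_thetaS (hq : ‖q‖ < 1) (hq0 : q ≠ 0) :
    IsBaileyPair (q ^ 2) (q ^ 2)
      (fun r => (1 - (q ^ 2) ^ (2 * r + 1)) / (1 - q ^ 2) * (q ^ (3 * r ^ 2 + r) * thetaS q r))
      (fun n => 1 / qPoch (-q ^ 2) (q ^ 2) n) := by
  have hq2 := norm_sq_lt_one hq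
  have hne := one_sub_pow_ne_zero hq
  have h1 : 1 - q ^ 2 ≠ 0 := hne 1
  have key := isBaileyPair_of_recurrence (a := q ^ 2) (b := -1) (q := q ^ 2)
    (p := fun r => (1 - (q ^ 2) ^ (2 * r + 1)) / (1 - q ^ 2) * q ^ (3 * r ^ 2 + r))
    (t := thetaS q) hq2 (mul_pow_ne_one hq2 hq2)
    (mul_pow_ne_one (by rw [neg_one_mul]; exact norm_neg_pow_succ_lt_one hq 1) hq2)
    (by simp [h1]) (by simp [thetaS]) ?_ ?_
  · simpa only [neg_one_mul, mul_assoc] using key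
  · intro r
    have e1 : q ^ (3 * (r + 1) ^ 2 + (r + 1)) = q ^ (3 * r ^ 2 + r) * q ^ (6 * r + 4) := by ring
    rw [e1]
    field_simp
    ring
  · intro r
    have e1 : q ^ (3 * (r + 1) ^ 2 + (r + 1)) * q ^ (-2 * ((r : ℤ) + 1) ^ 2) =
        q ^ ((r + 1) ^ 2 + (r + 1)) := pow_mul_zpow hq0 (by push_cast; ring)
    have e2 : thetaS q (r + 1) - thetaS q r =
        2 * (-1) ^ (r + 1) * q ^ (-2 * ((r : ℤ) + 1) ^ 2) := by
      rw [thetaS, sum_Icc_neg_succ, ← thetaS, neg_one_zpow_natCast_succ, neg_one_zpow_neg_succ,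
        show (-(r : ℤ) - 1) ^ 2 = ((r : ℤ) + 1) ^ 2 by ring]
      ring
    have e3 := sq_pow_choose_two_succ q r
    rw [e2, e3, ← e1, qPoch_succ]
    field_simp
    ring

/-- The pair behind `T₁`: the case `a = q²`, `b = -q`, in base `q²`, of
`isBaileyPair_of_recurrence`. -/
theorem isBaileyPair_thetaT (hq : ‖q‖ < 1) (hq0 : q ≠ 0) :
    IsBaileyPair (q ^ 2) (q ^ 2)
      (fun r => (1 - q ^ (2 * r + 1)) / (1 - q) * (q ^ (3 * r ^ 2 + 2 * r) * thetaT q r))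
      (fun n => 1 / qPoch (-q ^ 3) (q ^ 2) n) := by
  have hq2 := norm_sq_lt_one hq
  have h1 : 1 - q ≠ 0 := one_sub_ne_zero_of_norm_lt hq
  have key := isBaileyPair_of_recurrence (a := q ^ 2) (b := -q) (q := q ^ 2)
    (p := fun r => (1 - q ^ (2 * r + 1)) / (1 - q) * q ^ (3 * r ^ 2 + 2 * r))
    (t := thetaT q) hq2 (mul_pow_ne_one hq2 hq2)
    (mul_pow_ne_one (by
      rw [show -q * q ^ 2 = -q ^ 3 by ring]; exact norm_neg_pow_succ_lt_one hq 2) hq2)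
    (by simp [h1]) (by simp [thetaT]) ?_ ?_
  · simpa only [show -q * q ^ 2 = -q ^ 3 by ring, mul_assoc] using key
  · intro r
    have e1 : q ^ (3 * (r + 1) ^ 2 + 2 * (r + 1)) = q ^ (3 * r ^ 2 + 2 * r) * q ^ (6 * r + 5) := by
      ring
    rw [e1]
    field_simp
    ring
  · intro r
    have e1 : q ^ (3 * (r + 1) ^ 2 + 2 * (r + 1)) * q ^ (-2 * ((r : ℤ) + 1) ^ 2 - ((r : ℤ) + 1)) =
        q ^ ((r + 1) ^ 2 + (r + 1)) := pow_mul_zpow hq0 (by push_cast; ring)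
    have e2 : thetaT q (r + 1) - thetaT q r =
        (-1) ^ (r + 1) * (1 + q ^ (2 * (r + 1))) *
          q ^ (-2 * ((r : ℤ) + 1) ^ 2 - ((r : ℤ) + 1)) := by
      have : q ^ (-2 * (-(r : ℤ) - 1) ^ 2 - (-(r : ℤ) - 1)) =
          q ^ (2 * (r + 1)) * q ^ (-2 * ((r : ℤ) + 1) ^ 2 - ((r : ℤ) + 1)) := by
        rw [← zpow_natCast q (2 * (r + 1)), ← zpow_add₀ hq0]
        congr 1; push_cast; ring
      rw [thetaT, sum_Icc_neg_succ, ← thetaT, neg_one_zpow_natCast_succ, neg_one_zpow_neg_succ, this]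
      ring
    have e3 := sq_pow_choose_two_succ q r
    rw [e2, e3, ← e1, qPoch_succ]
    field_simp
    ring

/-- The pair behind `T₀`: the case `a = q⁴`, `b = -q`, in base `q²`, of
`isBaileyPair_of_recurrence`. -/
theorem isBaileyPair_thetaT' (hq : ‖q‖ < 1) (hq0 : q ≠ 0) :
    IsBaileyPair (q ^ 4) (q ^ 2)
      (fun r => (1 - q ^ (4 * r + 4)) / ((1 - q ^ 4) * (1 - q)) *
        (q ^ (3 * r ^ 2 + 4 * r) * thetaT' q r))
      (fun n => 1 / qPoch (-q ^ 3) (q ^ 2) n) := by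
  have hq2 := norm_sq_lt_one hq
  have hq4 := norm_pow_succ_lt_one hq 3
  have h1 : 1 - q ≠ 0 := one_sub_ne_zero_of_norm_lt hq
  have h2 : 1 - q ^ 2 ≠ 0 := one_sub_ne_zero_of_norm_lt hq2
  have h4 : 1 - q ^ 4 ≠ 0 := one_sub_ne_zero_of_norm_lt hq4
  have key := isBaileyPair_of_recurrence (a := q ^ 4) (b := -q) (q := q ^ 2)
    (p := fun r => (1 - q ^ (4 * r + 4)) / (1 - q ^ 4) * q ^ (3 * r ^ 2 + 4 * r))
    (t := fun r => thetaT' q r / (1 - q)) hq2 (mul_pow_ne_one hq4 hq2)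
    (mul_pow_ne_one (by
      rw [show -q * q ^ 2 = -q ^ 3 by ring]; exact norm_neg_pow_succ_lt_one hq 2) hq2)
    (by simp [h4]) ?_ ?_ ?_
  · convert key using 2
    · rename_i r
      field_simp
    · rw [show -q * q ^ 2 = -q ^ 3 by ring]
  · have : Finset.Icc (-((0 : ℕ) : ℤ) - 1) ((0 : ℕ) : ℤ) = {-1, 0} := by decide
    rw [thetaT', this, Finset.sum_pair (by norm_num), div_eq_one_iff_eq h1]
    norm_num
    ring
  · intro r
    have e1 : q ^ (3 * (r + 1) ^ 2 + 4 * (r + 1)) = q ^ (3 * r ^ 2 + 4 * r) * q ^ (6 * r + 7) := by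
      ring
    rw [e1]
    field_simp
    ring
  · intro r
    have e1 : q ^ (3 * (r + 1) ^ 2 + 4 * (r + 1)) *
        q ^ (-2 * ((r : ℤ) + 1) ^ 2 - 3 * ((r : ℤ) + 1)) =
        q ^ ((r + 1) ^ 2 + (r + 1)) := pow_mul_zpow hq0 (by push_cast; ring)
    have e2 : thetaT' q (r + 1) - thetaT' q r =
        (-1) ^ (r + 1) * (1 - q ^ (2 * r + 3)) *
          q ^ (-2 * ((r : ℤ) + 1) ^ 2 - 3 * ((r : ℤ) + 1)) := by
      have e : q ^ (-2 * (-(r : ℤ) - 1 - 1) ^ 2 - 3 * (-(r : ℤ) - 1 - 1)) =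
          q ^ (2 * r + 3) * q ^ (-2 * ((r : ℤ) + 1) ^ 2 - 3 * ((r : ℤ) + 1)) := by
        rw [← zpow_natCast q (2 * r + 3), ← zpow_add₀ hq0]
        congr 1; push_cast; ring
      have hs : (-1 : ℂ) ^ (-(r : ℤ) - 1 - 1) = -(-1) ^ (r + 1) := by
        rw [zpow_sub_one₀ (by norm_num), neg_one_zpow_neg_succ]; norm_num
      rw [thetaT', show -((r + 1 : ℕ) : ℤ) - 1 = -(r : ℤ) - 1 - 1 by push_cast; ring,
        show ((r + 1 : ℕ) : ℤ) = (r : ℤ) + 1 by push_cast; ring,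
        sum_Icc_add_endpoints _ (by omega), ← thetaT', neg_one_zpow_natCast_succ, hs, e]
      ring
    have e3 := sq_pow_choose_two_succ q r
    have e4 : qPoch (q ^ 4) (q ^ 2) r =
        qPoch (q ^ 2) (q ^ 2) r * (1 - q ^ 2 * (q ^ 2) ^ r) / (1 - q ^ 2) := by
      rw [eq_div_iff h2, ← qPoch_mul_self_left, show q ^ 2 * q ^ 2 = q ^ 4 by ring]
      ring
    rw [← sub_div, e2, e3, ← e1, qPoch_succ, e4]
    field_simp
    ring

/-- The pair behind `V₀` and `V₁`, obtained from `isBaileyPair_thetaT` by `q ↦ -q`. -/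
theorem isBaileyPair_thetaV (hq : ‖q‖ < 1) (hq0 : q ≠ 0) :
    IsBaileyPair (q ^ 2) (q ^ 2)
      (fun r => (1 + q ^ (2 * r + 1)) / (1 + q) *
        ((-1) ^ r * q ^ (3 * r ^ 2 + 2 * r) * thetaV q r))
      (fun n => 1 / qPoch (q ^ 3) (q ^ 2) n) := by
  have key := isBaileyPair_thetaT (q := -q) (by simpa using hq) (by simpa using hq0)
  have hth : ∀ r, thetaT (-q) r = thetaV q r := by
    intro r
    rw [thetaT, thetaV]
    refine Finset.sum_congr rfl fun j _ => ?_
    rw [neg_eq_neg_one_mul q, mul_zpow, ← mul_assoc, ← zpow_add₀ (by norm_num)]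
    have : Even (j + (-2 * j ^ 2 - j)) := ⟨-j ^ 2, by ring⟩
    rw [this.neg_one_zpow, one_mul]
  have hpow : ∀ r : ℕ, (-q) ^ (3 * r ^ 2 + 2 * r) = (-1) ^ r * q ^ (3 * r ^ 2 + 2 * r) := by
    intro r
    rw [neg_pow]
    congr 1
    have : Even (3 * r ^ 2 + 2 * r + r) := by
      have := Nat.even_mul_succ_self r
      rw [show 3 * r ^ 2 + 2 * r + r = 3 * (r * (r + 1)) by ring]
      exact this.mul_left 3
    have h2 : (-1 : ℂ) ^ (3 * r ^ 2 + 2 * r) * (-1) ^ r = 1 := by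
      rw [← pow_add, this.neg_one_pow]
    have h3 : (-1 : ℂ) ^ r * (-1) ^ r = 1 := by rw [← mul_pow]; norm_num
    calc (-1 : ℂ) ^ (3 * r ^ 2 + 2 * r)
        = (-1) ^ (3 * r ^ 2 + 2 * r) * ((-1) ^ r * (-1) ^ r) := by rw [h3, mul_one]
      _ = (-1) ^ r := by rw [← mul_assoc, h2, one_mul]
  have hodd : ∀ r : ℕ, (-q) ^ (2 * r + 1) = -q ^ (2 * r + 1) := fun r => Odd.neg_pow ⟨r, rfl⟩ q
  have h3 : (-q) ^ 3 = -q ^ 3 := by ring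
  simpa only [neg_sq, hth, hpow, hodd, h3, sub_neg_eq_add, neg_neg] using key

end

/-! ### Summability of theta sums weighted by powers of `q` -/

section

variable {q : ℂ}

lemma tendsto_pow_of_le (hq : ‖q‖ < 1) {N : ℕ → ℕ} (hN : ∀ n, n ≤ N n) :
    Tendsto (fun n => q ^ N n) atTop (𝓝 0) :=
  (summable_norm_pow hq hN).of_norm.tendsto_atTop_zero

lemma summable_norm_neg_one_pow_mul {f : ℕ → ℂ} (hf : Summable fun n => ‖f n‖) :
    Summable fun n => ‖(-1) ^ n * f n‖ := by
  simpa [norm_mul] using hf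

lemma norm_neg_one_zpow (j : ℤ) : ‖(-1 : ℂ) ^ j‖ ≤ 1 := by simp [norm_zpow]

lemma summable_norm_thetaS (hq : ‖q‖ < 1) (hq0 : q ≠ 0) {g : ℕ → ℂ} {l : ℂ} {N : ℕ → ℕ}
    (hg : Tendsto g atTop (𝓝 l)) (hN : ∀ n, 2 * n ^ 2 + n ≤ N n) :
    Summable fun n => ‖g n * (q ^ N n * thetaS q n)‖ := by
  refine summable_norm_hecke hq hq0 (S := fun n => Finset.Icc (-(n : ℤ)) n)
    (c := fun j => (-1) ^ j) (e := fun j => -2 * j ^ 2) hg norm_neg_one_zpow ?_ ?_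
  · intro n; rw [Int.card_Icc]; omega
  · intro n j hj
    rw [Finset.mem_Icc] at hj
    have h1 : (2 * (n : ℤ) ^ 2 + n) ≤ N n := by exact_mod_cast hN n
    nlinarith [mul_nonneg (sub_nonneg.2 hj.2) (sub_nonneg.2 hj.1)]

lemma summable_norm_thetaT (hq : ‖q‖ < 1) (hq0 : q ≠ 0) {g : ℕ → ℂ} {l : ℂ} {N : ℕ → ℕ}
    (hg : Tendsto g atTop (𝓝 l)) (hN : ∀ n, 2 * n ^ 2 + 2 * n ≤ N n) :
    Summable fun n => ‖g n * (q ^ N n * thetaT q n)‖ := by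
  refine summable_norm_hecke hq hq0 (S := fun n => Finset.Icc (-(n : ℤ)) n)
    (c := fun j => (-1) ^ j) (e := fun j => -2 * j ^ 2 - j) hg norm_neg_one_zpow ?_ ?_
  · intro n; rw [Int.card_Icc]; omega
  · intro n j hj
    rw [Finset.mem_Icc] at hj
    have h1 : (2 * (n : ℤ) ^ 2 + 2 * n) ≤ N n := by exact_mod_cast hN n
    nlinarith [mul_nonneg (sub_nonneg.2 hj.2) (sub_nonneg.2 hj.1)]

lemma summable_norm_thetaT' (hq : ‖q‖ < 1) (hq0 : q ≠ 0) {g : ℕ → ℂ} {l : ℂ} {N : ℕ → ℕ}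
    (hg : Tendsto g atTop (𝓝 l)) (hN : ∀ n, 2 * n ^ 2 + 4 * n ≤ N n) :
    Summable fun n => ‖g n * (q ^ N n * thetaT' q n)‖ := by
  refine summable_norm_hecke hq hq0 (S := fun n => Finset.Icc (-(n : ℤ) - 1) n)
    (c := fun j => (-1) ^ j) (e := fun j => -2 * j ^ 2 - 3 * j) hg norm_neg_one_zpow ?_ ?_
  · intro n; rw [Int.card_Icc]; omega
  · intro n j hj
    rw [Finset.mem_Icc] at hj
    have h1 : (2 * (n : ℤ) ^ 2 + 4 * n) ≤ N n := by exact_mod_cast hN n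
    have h2 : 0 ≤ 2 * ((n : ℤ) + j) + 3 := by omega
    nlinarith [mul_nonneg (sub_nonneg.2 hj.2) h2]

lemma summable_norm_thetaV (hq : ‖q‖ < 1) (hq0 : q ≠ 0) {g : ℕ → ℂ} {l : ℂ} {N : ℕ → ℕ}
    (hg : Tendsto g atTop (𝓝 l)) (hN : ∀ n, 2 * n ^ 2 + 2 * n ≤ N n) :
    Summable fun n => ‖g n * (q ^ N n * thetaV q n)‖ := by
  have := summable_norm_hecke hq hq0 (S := fun n => Finset.Icc (-(n : ℤ)) n) (N := N)
    (c := fun _ => 1) (e := fun j => -2 * j ^ 2 - j) hg (by simp) ?_ ?_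
  · simpa only [one_mul, thetaV] using this
  · intro n; rw [Int.card_Icc]; omega
  · intro n j hj
    rw [Finset.mem_Icc] at hj
    have h1 : (2 * (n : ℤ) ^ 2 + 2 * n) ≤ N n := by exact_mod_cast hN n
    nlinarith [mul_nonneg (sub_nonneg.2 hj.2) (sub_nonneg.2 hj.1)]

/-- The sum over the triangular numbers `j(j+1)/2`, `0 ≤ j ≤ 2n`, in the series for `V₀` is
`thetaV`: even `j = 2i` correspond to the index `i`, and odd `j = 2i - 1` to the index `-i`. -/
lemma sum_range_eq_thetaV (q : ℂ) (n : ℕ) :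
    ∑ j ∈ Finset.range (2 * n + 1), q ^ (-((j + 1).choose 2 : ℤ)) = thetaV q n := by
  induction n with
  | zero => simp [thetaV]
  | succ n ih =>
    have h1 : (2 * n + 1 + 1).choose 2 = (n + 1) * (2 * n + 1) := by
      rw [Nat.choose_two_right, show (2 * n + 1 + 1) * (2 * n + 1 + 1 - 1) =
        (n + 1) * (2 * n + 1) * 2 by rw [Nat.add_sub_cancel]; ring, Nat.mul_div_cancel _ two_pos]
    have h2 : (2 * n + 1 + 1 + 1).choose 2 = (2 * n + 3) * (n + 1) := by
      rw [Nat.choose_two_right, show (2 * n + 1 + 1 + 1) * (2 * n + 1 + 1 + 1 - 1) =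
        (2 * n + 3) * (n + 1) * 2 by rw [Nat.add_sub_cancel]; ring, Nat.mul_div_cancel _ two_pos]
    rw [thetaV, sum_Icc_neg_succ, ← thetaV, ← ih, show 2 * (n + 1) + 1 = 2 * n + 1 + 1 + 1 by ring,
      Finset.sum_range_succ, Finset.sum_range_succ, h1, h2, add_assoc, add_comm (q ^ _) (q ^ _)]
    congr 3
    · push_cast; ring
    · push_cast; ring

/-! ### Convergence of the series of the theorem -/

lemma norm_neg_lt_one (hq : ‖q‖ < 1) : ‖-q‖ < 1 := by simpa using hq

lemma summable_S0Term (hq : ‖q‖ < 1) : Summable (S0Term q) :=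
  summable_eulerian hq (norm_sq_lt_one hq)
    (mul_pow_ne_one (norm_neg_pow_succ_lt_one hq 1) (norm_sq_lt_one hq)) (N := fun n => n ^ 2)
    (m := id) fun n => by nlinarith

lemma summable_S1Term (hq : ‖q‖ < 1) : Summable (S1Term q) :=
  summable_eulerian hq (norm_sq_lt_one hq)
    (mul_pow_ne_one (norm_neg_pow_succ_lt_one hq 1) (norm_sq_lt_one hq))
    (N := fun n => n * (n + 2)) (m := id) fun n => by nlinarith

lemma summable_T0Term (hq : ‖q‖ < 1) : Summable (T0Term q) :=
  summable_eulerian hq (norm_sq_lt_one hq)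
    (mul_pow_ne_one (norm_neg_lt_one hq) (norm_sq_lt_one hq))
    (N := fun n => (n + 1) * (n + 2)) (m := fun n => n + 1) fun n => by nlinarith

lemma summable_T1Term (hq : ‖q‖ < 1) : Summable (T1Term q) :=
  summable_eulerian hq (norm_sq_lt_one hq)
    (mul_pow_ne_one (norm_neg_lt_one hq) (norm_sq_lt_one hq))
    (N := fun n => n * (n + 1)) (m := fun n => n + 1) fun n => by nlinarith

lemma summable_V0Term (hq : ‖q‖ < 1) : Summable (V0Term q) :=
  summable_eulerian hq (norm_sq_lt_one hq) (mul_pow_ne_one hq (norm_sq_lt_one hq))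
    (N := fun n => n ^ 2) (m := id) fun n => by nlinarith

lemma summable_V1Term (hq : ‖q‖ < 1) : Summable (V1Term q) :=
  summable_eulerian hq (norm_sq_lt_one hq) (mul_pow_ne_one hq (norm_sq_lt_one hq))
    (N := fun n => (n + 1) ^ 2) (m := fun n => n + 1) fun n => by nlinarith

lemma S0Hecke_eq (q : ℂ) (n : ℕ) :
    S0Hecke q n = (1 - q ^ (6 * n + 3)) * (q ^ (4 * n ^ 2 + n) * thetaS q n) := by
  rw [S0Hecke, thetaS]; ring

lemma S1Hecke_eq (q : ℂ) (n : ℕ) :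
    S1Hecke q n = (1 - q ^ (2 * n + 1)) * (q ^ (4 * n ^ 2 + 3 * n) * thetaS q n) := by
  rw [S1Hecke, thetaS]; ring

lemma T0Hecke_eq (q : ℂ) (n : ℕ) :
    T0Hecke q n = (1 - q ^ (2 * n + 2)) * (q ^ (4 * n ^ 2 + 7 * n) * thetaT' q n) := by
  rw [T0Hecke, thetaT']; ring

lemma T1Hecke_eq (q : ℂ) (n : ℕ) :
    T1Hecke q n = (1 - q ^ (2 * n + 1)) * (q ^ (4 * n ^ 2 + 3 * n) * thetaT q n) := by
  rw [T1Hecke, thetaT]; ring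

lemma V0Hecke_eq (q : ℂ) (n : ℕ) :
    V0Hecke q n = (-1) ^ n * ((1 + q ^ (4 * n + 2)) * (q ^ (4 * n ^ 2 + 2 * n) * thetaV q n)) := by
  rw [V0Hecke, ← Finset.sum_mul, sum_range_eq_thetaV]; ring

lemma V1Hecke_eq (q : ℂ) (n : ℕ) :
    V1Hecke q n = (-1) ^ n * (1 * (q ^ (4 * n ^ 2 + 4 * n) * thetaV q n)) := by
  rw [V1Hecke, thetaV]; ring

lemma summable_S0Hecke (hq : ‖q‖ < 1) (hq0 : q ≠ 0) : Summable (S0Hecke q) := by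
  simp only [funext (S0Hecke_eq q)]
  exact (summable_norm_thetaS hq hq0 ((tendsto_pow_of_le hq fun n => by omega).const_sub 1)
    fun n => by nlinarith).of_norm

lemma summable_S1Hecke (hq : ‖q‖ < 1) (hq0 : q ≠ 0) : Summable (S1Hecke q) := by
  simp only [funext (S1Hecke_eq q)]
  exact (summable_norm_thetaS hq hq0 ((tendsto_pow_of_le hq fun n => by omega).const_sub 1)
    fun n => by nlinarith).of_norm

lemma summable_T0Hecke (hq : ‖q‖ < 1) (hq0 : q ≠ 0) : Summable (T0Hecke q) := by
  simp only [funext (T0Hecke_eq q)]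
  exact (summable_norm_thetaT' hq hq0 ((tendsto_pow_of_le hq fun n => by omega).const_sub 1)
    fun n => by nlinarith).of_norm

lemma summable_T1Hecke (hq : ‖q‖ < 1) (hq0 : q ≠ 0) : Summable (T1Hecke q) := by
  simp only [funext (T1Hecke_eq q)]
  exact (summable_norm_thetaT hq hq0 ((tendsto_pow_of_le hq fun n => by omega).const_sub 1)
    fun n => by nlinarith).of_norm

lemma summable_V0Hecke (hq : ‖q‖ < 1) (hq0 : q ≠ 0) : Summable (V0Hecke q) := by
  simp only [funext (V0Hecke_eq q)]
  exact (summable_norm_neg_one_pow_mul (summable_norm_thetaV hq hq0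
    ((tendsto_pow_of_le hq fun n => by omega).const_add 1) fun n => by nlinarith)).of_norm

lemma summable_V1Hecke (hq : ‖q‖ < 1) (hq0 : q ≠ 0) : Summable (V1Hecke q) := by
  simp only [funext (V1Hecke_eq q)]
  exact (summable_norm_neg_one_pow_mul (summable_norm_thetaV hq hq0
    tendsto_const_nhds fun n => by nlinarith)).of_norm

/-! ### Hecke-type representations -/

lemma sq_pow_choose_two_mul (q : ℂ) (k n : ℕ) :
    (q ^ 2) ^ (n.choose 2) * (q ^ (k + 1)) ^ n = q ^ (n ^ 2 + k * n) := by
  rw [pow_add q (n ^ 2), ← sq_pow_choose_two]; ring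

/-- Bailey's lemma in base `q²` in the shape used for all six functions. -/
lemma bailey_lemma_sq {a z : ℂ} {α β : ℕ → ℂ} (k : ℕ) (hq : ‖q‖ < 1) (hq0 : q ≠ 0) (hz : z ≠ 0)
    (ha : ‖a * q ^ 2‖ < 1) (hzw : -z * q ^ (k + 1) = a * q ^ 2)
    (hα : Summable fun r => ‖α r‖) (h : IsBaileyPair a (q ^ 2) α β) :
    ∑' n, q ^ (n ^ 2 + k * n) * qPoch z (q ^ 2) n * β n =
      qPochInf (-q ^ (k + 1)) (q ^ 2) / qPochInf (a * q ^ 2) (q ^ 2) *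
      ∑' r, q ^ (r ^ 2 + k * r) * (qPoch z (q ^ 2) r / qPoch (-q ^ (k + 1)) (q ^ 2) r) * α r := by
  have hq2 := norm_sq_lt_one hq
  have := bailey_lemma_limit (w := -q ^ (k + 1)) hq2 (pow_ne_zero 2 hq0) hz (mul_pow_ne_one ha hq2)
    (by rw [← hzw]; ring) (mul_pow_ne_one (norm_neg_pow_succ_lt_one hq k) hq2) hα h
  simpa only [neg_neg, sq_pow_choose_two_mul] using this

lemma qPochInf_neg_cube (hq : ‖q‖ < 1) :
    qPochInf (-q) (q ^ 2) = (1 + q) * qPochInf (-q ^ 3) (q ^ 2) := by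
  rw [qPochInf_eq_one_sub_mul _ (norm_sq_lt_one hq), sub_neg_eq_add]
  congr 2; ring

lemma qPochInf_sq (hq : ‖q‖ < 1) :
    qPochInf (q ^ 2) (q ^ 2) = (1 - q ^ 2) * qPochInf (q ^ 2 * q ^ 2) (q ^ 2) :=
  qPochInf_eq_one_sub_mul _ (norm_sq_lt_one hq)

lemma qPoch_div_cube (hq : ‖q‖ < 1) (r : ℕ) :
    qPoch (-q) (q ^ 2) r / qPoch (-q ^ 3) (q ^ 2) r = (1 + q) / (1 + q ^ (2 * r + 1)) := by
  have h1 : 1 + q ≠ 0 := by simpa using one_add_pow_ne_zero hq 0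
  have h2 := one_add_pow_ne_zero hq (2 * r)
  have h3 := qPoch_ne_zero (mul_pow_ne_one (norm_neg_lt_one hq) (norm_sq_lt_one hq)) r
  have := qPoch_neg_mul_self_left (q ^ 2) r h1
  rw [show q * q ^ 2 = q ^ 3 by ring, show q * (q ^ 2) ^ r = q ^ (2 * r + 1) by ring] at this
  rw [this]
  field_simp

theorem S1_eq_hecke (hq : ‖q‖ < 1) (hq0 : q ≠ 0) :
    S1 q = qPochInf (-q) (q ^ 2) / qPochInf (q ^ 2) (q ^ 2) * ∑' n, S1Hecke q n := by
  have hq2 := norm_sq_lt_one hq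
  have h1 : 1 + q ≠ 0 := by simpa using one_add_pow_ne_zero hq 0
  have h2 : 1 - q ^ 2 ≠ 0 := one_sub_ne_zero_of_norm_lt hq2
  have hα := summable_norm_thetaS hq hq0 (N := fun r => 3 * r ^ 2 + r)
    (((tendsto_pow_of_le hq2 (N := fun r => 2 * r + 1) fun n => by omega).const_sub 1).div_const
      (1 - q ^ 2)) fun n => by nlinarith
  have key := bailey_lemma_sq (z := -q) 2 hq hq0 (neg_ne_zero.2 hq0)
    (by rw [← pow_add]; exact norm_pow_succ_lt_one hq 3) (by ring) hα (isBaileyPair_thetaS hq hq0)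
  rw [S1, qPochInf_neg_cube hq, qPochInf_sq hq]
  have hR : ∀ r, q ^ (r ^ 2 + 2 * r) * (qPoch (-q) (q ^ 2) r / qPoch (-q ^ (2 + 1)) (q ^ 2) r) *
      ((1 - (q ^ 2) ^ (2 * r + 1)) / (1 - q ^ 2) * (q ^ (3 * r ^ 2 + r) * thetaS q r)) =
      (1 + q) / (1 - q ^ 2) * S1Hecke q r := by
    intro r
    have h3 := one_add_pow_ne_zero hq (2 * r)
    rw [qPoch_div_cube hq, S1Hecke_eq,
      show q ^ (4 * r ^ 2 + 3 * r) = q ^ (r ^ 2 + 2 * r) * q ^ (3 * r ^ 2 + r) by ring,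
      show (q ^ 2) ^ (2 * r + 1) = q ^ (2 * r + 1) * q ^ (2 * r + 1) by ring]
    field_simp
    ring
  simp only [hR, tsum_mul_left] at key
  calc ∑' n, S1Term q n = _ := tsum_congr fun n => ?_
    _ = _ := key
    _ = _ := ?_
  · rw [S1Term]; ring
  · field_simp

/-- Index shift merging the two parts of the `α` of `IsBaileyPair.lower`. -/
lemma tsum_telescoped (f g : ℕ → ℂ) (hf : Summable f) (hg : Summable g) :
    ∑' r, (f r - if r = 0 then 0 else g (r - 1)) = ∑' r, (f r - g r) := by
  have hg' : Summable fun r => if r = 0 then 0 else g (r - 1) := by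
    rw [← summable_nat_add_iff 1]
    simpa using hg
  rw [hf.tsum_sub hg', hf.tsum_sub hg, hg'.tsum_eq_zero_add]
  simp

theorem S0_eq_hecke (hq : ‖q‖ < 1) (hq0 : q ≠ 0) :
    S0 q = qPochInf (-q) (q ^ 2) / qPochInf (q ^ 2) (q ^ 2) * ∑' n, S0Hecke q n := by
  have hq2 := norm_sq_lt_one hq
  have hpair := (isBaileyPair_thetaS hq hq0).lower 0 hq2
  simp only [zero_mul, sub_zero, mul_one, one_mul] at hpair
  have hA : Summable fun r => ‖q ^ (3 * r ^ 2 + r) * thetaS q r‖ := by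
    simpa using summable_norm_thetaS hq hq0 (N := fun r => 3 * r ^ 2 + r) (g := fun _ => 1)
      tendsto_const_nhds fun n => by nlinarith
  have hB : Summable fun r => ‖q ^ (3 * r ^ 2 + r) * thetaS q r * (q ^ 2) ^ (2 * r + 1)‖ := by
    simpa [mul_comm] using summable_norm_mul_of_tendsto
      (tendsto_pow_of_le hq2 (N := fun r => 2 * r + 1) fun n => by omega) hA
  have hB' : Summable fun r => if r = 0 then (0 : ℂ) else
      q ^ (3 * (r - 1) ^ 2 + (r - 1)) * thetaS q (r - 1) * (q ^ 2) ^ (2 * r - 1) := by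
    rw [← summable_nat_add_iff 1]
    refine hB.of_norm.congr fun r => ?_
    rw [if_neg r.succ_ne_zero, Nat.add_sub_cancel, show 2 * (r + 1) - 1 = 2 * r + 1 by omega]
  have key := bailey_lemma_sq (z := -q) 0 hq hq0 (neg_ne_zero.2 hq0)
    (by rw [one_mul]; exact hq2) (by ring) (hA.of_norm.sub hB').norm hpair
  have hw := mul_pow_ne_one (norm_neg_lt_one hq) hq2
  have hR : ∀ r, q ^ (r ^ 2 + 0 * r) *
      (qPoch (-q) (q ^ 2) r / qPoch (-q ^ (0 + 1)) (q ^ 2) r) *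
      (q ^ (3 * r ^ 2 + r) * thetaS q r - if r = 0 then (0 : ℂ) else
        q ^ (3 * (r - 1) ^ 2 + (r - 1)) * thetaS q (r - 1) * (q ^ 2) ^ (2 * r - 1)) =
      q ^ (4 * r ^ 2 + r) * thetaS q r - if r = 0 then (0 : ℂ) else
        (fun r => q ^ (4 * r ^ 2 + 7 * r + 3) * thetaS q r) (r - 1) := by
    intro r
    rw [zero_add, pow_one, div_self (qPoch_ne_zero hw r)]
    rcases r with _ | r
    · simp
    · rw [if_neg r.succ_ne_zero, if_neg r.succ_ne_zero, Nat.add_sub_cancel,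
        show 2 * (r + 1) - 1 = 2 * r + 1 by omega]
      ring
  simp only [hR] at key
  have htel := tsum_telescoped (fun r => q ^ (4 * r ^ 2 + r) * thetaS q r)
    (fun r => q ^ (4 * r ^ 2 + 7 * r + 3) * thetaS q r) ?_ ?_
  · rw [htel] at key
    rw [S0]
    calc ∑' n, S0Term q n = _ := tsum_congr fun n => ?_
      _ = _ := key
      _ = _ := ?_
    · rw [S0Term, zero_mul, add_zero]; ring
    · rw [one_mul, zero_add, pow_one]
      congr 1
      refine tsum_congr fun r => ?_
      rw [S0Hecke_eq]
      ring
  · simpa using (summable_norm_thetaS hq hq0 (N := fun r => 4 * r ^ 2 + r) (g := fun _ => 1)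
      tendsto_const_nhds fun n => by nlinarith).of_norm
  · simpa using (summable_norm_thetaS hq hq0 (N := fun r => 4 * r ^ 2 + 7 * r + 3)
      (g := fun _ => 1) tendsto_const_nhds fun n => by nlinarith).of_norm

lemma qPoch_odd_succ (hq : ‖q‖ < 1) (n : ℕ) :
    1 / qPoch (-q ^ 3) (q ^ 2) n = (1 + q) / qPoch (-q) (q ^ 2) (n + 1) := by
  have h1 : 1 + q ≠ 0 := by simpa using one_add_pow_ne_zero hq 0
  rw [qPoch_succ', sub_neg_eq_add, show -q * q ^ 2 = -q ^ 3 by ring]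
  field_simp

theorem T1_eq_hecke (hq : ‖q‖ < 1) (hq0 : q ≠ 0) :
    T1 q = qPochInf (-q ^ 2) (q ^ 2) / qPochInf (q ^ 2) (q ^ 2) * ∑' n, T1Hecke q n := by
  have hq2 := norm_sq_lt_one hq
  have h1 : 1 + q ≠ 0 := by simpa using one_add_pow_ne_zero hq 0
  have h0 : 1 - q ≠ 0 := one_sub_ne_zero_of_norm_lt hq
  have h2 : 1 - q ^ 2 ≠ 0 := one_sub_ne_zero_of_norm_lt hq2
  have hα := summable_norm_thetaT hq hq0 (N := fun r => 3 * r ^ 2 + 2 * r)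
    (((tendsto_pow_of_le hq (N := fun r => 2 * r + 1) fun n => by omega).const_sub 1).div_const
      (1 - q)) fun n => by nlinarith
  have key := bailey_lemma_sq (z := -q ^ 2) 1 hq hq0 (neg_ne_zero.2 (pow_ne_zero 2 hq0))
    (by rw [← pow_add]; exact norm_pow_succ_lt_one hq 3) (by ring) hα (isBaileyPair_thetaT hq hq0)
  have hw := mul_pow_ne_one (norm_neg_pow_succ_lt_one hq 1) hq2
  have hR : ∀ r, q ^ (r ^ 2 + 1 * r) * (qPoch (-q ^ 2) (q ^ 2) r / qPoch (-q ^ (1 + 1)) (q ^ 2) r) *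
      ((1 - q ^ (2 * r + 1)) / (1 - q) * (q ^ (3 * r ^ 2 + 2 * r) * thetaT q r)) =
      1 / (1 - q) * T1Hecke q r := by
    intro r
    rw [div_self (qPoch_ne_zero hw r), T1Hecke_eq]
    field_simp
    ring
  have hL : ∀ n, q ^ (n ^ 2 + 1 * n) * qPoch (-q ^ 2) (q ^ 2) n * (1 / qPoch (-q ^ 3) (q ^ 2) n) =
      (1 + q) * T1Term q n := by
    intro n
    rw [qPoch_odd_succ hq, T1Term]
    ring
  simp only [hR, hL, tsum_mul_left] at key
  rw [T1, qPochInf_sq hq]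
  refine mul_left_cancel₀ h1 (key.trans ?_)
  have e : 1 - q ^ 2 = (1 - q) * (1 + q) := by ring
  rw [e]
  field_simp

theorem T0_eq_hecke (hq : ‖q‖ < 1) (hq0 : q ≠ 0) :
    T0 q = q ^ 2 * (qPochInf (-q ^ 2) (q ^ 2) / qPochInf (q ^ 2) (q ^ 2)) *
      ∑' n, T0Hecke q n := by
  have hq2 := norm_sq_lt_one hq
  have h1 : 1 + q ≠ 0 := by simpa using one_add_pow_ne_zero hq 0
  have h0 : 1 - q ≠ 0 := one_sub_ne_zero_of_norm_lt hq
  have h2 : 1 + q ^ 2 ≠ 0 := one_add_pow_ne_zero hq 1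
  have hα := summable_norm_thetaT' hq hq0 (N := fun r => 3 * r ^ 2 + 4 * r)
    (((tendsto_pow_of_le hq (N := fun r => 4 * r + 4) fun n => by omega).const_sub 1).div_const
      ((1 - q ^ 4) * (1 - q))) fun n => by nlinarith
  have key := bailey_lemma_sq (z := -q ^ 2) 3 hq hq0 (neg_ne_zero.2 (pow_ne_zero 2 hq0))
    (by rw [← pow_add]; exact norm_pow_succ_lt_one hq 5) (by ring) hα
    (isBaileyPair_thetaT' hq hq0)
  have hdiv : ∀ r, qPoch (-q ^ 2) (q ^ 2) r / qPoch (-q ^ 4) (q ^ 2) r =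
      (1 + q ^ 2) / (1 + q ^ (2 * r + 2)) := by
    intro r
    have h3 := qPoch_ne_zero (mul_pow_ne_one (norm_neg_pow_succ_lt_one hq 1) hq2) r
    have h4 := one_add_pow_ne_zero hq (2 * r + 1)
    have := qPoch_neg_mul_self_left (q ^ 2) r h2
    rw [show q ^ 2 * q ^ 2 = q ^ 4 by ring,
      show q ^ 2 * (q ^ 2) ^ r = q ^ (2 * r + 1 + 1) by ring] at this
    rw [this]
    field_simp
  have hR : ∀ r, q ^ (r ^ 2 + 3 * r) * (qPoch (-q ^ 2) (q ^ 2) r / qPoch (-q ^ (3 + 1)) (q ^ 2) r) *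
      ((1 - q ^ (4 * r + 4)) / ((1 - q ^ 4) * (1 - q)) * (q ^ (3 * r ^ 2 + 4 * r) * thetaT' q r)) =
      (1 + q ^ 2) / ((1 - q ^ 4) * (1 - q)) * T0Hecke q r := by
    intro r
    have h4 : 1 + q ^ (2 * r + 2) ≠ 0 := one_add_pow_ne_zero hq (2 * r + 1)
    rw [hdiv, T0Hecke_eq, show q ^ (4 * r + 4) = q ^ (2 * r + 2) * q ^ (2 * r + 2) by ring,
      show q ^ (4 * r ^ 2 + 7 * r) = q ^ (r ^ 2 + 3 * r) * q ^ (3 * r ^ 2 + 4 * r) by ring,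
      show 1 - q ^ (2 * r + 2) * q ^ (2 * r + 2) =
        (1 - q ^ (2 * r + 2)) * (1 + q ^ (2 * r + 2)) by ring]
    generalize (1 - q ^ 4) * (1 - q) = D at *
    field_simp
  have hL : ∀ n, q ^ (n ^ 2 + 3 * n) * qPoch (-q ^ 2) (q ^ 2) n * (1 / qPoch (-q ^ 3) (q ^ 2) n) =
      (1 + q) / q ^ 2 * T0Term q n := by
    intro n
    rw [qPoch_odd_succ hq, T0Term,
      show q ^ ((n + 1) * (n + 2)) = q ^ (n ^ 2 + 3 * n) * q ^ 2 by ring]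
    field_simp
  simp only [hR, hL, tsum_mul_left] at key
  have e1 : qPochInf (-q ^ 2) (q ^ 2) = (1 + q ^ 2) * qPochInf (-q ^ (3 + 1)) (q ^ 2) := by
    rw [qPochInf_eq_one_sub_mul _ hq2, sub_neg_eq_add]
    congr 2; ring
  have e2 : qPochInf (q ^ 2) (q ^ 2) =
      (1 - q ^ 2) * (1 - q ^ 4) * qPochInf (q ^ 4 * q ^ 2) (q ^ 2) := by
    rw [qPochInf_eq_one_sub_mul _ hq2, qPochInf_eq_one_sub_mul _ hq2,
      show q ^ 2 * q ^ 2 = q ^ 4 by ring]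
    ring
  have h4 : 1 - q ^ 4 ≠ 0 := one_sub_pow_ne_zero hq 3
  rw [T0, e1, e2]
  refine mul_left_cancel₀ (div_ne_zero h1 (pow_ne_zero 2 hq0)) (key.trans ?_)
  have e3 : 1 - q ^ 4 = (1 - q) * (1 + q) * (1 + q ^ 2) := by ring
  have e4 : 1 - q ^ 2 = (1 - q) * (1 + q) := by ring
  rw [e3, e4]
  field_simp

lemma qPoch_odd_succ' (hq : ‖q‖ < 1) (n : ℕ) :
    1 / qPoch (q ^ 3) (q ^ 2) n = (1 - q) / qPoch q (q ^ 2) (n + 1) := by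
  have h1 : 1 - q ≠ 0 := one_sub_ne_zero_of_norm_lt hq
  rw [qPoch_succ', show q * q ^ 2 = q ^ 3 by ring]
  field_simp

theorem V1_eq_hecke (hq : ‖q‖ < 1) (hq0 : q ≠ 0) :
    V1 q = q * (qPochInf (-q) (q ^ 2) / qPochInf (q ^ 2) (q ^ 2)) * ∑' n, V1Hecke q n := by
  have hq2 := norm_sq_lt_one hq
  have h1 : 1 + q ≠ 0 := by simpa using one_add_pow_ne_zero hq 0
  have h0 : 1 - q ≠ 0 := one_sub_ne_zero_of_norm_lt hq
  have hα := summable_norm_neg_one_pow_mul (summable_norm_thetaV hq hq0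
    (N := fun r => 3 * r ^ 2 + 2 * r)
    (((tendsto_pow_of_le hq (N := fun r => 2 * r + 1) fun n => by omega).const_add 1).div_const
      (1 + q)) fun n => by nlinarith)
  have key := bailey_lemma_sq (z := -q) 2 hq hq0 (neg_ne_zero.2 hq0)
    (by rw [← pow_add]; exact norm_pow_succ_lt_one hq 3) (by ring)
    (hα.congr fun r => by congr 1; ring) (isBaileyPair_thetaV hq hq0)
  have hR : ∀ r, q ^ (r ^ 2 + 2 * r) * (qPoch (-q) (q ^ 2) r / qPoch (-q ^ (2 + 1)) (q ^ 2) r) *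
      ((1 + q ^ (2 * r + 1)) / (1 + q) * ((-1) ^ r * q ^ (3 * r ^ 2 + 2 * r) * thetaV q r)) =
      V1Hecke q r := by
    intro r
    have h3 := one_add_pow_ne_zero hq (2 * r)
    rw [qPoch_div_cube hq, V1Hecke_eq]
    field_simp
    ring
  have hL : ∀ n, q ^ (n ^ 2 + 2 * n) * qPoch (-q) (q ^ 2) n * (1 / qPoch (q ^ 3) (q ^ 2) n) =
      (1 - q) / q * V1Term q n := by
    intro n
    rw [qPoch_odd_succ' hq, V1Term, show q ^ ((n + 1) ^ 2) = q ^ (n ^ 2 + 2 * n) * q by ring]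
    field_simp
  simp only [hR, hL, tsum_mul_left] at key
  rw [V1, qPochInf_sq hq, qPochInf_neg_cube hq]
  refine mul_left_cancel₀ (div_ne_zero h0 hq0) (key.trans ?_)
  rw [show 1 - q ^ 2 = (1 - q) * (1 + q) by ring]
  field_simp

theorem V0_eq_hecke (hq : ‖q‖ < 1) (hq0 : q ≠ 0) :
    V0 q = -1 + 2 * (qPochInf (-q) (q ^ 2) / qPochInf (q ^ 2) (q ^ 2)) * ∑' n, V0Hecke q n := by
  have hq2 := norm_sq_lt_one hq
  have h0 : 1 - q ≠ 0 := one_sub_ne_zero_of_norm_lt hq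
  have h1 : 1 + q ≠ 0 := by simpa using one_add_pow_ne_zero hq 0
  have hne := one_sub_pow_ne_zero hq
  set A : ℕ → ℂ := fun r =>
    (-1) ^ r * ((1 - q) / (1 - q ^ (2 * r + 1)) * (q ^ (3 * r ^ 2 + 2 * r) * thetaV q r)) with hAdef
  have hpair : IsBaileyPair (q ^ 2) (q ^ 2)
      (fun r => (1 - (q ^ 2) ^ (2 * r + 1)) / (1 - q ^ 2) * A r)
      (fun n => 1 / qPoch (q ^ 3) (q ^ 2) n) := by
    convert isBaileyPair_thetaV hq hq0 using 2
    rename_i r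
    have h3 := hne (2 * r)
    rw [hAdef, show (q ^ 2) ^ (2 * r + 1) = q ^ (2 * r + 1) * q ^ (2 * r + 1) by ring,
      show 1 - q ^ (2 * r + 1) * q ^ (2 * r + 1) =
        (1 - q ^ (2 * r + 1)) * (1 + q ^ (2 * r + 1)) by ring,
      show 1 - q ^ 2 = (1 - q) * (1 + q) by ring]
    field_simp
  -- the factor `1 - q^{2n+1}` gained here turns `1 / (q³; q²)_n` into `(1 - q) / (q; q²)_n`
  have hlow := hpair.lower q hq2
  have hlim : Tendsto (fun r : ℕ => (1 - q) / (1 - q ^ (2 * r + 1))) atTop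
      (𝓝 ((1 - q) / (1 - 0))) :=
    tendsto_const_nhds.div
      ((tendsto_pow_of_le hq (N := fun r => 2 * r + 1) fun n => by omega).const_sub 1) (by simp)
  have hA : Summable fun r => ‖A r‖ :=
    summable_norm_neg_one_pow_mul (summable_norm_thetaV hq hq0 (N := fun r => 3 * r ^ 2 + 2 * r)
      hlim fun n => by nlinarith)
  have hA1 : Summable fun r => ‖A r * (1 - q * (q ^ 2) ^ r)‖ := by
    simpa [mul_comm] using summable_norm_mul_of_tendsto
      (((tendsto_pow_zero hq2).const_mul q).const_sub 1) hA
  have hA2 : Summable fun r => ‖A r * ((q ^ 2) ^ (2 * r + 1) - q * (q ^ 2) ^ r)‖ := by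
    simpa [mul_comm] using summable_norm_mul_of_tendsto
      ((tendsto_pow_of_le hq2 (N := fun r => 2 * r + 1) fun n => by omega).sub
        ((tendsto_pow_zero hq2).const_mul q)) hA
  have hA3 : Summable fun r => if r = 0 then (0 : ℂ) else
      A (r - 1) * ((q ^ 2) ^ (2 * r - 1) - q * (q ^ 2) ^ (r - 1)) := by
    rw [← summable_nat_add_iff 1]
    refine hA2.of_norm.congr fun r => ?_
    rw [if_neg r.succ_ne_zero, Nat.add_sub_cancel, show 2 * (r + 1) - 1 = 2 * r + 1 by omega]
  have key := bailey_lemma_sq (z := -q) 0 hq hq0 (neg_ne_zero.2 hq0)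
    (by rw [one_mul]; exact hq2) (by ring) (hA1.of_norm.sub hA3).norm hlow
  have hw := mul_pow_ne_one (norm_neg_lt_one hq) hq2
  have hR : ∀ r, q ^ (r ^ 2 + 0 * r) *
      (qPoch (-q) (q ^ 2) r / qPoch (-q ^ (0 + 1)) (q ^ 2) r) *
      (A r * (1 - q * (q ^ 2) ^ r) - if r = 0 then (0 : ℂ) else
        A (r - 1) * ((q ^ 2) ^ (2 * r - 1) - q * (q ^ 2) ^ (r - 1))) =
      (1 - q) * ((-1) ^ r * (q ^ (4 * r ^ 2 + 2 * r) * thetaV q r) - if r = 0 then (0 : ℂ) else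
        (fun r => -((-1) ^ r * (q ^ (4 * r ^ 2 + 6 * r + 2) * thetaV q r))) (r - 1)) := by
    intro r
    have h3 := hne (2 * r)
    have e1 : A r * (1 - q * (q ^ 2) ^ r) =
        (-1) ^ r * ((1 - q) * (q ^ (3 * r ^ 2 + 2 * r) * thetaV q r)) := by
      rw [hAdef, show q * (q ^ 2) ^ r = q ^ (2 * r + 1) by ring]
      field_simp
    rw [zero_add, pow_one, div_self (qPoch_ne_zero hw r), e1]
    rcases r with _ | r
    · simp
    · have h4 := hne (2 * r)
      have e2 : A r * ((q ^ 2) ^ (2 * r + 1) - q * (q ^ 2) ^ r) =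
          -((-1) ^ r * ((1 - q) * (q ^ (2 * r + 1) * (q ^ (3 * r ^ 2 + 2 * r) * thetaV q r)))) := by
        rw [hAdef, show q * (q ^ 2) ^ r = q ^ (2 * r + 1) by ring,
          show (q ^ 2) ^ (2 * r + 1) = q ^ (2 * r + 1) * q ^ (2 * r + 1) by ring]
        field_simp
        ring
      rw [if_neg r.succ_ne_zero, if_neg r.succ_ne_zero, Nat.add_sub_cancel,
        show 2 * (r + 1) - 1 = 2 * r + 1 by omega, e2]
      ring
  have hL : ∀ n, q ^ (n ^ 2 + 0 * n) * qPoch (-q) (q ^ 2) n *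
      ((1 - q * (q ^ 2) ^ n) * (1 / qPoch (q ^ 3) (q ^ 2) n)) = (1 - q) * V0Term q n := by
    intro n
    have h3 : 1 - q * (q ^ 2) ^ n ≠ 0 := sub_ne_zero.2 (mul_pow_ne_one hq hq2 n).symm
    rw [qPoch_odd_succ' hq, V0Term, qPoch_succ, zero_mul, add_zero]
    field_simp
  simp only [hR, hL, tsum_mul_left] at key
  have htel := tsum_telescoped (fun r => (-1) ^ r * (q ^ (4 * r ^ 2 + 2 * r) * thetaV q r))
    (fun r => -((-1) ^ r * (q ^ (4 * r ^ 2 + 6 * r + 2) * thetaV q r))) ?_ ?_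
  · rw [htel] at key
    rw [V0, mul_assoc 2]
    congr 2
    refine mul_left_cancel₀ h0 (key.trans ?_)
    rw [one_mul, zero_add, pow_one, mul_left_comm]
    congr 2
    refine tsum_congr fun r => ?_
    rw [V0Hecke_eq]
    ring
  · exact (summable_norm_neg_one_pow_mul (by
      simpa using summable_norm_thetaV hq hq0 (N := fun r => 4 * r ^ 2 + 2 * r) (g := fun _ => 1)
        tendsto_const_nhds fun n => by nlinarith)).of_norm
  · exact (summable_norm_neg_one_pow_mul (by
      simpa using summable_norm_thetaV hq hq0 (N := fun r => 4 * r ^ 2 + 6 * r + 2)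
        (g := fun _ => 1) tendsto_const_nhds fun n => by nlinarith)).of_norm.neg

end

/-! ### The two Appell–Lerch series for `V1` -/

section

variable {q : ℂ}

/-- `V₁ / q` is the first of the three Eulerian series, in base `q²` and at `x = q`. -/
lemma V1Term_eq (q : ℂ) (n : ℕ) : V1Term q n = q * eulerTerm (q ^ 2) q n := by
  rw [V1Term, eulerTerm, ← sq_pow_choose_two]; ring

lemma V1_eq_eulerTerm (q : ℂ) : V1 q = q * ∑' n, eulerTerm (q ^ 2) q n := by
  simp only [V1, V1Term_eq, tsum_mul_left]

lemma tendsto_div_one_sub (hq : ‖q‖ < 1) {N : ℕ → ℕ} (hN : ∀ n, n ≤ N n) :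
    Tendsto (fun n => 1 / (1 - q ^ N n)) atTop (𝓝 (1 / (1 - 0))) :=
  tendsto_const_nhds.div ((tendsto_pow_of_le hq hN).const_sub 1) (by simp)

lemma summable_V1Appell (hq : ‖q‖ < 1) : Summable (V1Appell q) := by
  have hlim : Tendsto (fun n : ℕ => (1 - q ^ (2 * n + 1)) / (1 + q ^ (4 * n + 2))) atTop
      (𝓝 ((1 - 0) / (1 + 0))) :=
    ((tendsto_pow_of_le hq fun n => by omega).const_sub 1).div
      ((tendsto_pow_of_le hq fun n => by omega).const_add 1) (by simp)
  refine ((summable_norm_neg_one_pow_mul (summable_norm_mul_of_tendsto hlim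
    (summable_norm_pow hq (N := fun n => n ^ 2 + 2 * n) fun n => by nlinarith))).of_norm).congr
      fun n => ?_
  rw [V1Appell]; ring

/-- The pair of `isBaileyPair_appell` in base `q²` with `y = iq`, `w = -iq`, for which
`(y; q²)_n (w; q²)_n = (-q²; q⁴)_n`, and Bailey's lemma with `ρ₁ = -q²`, `ρ₂ = -q`. -/
theorem V1_eq_appell (hq : ‖q‖ < 1) (hq0 : q ≠ 0) :
    V1 q = q * (qPochInf (-q) q / qPochInf q q) * ∑' n, V1Appell q n := by
  have hq2 := norm_sq_lt_one hq
  have h1 : 1 + q ≠ 0 := by simpa using one_add_pow_ne_zero hq 0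
  have h2 : 1 - q ^ 2 ≠ 0 := one_sub_ne_zero_of_norm_lt hq2
  have hI := Complex.I_sq
  have hy : ∀ k : ℕ, Complex.I * q * (q ^ 2) ^ k ≠ 1 := mul_pow_ne_one (by simpa using hq) hq2
  have hw : ∀ k : ℕ, -(Complex.I * q) * (q ^ 2) ^ k ≠ 1 := mul_pow_ne_one (by simpa using hq) hq2
  have hpair := isBaileyPair_appell hq2
    (show Complex.I * q * -(Complex.I * q) = q ^ 2 by linear_combination -q ^ 2 * hI) hy hw
  have hden : ∀ r : ℕ, (1 - Complex.I * q * (q ^ 2) ^ r) * (1 - -(Complex.I * q) * (q ^ 2) ^ r) =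
      1 + q ^ (4 * r + 2) := fun r => by
    rw [show q ^ (4 * r + 2) = q ^ 2 * ((q ^ 2) ^ r) ^ 2 by ring]
    linear_combination -q ^ 2 * ((q ^ 2) ^ r) ^ 2 * hI
  have hβ : ∀ n : ℕ, qPoch (Complex.I * q) (q ^ 2) n * qPoch (-(Complex.I * q)) (q ^ 2) n =
      qPoch (-q ^ 2) ((q ^ 2) ^ 2) n := fun n => by
    rw [qPoch_mul_qPoch_neg, mul_pow, hI, neg_one_mul]
  have hexp : ∀ r : ℕ, (q ^ 2) ^ ((r + 1).choose 2) * q ^ (r + 1) = q ^ ((r + 1) ^ 2) :=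
    fun r => sq_pow_choose_two q (r + 1)
  simp only [hden, hβ] at hpair
  have hα : Summable fun r : ℕ => ‖(-1) ^ r * (q ^ 2) ^ ((r + 1).choose 2) *
      (1 - (q ^ 2) ^ (2 * r + 1)) / ((1 - q ^ 2) * (1 + q ^ (4 * r + 2)))‖ := by
    have hlim : Tendsto (fun r : ℕ => (1 - (q ^ 2) ^ (2 * r + 1)) /
        ((1 - q ^ 2) * (1 + q ^ (4 * r + 2)))) atTop (𝓝 ((1 - 0) / ((1 - q ^ 2) * (1 + 0)))) :=
      ((tendsto_pow_of_le hq2 fun n => by omega).const_sub 1).div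
        (((tendsto_pow_of_le hq fun n => by omega).const_add 1).const_mul _) (by simpa using h2)
    refine (summable_norm_neg_one_pow_mul (summable_norm_mul_of_tendsto hlim
      (summable_norm_pow hq2 (N := fun r => (r + 1).choose 2) fun r => ?_))).congr fun r => ?_
    · rw [Nat.choose_succ_succ r 1, Nat.choose_one_right]; omega
    · congr 1; ring
  have e1 : q ^ 2 * q ^ 2 * (-q ^ 2)⁻¹ = -q ^ 2 := by field_simp
  have e2 : q ^ 2 * q ^ 2 * (-q)⁻¹ = -q ^ 3 := by field_simp
  have e3 : q ^ 2 * q ^ 2 * (-q ^ 2)⁻¹ * (-q)⁻¹ = q := by field_simp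
  have hnq2 := norm_neg_pow_succ_lt_one hq 1
  have key := bailey_lemma (d := (-q ^ 2)⁻¹) (e := (-q)⁻¹) hq2 (pow_ne_zero 2 hq0)
    (mul_pow_ne_one (by rw [← pow_add]; exact norm_pow_succ_lt_one hq 3) hq2)
    (by rw [e3]; exact hq) (by rw [e1]; exact mul_pow_ne_one hnq2 hq2)
    (by rw [e2]; exact mul_pow_ne_one (norm_neg_pow_succ_lt_one hq 2) hq2) hα hpair
  rw [e3, e1, e2] at key
  have hwt : ∀ n, baileyWeight (q ^ 2) (q ^ 2) (-q ^ 2)⁻¹ (-q)⁻¹ n =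
      q ^ n * (qPoch (-q) (q ^ 2) n * qPoch (-q ^ 2) (q ^ 2) n) := fun n => by
    rw [baileyWeight, revPoch_inv (neg_ne_zero.2 (pow_ne_zero 2 hq0)),
      revPoch_inv (neg_ne_zero.2 hq0)]
    have : (-q ^ 2)⁻¹ ^ n * (-q)⁻¹ ^ n * (q ^ 2 * q ^ 2) ^ n = q ^ n := by
      rw [← mul_pow, ← mul_pow]; congr 1; field_simp
    linear_combination (qPoch (-q) (q ^ 2) n * qPoch (-q ^ 2) (q ^ 2) n) * this
  have hR : ∀ r, baileyWeight (q ^ 2) (q ^ 2) (-q ^ 2)⁻¹ (-q)⁻¹ r /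
      (qPoch (-q ^ 2) (q ^ 2) r * qPoch (-q ^ 3) (q ^ 2) r) *
      ((-1) ^ r * (q ^ 2) ^ ((r + 1).choose 2) *
      (1 - (q ^ 2) ^ (2 * r + 1)) / ((1 - q ^ 2) * (1 + q ^ (4 * r + 2)))) =
      (1 + q) / (1 - q ^ 2) * V1Appell q r := fun r => by
    have h3 := qPoch_ne_zero (mul_pow_ne_one hnq2 hq2) r
    have h4 := one_add_pow_ne_zero hq (2 * r)
    have h5 := one_add_pow_ne_zero hq (4 * r + 1)
    have h6 : baileyWeight (q ^ 2) (q ^ 2) (-q ^ 2)⁻¹ (-q)⁻¹ r /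
        (qPoch (-q ^ 2) (q ^ 2) r * qPoch (-q ^ 3) (q ^ 2) r) =
        q ^ r * (qPoch (-q) (q ^ 2) r / qPoch (-q ^ 3) (q ^ 2) r) := by
      rw [hwt]; field_simp
    have h7 : (q ^ 2) ^ ((r + 1).choose 2) * q ^ r = q ^ (r ^ 2 + 2 * r) := by
      refine mul_right_cancel₀ hq0 ?_
      rw [mul_assoc, ← pow_succ, hexp]; ring
    rw [h6, qPoch_div_cube hq, V1Appell, ← h7,
      show (q ^ 2) ^ (2 * r + 1) = q ^ (2 * r + 1) * q ^ (2 * r + 1) by ring]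
    field_simp
    ring
  simp only [hR, tsum_mul_left] at key
  have hL : ∑' n, eulerTermAppell (q ^ 2) q n = _ := (tsum_congr fun n => by
    rw [eulerTermAppell, hwt]; ring).trans key
  rw [V1_eq_eulerTerm, tsum_eulerTerm_eq_appell hq2 hq, hL, qPochInf_eq_even_mul_odd (-q) hq,
    qPochInf_eq_even_mul_odd q hq, show -q * q = -q ^ 2 by ring, show q * q = q ^ 2 by ring,
    qPochInf_neg_cube hq, qPochInf_sq hq]
  field_simp

lemma V1GordonMcIntosh_natCast (q : ℂ) (n : ℕ) : V1GordonMcIntosh q n =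
    (-1) ^ n * (1 / (1 - q ^ (4 * n + 1)) * q ^ ((2 * n + 1) ^ 2)) := by
  rw [V1GordonMcIntosh, show ((2 * (n : ℤ) + 1) ^ 2) = ((2 * n + 1) ^ 2 : ℕ) by push_cast; ring,
    show 4 * (n : ℤ) + 1 = ((4 * n + 1 : ℕ) : ℤ) by push_cast; ring]
  simp only [zpow_natCast]
  ring

lemma V1GordonMcIntosh_neg (hq : ‖q‖ < 1) (hq0 : q ≠ 0) (n : ℕ) :
    V1GordonMcIntosh q (-((n : ℤ) + 1)) =
      (-1) ^ n * (1 / (1 - q ^ (4 * n + 3)) * q ^ ((2 * n + 1) ^ 2 + (4 * n + 3))) := by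
  have h := one_sub_pow_ne_zero hq (4 * n + 2)
  have h' : q ^ (4 * n + 3) - 1 ≠ 0 := by rw [← neg_sub]; exact neg_ne_zero.2 h
  have h0 := pow_ne_zero (4 * n + 3) hq0
  rw [V1GordonMcIntosh, neg_one_zpow_neg, neg_one_zpow_natCast_succ,
    show ((2 * -((n : ℤ) + 1) + 1) ^ 2) = ((2 * n + 1) ^ 2 : ℕ) by push_cast; ring,
    show 4 * -((n : ℤ) + 1) + 1 = -((4 * n + 3 : ℕ) : ℤ) by push_cast; ring, zpow_neg]
  simp only [zpow_natCast]
  have h2 : 1 - (q ^ (4 * n + 3))⁻¹ = -(1 - q ^ (4 * n + 3)) / q ^ (4 * n + 3) := by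
    field_simp; ring
  rw [h2, pow_add q ((2 * n + 1) ^ 2), pow_succ]
  field_simp

lemma summable_V1GordonMcIntosh_natCast (hq : ‖q‖ < 1) :
    Summable fun n : ℕ => V1GordonMcIntosh q n := by
  simp only [V1GordonMcIntosh_natCast]
  exact (summable_norm_neg_one_pow_mul (summable_norm_mul_of_tendsto
    (tendsto_div_one_sub hq fun n => by omega) (summable_norm_pow hq fun n => by nlinarith))).of_norm

lemma summable_V1GordonMcIntosh_neg (hq : ‖q‖ < 1) (hq0 : q ≠ 0) :
    Summable fun n : ℕ => V1GordonMcIntosh q (-((n : ℤ) + 1)) := by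
  simp only [V1GordonMcIntosh_neg hq hq0]
  exact (summable_norm_neg_one_pow_mul (summable_norm_mul_of_tendsto
    (tendsto_div_one_sub hq fun n => by omega) (summable_norm_pow hq fun n => by nlinarith))).of_norm

lemma summable_V1GordonMcIntosh (hq : ‖q‖ < 1) (hq0 : q ≠ 0) : Summable (V1GordonMcIntosh q) :=
  (summable_V1GordonMcIntosh_natCast hq).of_nat_of_neg_add_one (summable_V1GordonMcIntosh_neg hq hq0)

/-- The Gordon–McIntosh series, with the terms of index `r` and `-1 - r` combined. -/
lemma tsum_V1GordonMcIntosh (hq : ‖q‖ < 1) (hq0 : q ≠ 0) :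
    ∑' n : ℤ, V1GordonMcIntosh q n = ∑' r : ℕ, q * ((-1) ^ r * (q ^ (4 * r ^ 2 + 4 * r) *
      (1 - q ^ (8 * r + 4)) / ((1 - q ^ (4 * r + 1)) * (1 - q ^ (4 * r + 3))))) := by
  have s1 := summable_V1GordonMcIntosh_natCast hq
  have s2 := summable_V1GordonMcIntosh_neg hq hq0
  rw [tsum_of_nat_of_neg_add_one s1 s2, ← s1.tsum_add s2]
  refine tsum_congr fun r => ?_
  have h1 := one_sub_pow_ne_zero hq (4 * r)
  have h2 := one_sub_pow_ne_zero hq (4 * r + 2)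
  rw [V1GordonMcIntosh_natCast, V1GordonMcIntosh_neg hq hq0,
    show q ^ (8 * r + 4) = q ^ (4 * r + 1) * q ^ (4 * r + 3) by ring,
    show q ^ ((2 * r + 1) ^ 2) = q * q ^ (4 * r ^ 2 + 4 * r) by ring,
    show q ^ ((2 * r + 1) ^ 2 + (4 * r + 3)) = q * q ^ (4 * r ^ 2 + 4 * r) * q ^ (4 * r + 3) by ring]
  field_simp
  ring

/-- The pair of `isBaileyPair_appell` in base `q⁴` with `y = q`, `w = q³`, for which
`(y; q⁴)_n (w; q⁴)_n = (q; q²)_{2n}`, and Bailey's lemma with `ρ₁ → ∞`, `ρ₂ = -q⁴`. -/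
theorem V1_eq_gordonMcIntosh (hq : ‖q‖ < 1) (hq0 : q ≠ 0) :
    V1 q = qPochInf (-q ^ 4) (q ^ 4) / qPochInf (q ^ 4) (q ^ 4) *
      ∑' n : ℤ, V1GordonMcIntosh q n := by
  have hq2 := norm_sq_lt_one hq
  have hq4 : ‖q ^ 4‖ < 1 := norm_pow_succ_lt_one hq 3
  have h4 : 1 - q ^ 4 ≠ 0 := one_sub_ne_zero_of_norm_lt hq4
  have hpair := isBaileyPair_appell hq4 (show q * q ^ 3 = q ^ 4 by ring)
    (mul_pow_ne_one hq hq4) (mul_pow_ne_one (norm_pow_succ_lt_one hq 2) hq4)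
  have hβ : ∀ n : ℕ, qPoch q (q ^ 4) (n + 1) * qPoch (q ^ 3) (q ^ 4) (n + 1) =
      qPoch q (q ^ 2) (2 * n + 2) := fun n => by
    rw [show 2 * n + 2 = 2 * (n + 1) by ring, qPoch_two_mul, show (q ^ 2) ^ 2 = q ^ 4 by ring,
      show q * q ^ 2 = q ^ 3 by ring]
  simp only [hβ] at hpair
  have hα : Summable fun r : ℕ => ‖(-1) ^ r * (q ^ 4) ^ ((r + 1).choose 2) *
      (1 - (q ^ 4) ^ (2 * r + 1)) /
        ((1 - q ^ 4) * ((1 - q * (q ^ 4) ^ r) * (1 - q ^ 3 * (q ^ 4) ^ r)))‖ := by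
    have hlim : Tendsto (fun r : ℕ => (1 - (q ^ 4) ^ (2 * r + 1)) /
        ((1 - q ^ 4) * ((1 - q * (q ^ 4) ^ r) * (1 - q ^ 3 * (q ^ 4) ^ r)))) atTop
        (𝓝 ((1 - 0) / ((1 - q ^ 4) * ((1 - q * 0) * (1 - q ^ 3 * 0))))) :=
      ((tendsto_pow_of_le hq4 fun n => by omega).const_sub 1).div
        (((((tendsto_pow_zero hq4).const_mul q).const_sub 1).mul
          (((tendsto_pow_zero hq4).const_mul _).const_sub 1)).const_mul _) (by simpa using h4)
    refine (summable_norm_neg_one_pow_mul (summable_norm_mul_of_tendsto hlim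
      (summable_norm_pow hq4 (N := fun r => (r + 1).choose 2) fun r => ?_))).congr fun r => ?_
    · rw [Nat.choose_succ_succ r 1, Nat.choose_one_right]; omega
    · congr 1; ring
  have hneg : ∀ k : ℕ, -q ^ 4 * (q ^ 4) ^ k ≠ 1 :=
    mul_pow_ne_one (norm_neg_pow_succ_lt_one hq 3) hq4
  have key := bailey_lemma_limit (z := -q ^ 4) (w := -q ^ 4) hq4 (pow_ne_zero 4 hq0)
    (neg_ne_zero.2 (pow_ne_zero 4 hq0))
    (mul_pow_ne_one (by rw [← pow_add]; exact norm_pow_succ_lt_one hq 7) hq4) (by ring) hneg hα hpair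
  have hexp : ∀ n : ℕ, (q ^ 4) ^ (n.choose 2) * (q ^ 4) ^ n = q ^ (2 * n ^ 2 + 2 * n) := fun n => by
    have := sq_pow_choose_two (q ^ 2) n
    rw [show (q ^ 2) ^ 2 = q ^ 4 by ring] at this
    rw [show (q ^ 4) ^ n = (q ^ 2) ^ n * (q ^ 2) ^ n by ring, ← mul_assoc, this]; ring
  have hR : ∀ r, (q ^ 4) ^ (r.choose 2) * (- -q ^ 4) ^ r *
      (qPoch (-q ^ 4) (q ^ 4) r / qPoch (-q ^ 4) (q ^ 4) r) *
      ((-1) ^ r * (q ^ 4) ^ ((r + 1).choose 2) * (1 - (q ^ 4) ^ (2 * r + 1)) /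
        ((1 - q ^ 4) * ((1 - q * (q ^ 4) ^ r) * (1 - q ^ 3 * (q ^ 4) ^ r)))) =
      1 / (1 - q ^ 4) * ((-1) ^ r * (q ^ (4 * r ^ 2 + 4 * r) *
      (1 - q ^ (8 * r + 4)) / ((1 - q ^ (4 * r + 1)) * (1 - q ^ (4 * r + 3))))) := fun r => by
    have h1 := one_sub_pow_ne_zero hq (4 * r)
    have h2 := one_sub_pow_ne_zero hq (4 * r + 2)
    have hc : (r + 1).choose 2 = r.choose 2 + r := by
      rw [Nat.choose_succ_succ r 1, Nat.choose_one_right, add_comm]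
    rw [div_self (qPoch_ne_zero hneg r), neg_neg, hexp, hc, pow_add (q ^ 4), hexp, show q * (q ^ 4) ^ r = q ^ (4 * r + 1) by ring,
      show q ^ 3 * (q ^ 4) ^ r = q ^ (4 * r + 3) by ring,
      show (q ^ 4) ^ (2 * r + 1) = q ^ (8 * r + 4) by ring]
    field_simp
    ring
  simp only [hR, tsum_mul_left] at key
  have hL : ∑' n, eulerTermBilateral (q ^ 2) q n = _ := (tsum_congr fun n => by
    rw [eulerTermBilateral, neg_neg, hexp, show (q ^ 2) ^ 2 = q ^ 4 by ring]; ring).trans key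
  rw [V1_eq_eulerTerm, tsum_eulerTerm_eq_bilateral hq2 hq, hL, tsum_V1GordonMcIntosh hq hq0,
    tsum_mul_left, qPochInf_eq_one_sub_mul (q ^ 4) hq4]
  field_simp

end

/-! ### The point `q = 0` -/

lemma tsum_eq_zero_of_succ {f : ℕ → ℂ} (h : ∀ n, f (n + 1) = 0) : ∑' n, f n = f 0 :=
  tsum_eq_single 0 fun n hn => by
    obtain ⟨m, rfl⟩ := Nat.exists_eq_succ_of_ne_zero hn; exact h m

lemma summable_of_succ_eq_zero {f : ℕ → ℂ} (h : ∀ n, f (n + 1) = 0) : Summable f :=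
  (summable_nat_add_iff 1).1 (by simpa only [h] using summable_zero)

lemma S0Hecke_zero_succ (n : ℕ) : S0Hecke 0 (n + 1) = 0 := by simp [S0Hecke]
lemma S1Hecke_zero_succ (n : ℕ) : S1Hecke 0 (n + 1) = 0 := by simp [S1Hecke]
lemma T0Hecke_zero_succ (n : ℕ) : T0Hecke 0 (n + 1) = 0 := by simp [T0Hecke]
lemma T1Hecke_zero_succ (n : ℕ) : T1Hecke 0 (n + 1) = 0 := by simp [T1Hecke]
lemma V0Hecke_zero_succ (n : ℕ) : V0Hecke 0 (n + 1) = 0 := by simp [V0Hecke]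
lemma V1Hecke_zero_succ (n : ℕ) : V1Hecke 0 (n + 1) = 0 := by simp [V1Hecke]

lemma V1GordonMcIntosh_zero (n : ℤ) : V1GordonMcIntosh 0 n = 0 := by
  have h : (2 * n + 1) ^ 2 ≠ 0 := pow_ne_zero 2 (by omega)
  simp [V1GordonMcIntosh, zero_zpow _ h]

lemma S0_zero : S0 0 = 1 := by
  rw [S0, tsum_eq_zero_of_succ fun n => by simp [S0Term]]; simp [S0Term]

lemma S1_zero : S1 0 = 1 := by
  rw [S1, tsum_eq_zero_of_succ fun n => by simp [S1Term]]; simp [S1Term]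

lemma T0_zero : T0 0 = 0 := by simp [T0, T0Term]

lemma T1_zero : T1 0 = 1 := by
  rw [T1, tsum_eq_zero_of_succ fun n => by simp [T1Term]]; simp [T1Term, qPoch]

lemma V0_zero : V0 0 = 1 := by
  rw [V0, tsum_eq_zero_of_succ fun n => by simp [V0Term]]; simp [V0Term]; norm_num

lemma V1_zero : V1 0 = 0 := by simp [V1, V1Term]

end MockTheta8

end

open MockTheta8 in
theorem mainTheorem4 (q : ℂ) (hq : ‖q‖ < 1) :
    -- the defining series converge
    (Summable (S0Term q) ∧ Summable (S1Term q) ∧ Summable (T0Term q) ∧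
      Summable (T1Term q) ∧ Summable (V0Term q) ∧ Summable (V1Term q)) ∧
    -- the Hecke-type series converge
    (Summable (S0Hecke q) ∧ Summable (S1Hecke q) ∧ Summable (T0Hecke q) ∧
      Summable (T1Hecke q) ∧ Summable (V0Hecke q) ∧ Summable (V1Hecke q)) ∧
    -- the Appell-Lerch series converge
    (Summable (V1Appell q) ∧ Summable (V1GordonMcIntosh q)) ∧
    -- Hecke-type representations
    S0 q = qPochInf (-q) (q ^ 2) / qPochInf (q ^ 2) (q ^ 2) * ∑' n : ℕ, S0Hecke q n ∧
    S1 q = qPochInf (-q) (q ^ 2) / qPochInf (q ^ 2) (q ^ 2) * ∑' n : ℕ, S1Hecke q n ∧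
    T0 q = q ^ 2 * (qPochInf (-q ^ 2) (q ^ 2) / qPochInf (q ^ 2) (q ^ 2)) *
      ∑' n : ℕ, T0Hecke q n ∧
    T1 q = qPochInf (-q ^ 2) (q ^ 2) / qPochInf (q ^ 2) (q ^ 2) * ∑' n : ℕ, T1Hecke q n ∧
    V0 q = -1 + 2 * (qPochInf (-q) (q ^ 2) / qPochInf (q ^ 2) (q ^ 2)) *
      ∑' n : ℕ, V0Hecke q n ∧
    V1 q = q * (qPochInf (-q) (q ^ 2) / qPochInf (q ^ 2) (q ^ 2)) * ∑' n : ℕ, V1Hecke q n ∧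
    -- the new Appell-Lerch representation
    V1 q = q * (qPochInf (-q) q / qPochInf q q) * ∑' n : ℕ, V1Appell q n ∧
    -- it agrees with the Gordon-McIntosh representation
    q * (qPochInf (-q) q / qPochInf q q) * ∑' n : ℕ, V1Appell q n =
      qPochInf (-q ^ 4) (q ^ 4) / qPochInf (q ^ 4) (q ^ 4) *
        ∑' n : ℤ, V1GordonMcIntosh q n := by
  refine ⟨⟨summable_S0Term hq, summable_S1Term hq, summable_T0Term hq, summable_T1Term hq,
    summable_V0Term hq, summable_V1Term hq⟩, ?_⟩
  rcases eq_or_ne q 0 with rfl | hq0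
  · have hGM : V1GordonMcIntosh 0 = 0 := funext V1GordonMcIntosh_zero
    refine ⟨⟨summable_of_succ_eq_zero S0Hecke_zero_succ, summable_of_succ_eq_zero S1Hecke_zero_succ,
      summable_of_succ_eq_zero T0Hecke_zero_succ, summable_of_succ_eq_zero T1Hecke_zero_succ,
      summable_of_succ_eq_zero V0Hecke_zero_succ, summable_of_succ_eq_zero V1Hecke_zero_succ⟩,
      ⟨summable_V1Appell hq, by rw [hGM]; exact summable_zero⟩, ?_, ?_, ?_, ?_, ?_, ?_, ?_, ?_⟩
    · rw [S0_zero, tsum_eq_zero_of_succ S0Hecke_zero_succ]; simp [S0Hecke]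
    · rw [S1_zero, tsum_eq_zero_of_succ S1Hecke_zero_succ]; simp [S1Hecke]
    · simp [T0_zero]
    · rw [T1_zero, tsum_eq_zero_of_succ T1Hecke_zero_succ]; simp [T1Hecke]
    · rw [V0_zero, tsum_eq_zero_of_succ V0Hecke_zero_succ]; simp [V0Hecke]; norm_num
    · simp [V1_zero]
    · simp [V1_zero]
    · simp [hGM]
  · exact ⟨⟨summable_S0Hecke hq hq0, summable_S1Hecke hq hq0, summable_T0Hecke hq hq0,
      summable_T1Hecke hq hq0, summable_V0Hecke hq hq0, summable_V1Hecke hq hq0⟩,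
      ⟨summable_V1Appell hq, summable_V1GordonMcIntosh hq hq0⟩,
      S0_eq_hecke hq hq0, S1_eq_hecke hq hq0, T0_eq_hecke hq hq0, T1_eq_hecke hq hq0,
      V0_eq_hecke hq hq0, V1_eq_hecke hq hq0, V1_eq_appell hq hq0,
      (V1_eq_appell hq hq0).symm.trans (V1_eq_gordonMcIntosh hq hq0)⟩
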